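/- **Setting.** Let $\mathcal G_h$ be a finite grid, without hanging nodes, of closed axis-parallel rectangles (cells) subdividing a polygon $\Omega$, such that no cell contains two corner nodes of $\partial\Omega$ (boundary vertices at which two boundary edges not on the same line meet). For a cell $K$ let $h_K$ be its longer side length and $\rho_K$ its inscribed circle radius. *Extended grid.* Cells are added locally outside $\Omega$: for each boundary edge of a cell $K$ two layers, of freely chosen widths, are attached to $K$ beyond this edge (for an edge ending at a concave corner the widths are those given by the two grid cells that lie beyond the line of the edge, starting at this corner). If $K$ is a cell of $\mathcal G_h$, the first cell attached to $K$ beyond a boundary edge, or the first cell attached to $K$ diagonally at a convex corner, then $\mathcal M_K$ is the $3\times3$ patch centred at $K$, with side lengths $L_{K,-1},L_K,L_{K,1}$ (in the $x$ direction) and $H_{K,-1},H_K,H_{K,1}$ (in the $y$ direction), made of grid cells and attached cells. Let $\mathcal J_h$ be the set of all these $K$, and $\widetilde\Omega_h=\bigcup_{K\in\mathcal J_h}\mathcal M_K$. It is assumed that all cells $K'$ of all these patches satisfy $h_{K'}/\rho_{K'}\le\gamma_0$, and that the attached cells do not interfere with remote parts of the grid, that is, the interior of each $T\in\mathcal G_h$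 meets the interiors of exactly nine of the patches $\mathcal M_K$, $K\in\mathcal J_h$. *Basis functions.* $\varphi_K$ vanishes outside $\mathcal M_K$; on each of the nine cells of $\mathcal M_K$ it is a polynomial of total degree at most $2$; its values at vertices, and the means of its normal derivative over edges, are continuous in the interior of $\mathcal M_K$ and vanish on $\partial\mathcal M_K$; and at the lower left vertex of $K$ it has the value $\frac{L_{K,-1}}{L_{K,-1}+L_K}\cdot\frac{H_{K,-1}}{H_{K,-1}+H_K}$. (These conditions determine $\varphi_K$ up to its values on the edges of the nine cells.) *Interpolant.* Let $S_1^K,S_2^K,S_3^K,S_4^K$ be the left, right, lower and upper neighbour of $S_5^K=K$ in $\mathcal M_K$, and $$w_1^K=\tfrac{-L_K^2}{(L_{K,-1}+L_K)(L_{K,-1}+L_K+L_{K,1})},\quad w_2^K=\tfrac{-L_K^2}{(L_K+L_{K,1})(L_{K,-1}+L_K+L_{K,1})},$$ $$w_3^K=\tfrac{-H_K^2}{(H_{K,-1}+H_K)(H_{K,-1}+H_K+H_{K,1})},\quad w_4^K=\tfrac{-H_K^2}{(H_K+H_{K,1})(H_{K,-1}+H_K+H_{K,1})},\quad w_5^K=1-\sum_{\mu=1}^4w_\mu^K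 .$$ For $v\in L^1(\widetilde\Omega_h)$ put $\lambda_K(v)=\sum_{\mu=1}^5 w_\mu^K\,\frac1{|S_\mu^K|}\int_{S_\mu^K}v$ and $\widetilde\Pi_hv=\sum_{K\in\mathcal J_h}\lambda_K(v)\,\varphi_K$. For $T\in\mathcal G_h$ let $\Delta_T$ be the union of the patches $\mathcal M_K$, $K\in\mathcal J_h$, that contain $T$. $\|\cdot\|_{0,D}$ is the $L^2(D)$ norm and $|\cdot|_{k,D}$ the Sobolev seminorm of order $k$ on the interior of $D$. **Lemma.** There is a constant $C>0$, depending only on $\gamma_0$, such that for every such grid and extension, every $T\in\mathcal G_h$ and every $v\in L^1(\widetilde\Omega_h)$: (a) if $v|_{\Delta_T}$ is (almost everywhere) a polynomial of total degree at most $2$, then $\widetilde\Pi_hv=v$ almost everywhere on $T$; (b) $|\widetilde\Pi_hv|_{k,T}\le C\,h_T^{-k}\,\|v\|_{0,\Delta_T}$ for every integer $0\le k\le2$ (the right side being $\infty$ if $v\notin L^2(\Delta_T)$); (c) $|v-\widetilde\Pi_hv|_{k,T}\le C\,h_T^{s-k}\,|v|_{s,\Delta_T}$ for all integers $0\le k\le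 s\le3$, if $v\in H^s(\Delta_T)$. -/

import Mathlib

open MeasureTheory MvPolynomial
open scoped ENNReal ContDiff

namespace RRM

/-! ### Rectangles and rectangular grids -/

/-- The plane, with coordinates `x 0`, `x 1`. Its norm is never used. -/
abbrev Pt := Fin 2 → ℝ

/-- A rectangle with sides parallel to the axes, `[lo 0, hi 0] × [lo 1, hi 1]`. -/
@[ext]
structure Rect where
  lo : Pt
  hi : Pt

namespace Rect

/-- The closed rectangle. -/
def closed (K : Rect) : Set Pt := {x | ∀ i, K.lo i ≤ x i ∧ x i ≤ K.hi i}

/-- The open rectangle. -/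
def inner (K : Rect) : Set Pt := {x | ∀ i, K.lo i < x i ∧ x i < K.hi i}

/-- The edge `(i, b)` of `K` is the one on the line `x i = K.face i b`:
the upper one in the direction `i` for `b = true`, the lower one for `b = false`. -/
def face (K : Rect) (i : Fin 2) (b : Bool) : ℝ := if b then K.hi i else K.lo i

def IsVertex (K : Rect) (a : Pt) : Prop := ∀ i, a i = K.lo i ∨ a i = K.hi i

/-- `N` and `K` lie on the two sides of the edge `(i, b)` of `K`, which is a full edge of both. -/
def IsNeighbor (K N : Rect) (i : Fin 2) (b : Bool) : Prop :=
  N.face i (!b) = K.face i b ∧ ∀ j, j ≠ i → N.lo j = K.lo j ∧ N.hi j = K.hi j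

/-- `N` touches `K` and lies beyond the line through the edge `(i, b)` of `K`, next to it. -/
def TouchesBeyond (K N : Rect) (i : Fin 2) (b : Bool) : Prop :=
  N.face i (!b) = K.face i b ∧ (K.closed ∩ N.closed).Nonempty

/-- The size `h_K`: the longer side length. -/
noncomputable def size (K : Rect) : ℝ := max (K.hi 0 - K.lo 0) (K.hi 1 - K.lo 1)

/-- The radius `ρ_K` of the inscribed circle. -/
noncomputable def inradius (K : Rect) : ℝ := min (K.hi 0 - K.lo 0) (K.hi 1 - K.lo 1) / 2

/-- The mean over the edge `(i, b)` of the derivative of `p` in the direction `i`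
(normal to the edge; the same direction is used for both cells at an edge). -/
noncomputable def normalMean (K : Rect) (p : MvPolynomial (Fin 2) ℝ) (i : Fin 2) (b : Bool) : ℝ :=
  (K.hi (1 - i) - K.lo (1 - i))⁻¹ *
    ∫ t in (K.lo (1 - i))..(K.hi (1 - i)),
      eval (Function.update (fun _ => t) i (K.face i b)) (pderiv i p)

end Rect

/-- The closed region covered by a finite set of cells. -/
def region (G : Finset Rect) : Set Pt := ⋃ K ∈ G, K.closed

/-- No cell of the grid lies on the other side of the edge `(i, b)` of `K`. -/
def IsBoundaryEdge (G : Finset Rect) (K : Rect) (i : Fin 2) (b : Bool) : Prop :=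
  ∀ N ∈ G, ¬ K.IsNeighbor N i b

/-- A corner node: a vertex at which two boundary edges meet that are not on the same line. -/
def IsCornerNode (G : Finset Rect) (a : Pt) : Prop :=
  ∀ i, ∃ K ∈ G, ∃ b, IsBoundaryEdge G K i b ∧ K.IsVertex a ∧ a i = K.face i b

/-- `G` is a rectangular grid (without hanging nodes) of a polygon, namely of the interior of
`region G`, and no cell of it contains two corner nodes. -/
structure IsRectGrid (G : Finset Rect) : Prop where
  nondegenerate : ∀ K ∈ G, ∀ i, K.lo i < K.hi i
  disjoint : ∀ K ∈ G, ∀ K' ∈ G, K ≠ K' → Disjoint K.inner K'.inner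
  conforming : ∀ K ∈ G, ∀ K' ∈ G, ∀ a, K'.IsVertex a → a ∈ K.closed → K.IsVertex a
  /-- The boundary of the polygon does not pass twice through a point: two cells opposite to each
  other at a vertex are not the only ones there. -/
  noPinch : ∀ K ∈ G, ∀ K' ∈ G, ∀ s : Fin 2 → Bool,
    (∀ i, K'.face i (!(s i)) = K.face i (s i)) → ∃ i, ¬ IsBoundaryEdge G K i (s i)
  corners : ∀ K ∈ G, ∀ a a', K.IsVertex a → K.IsVertex a' →
    IsCornerNode G a → IsCornerNode G a' → a = a'

/-! ### The reduced rectangular Morley space and its locally supported functions -/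

/-- `w` belongs to the space `V_{h0}^R` on the grid `G`, and `p K` is the quadratic polynomial
that `w` is on the cell `K`: nodal values and edge means of the normal derivative are continuous
in the interior and vanish on the boundary. -/
structure IsReducedMorley₀ (G : Finset Rect) (w : Pt → ℝ)
    (p : Rect → MvPolynomial (Fin 2) ℝ) : Prop where
  degree : ∀ K ∈ G, (p K).totalDegree ≤ 2
  pieces : ∀ K ∈ G, ∀ x ∈ K.inner, w x = eval x (p K)
  vertex_continuous : ∀ a, ∀ K ∈ G, ∀ K' ∈ G, K.IsVertex a → K'.IsVertex a →
    eval a (p K) = eval a (p K')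
  vertex_boundary : ∀ a ∈ frontier (region G), ∀ K ∈ G, K.IsVertex a → eval a (p K) = 0
  edge_continuous : ∀ K ∈ G, ∀ N ∈ G, ∀ i b, K.IsNeighbor N i b →
    K.normalMean (p K) i b = N.normalMean (p N) i (!b)
  edge_boundary : ∀ K ∈ G, ∀ i b, IsBoundaryEdge G K i b → K.normalMean (p K) i b = 0

/-- A `3 × 3` patch, given by its four grid lines in each of the two directions. The cell `K` in
its centre is `Patch.cell M (fun _ => 1)`. -/
abbrev Patch := Fin 2 → Fin 4 → ℝ

namespace Patch

/-- The side lengths: `L_{K,-1}, L_K, L_{K,1}` for `i = 0` and `H_{K,-1}, H_K, H_{K,1}` for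
`i = 1`. -/
def len (M : Patch) (i : Fin 2) (m : Fin 3) : ℝ := M i m.succ - M i m.castSucc

/-- The nine cells. -/
def cell (M : Patch) (m : Fin 2 → Fin 3) : Rect :=
  ⟨fun i => M i (m i).castSucc, fun i => M i (m i).succ⟩

open scoped Classical in
/-- The patch as a grid of nine cells. -/
noncomputable def grid (M : Patch) : Finset Rect := Finset.univ.image M.cell

/-- The closed rectangle that the patch covers. -/
def closed (M : Patch) : Set Pt := {x | ∀ i, M i 0 ≤ x i ∧ x i ≤ M i 3}

/-- The open rectangle that the patch covers. -/
def inner (M : Patch) : Set Pt := {x | ∀ i, M i 0 < x i ∧ x i < M i 3}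

/-- `φ` is a function `φ_K`: it vanishes outside the patch, is in `V_{h0}^R` of the patch, and
has the prescribed value at the interior vertex `X_{1,1}`, the lower left vertex of `K`. -/
def IsBasisFunction (M : Patch) (φ : Pt → ℝ) : Prop :=
  (∀ x ∉ M.closed, φ x = 0) ∧
  ∃ p, IsReducedMorley₀ M.grid φ p ∧
    eval (fun i => M i 1) (p (M.cell fun _ => 1)) =
      (M.len 0 0 / (M.len 0 0 + M.len 0 1)) * (M.len 1 0 / (M.len 1 0 + M.len 1 1))

/-! Existence of a basis function, by an explicit formula: on a cell it is a quadratic polynomial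
built from the values and slopes of two univariate quadratic B-splines at the lines of the patch. -/

/-- The value of the spline in the direction `i` at the line `t`. -/
noncomputable def splVal (M : Patch) (i : Fin 2) (t : ℝ) : ℝ :=
  if t = M i 1 then M.len i 0 / (M.len i 0 + M.len i 1)
  else if t = M i 2 then M.len i 2 / (M.len i 1 + M.len i 2) else 0

/-- The slope of the spline in the direction `i` at the line `t`. -/
noncomputable def splDer (M : Patch) (i : Fin 2) (t : ℝ) : ℝ :=
  if t = M i 1 then 2 / (M.len i 0 + M.len i 1)
  else if t = M i 2 then - 2 / (M.len i 1 + M.len i 2) else 0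

/-- The linear interpolant of the spline in the direction `i` on the side of `K`. -/
noncomputable def linPart (M : Patch) (K : Rect) (i : Fin 2) : MvPolynomial (Fin 2) ℝ :=
  C (M.splVal i (K.lo i)) +
    C ((M.splVal i (K.hi i) - M.splVal i (K.lo i)) / (K.hi i - K.lo i)) * (X i - C (K.lo i))

/-- The quadratic rest of that spline, times the mean of the end values of the other one. -/
noncomputable def quadPart (M : Patch) (K : Rect) (i : Fin 2) : MvPolynomial (Fin 2) ℝ :=
  C ((M.splDer i (K.hi i) - M.splDer i (K.lo i)) / (2 * (K.hi i - K.lo i)) *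
      ((M.splVal (1 - i) (K.lo (1 - i)) + M.splVal (1 - i) (K.hi (1 - i))) / 2)) *
    ((X i - C (K.lo i)) * (X i - C (K.hi i)))

/-- The quadratic polynomial on the cell `K`. -/
noncomputable def piece (M : Patch) (K : Rect) : MvPolynomial (Fin 2) ℝ :=
  M.linPart K 0 * M.linPart K 1 + M.quadPart K 0 + M.quadPart K 1

theorem piece_degree (M : Patch) (K : Rect) : (M.piece K).totalDegree ≤ 2 := by
  have hX : ∀ (i : Fin 2) (c : ℝ), (X i - C c : MvPolynomial (Fin 2) ℝ).totalDegree ≤ 1 := by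
    intro i c
    refine (totalDegree_sub _ _).trans ?_
    simp
  have hl : ∀ i, (M.linPart K i).totalDegree ≤ 1 := by
    intro i
    refine (totalDegree_add _ _).trans (max_le (by simp) ?_)
    refine (totalDegree_mul _ _).trans ?_
    simpa using hX _ _
  have hq : ∀ i, (M.quadPart K i).totalDegree ≤ 2 := by
    intro i
    refine (totalDegree_mul _ _).trans ?_
    have := (totalDegree_mul (X i - C (K.lo i) : MvPolynomial (Fin 2) ℝ) (X i - C (K.hi i)))
    have h1 := hX i (K.lo i)
    have h2 := hX i (K.hi i)
    rw [totalDegree_C]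
    omega
  refine (totalDegree_add _ _).trans (max_le ((totalDegree_add _ _).trans (max_le ?_ (hq 0))) (hq 1))
  have := totalDegree_mul (M.linPart K 0) (M.linPart K 1)
  have h1 := hl 0
  have h2 := hl 1
  omega

theorem piece_vertex (M : Patch) (K : Rect) (hK : ∀ i, K.lo i < K.hi i) (a : Pt)
    (ha : K.IsVertex a) : eval a (M.piece K) = M.splVal 0 (a 0) * M.splVal 1 (a 1) := by
  have h0 := sub_ne_zero.2 (hK 0).ne'
  have h1 := sub_ne_zero.2 (hK 1).ne'
  rcases ha 0 with h | h <;> rcases ha 1 with h' | h' <;>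
    simp only [piece, linPart, quadPart, h, h', map_add, map_mul, map_sub, eval_C, eval_X] <;>
    field_simp <;> ring

theorem piece_normalMean (M : Patch) (K : Rect) (hK : ∀ i, K.lo i < K.hi i)
    (hs : ∀ i, (M.splDer i (K.lo i) + M.splDer i (K.hi i)) * (K.hi i - K.lo i) =
      2 * (M.splVal i (K.hi i) - M.splVal i (K.lo i))) (i : Fin 2) (b : Bool) :
    K.normalMean (M.piece K) i b = M.splDer i (K.face i b) *
      ((M.splVal (1 - i) (K.lo (1 - i)) + M.splVal (1 - i) (K.hi (1 - i))) / 2) := by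
  have h0 := sub_ne_zero.2 (hK 0).ne'
  have h1 := sub_ne_zero.2 (hK 1).ne'
  have e0 := hs 0
  have e1 := hs 1
  have key : ∀ (A B V u w : ℝ) (f : ℝ → ℝ), u < w → (∀ t, f t = A + B * t) →
      A + B * ((u + w) / 2) = V → (w - u)⁻¹ * ∫ t in u..w, f t = V := by
    intro A B V u w f huw hf hV
    have : w - u ≠ 0 := sub_ne_zero.2 huw.ne'
    simp_rw [hf]
    rw [intervalIntegral.integral_add (Continuous.intervalIntegrable (by fun_prop) _ _)
      (Continuous.intervalIntegrable (by fun_prop) _ _), intervalIntegral.integral_const,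
      intervalIntegral.integral_const_mul, integral_id, ← hV, smul_eq_mul]
    field_simp
    ring
  unfold Rect.normalMean
  fin_cases i
  · set c := K.face 0 b with hc
    set q := (M.splDer 0 (K.hi 0) - M.splDer 0 (K.lo 0)) / (2 * (K.hi 0 - K.lo 0)) *
      ((M.splVal 1 (K.lo 1) + M.splVal 1 (K.hi 1)) / 2)
    set s0 := (M.splVal 0 (K.hi 0) - M.splVal 0 (K.lo 0)) / (K.hi 0 - K.lo 0)
    set s1 := (M.splVal 1 (K.hi 1) - M.splVal 1 (K.lo 1)) / (K.hi 1 - K.lo 1)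
    refine key (s0 * (M.splVal 1 (K.lo 1) - s1 * K.lo 1) + q * ((c - K.lo 0) + (c - K.hi 0)))
      (s0 * s1) _ _ _ _ (hK 1) ?_ ?_
    · intro t
      simp [piece, linPart, quadPart, Derivation.leibniz, pderiv_X]
      ring
    · rcases b with _ | _ <;> simp [Rect.face, c, q, s0, s1] <;> field_simp <;> linear_combination (-(M.splVal 1 (K.lo 1) + M.splVal 1 (K.hi 1)) * (K.hi 1 - K.lo 1)) * e0
  · set c := K.face 1 b with hc
    set q := (M.splDer 1 (K.hi 1) - M.splDer 1 (K.lo 1)) / (2 * (K.hi 1 - K.lo 1)) *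
      ((M.splVal 0 (K.lo 0) + M.splVal 0 (K.hi 0)) / 2)
    set s1 := (M.splVal 1 (K.hi 1) - M.splVal 1 (K.lo 1)) / (K.hi 1 - K.lo 1)
    set s0 := (M.splVal 0 (K.hi 0) - M.splVal 0 (K.lo 0)) / (K.hi 0 - K.lo 0)
    refine key (s1 * (M.splVal 0 (K.lo 0) - s0 * K.lo 0) + q * ((c - K.lo 1) + (c - K.hi 1)))
      (s1 * s0) _ _ _ _ (hK 0) ?_ ?_
    · intro t
      simp [piece, linPart, quadPart, Derivation.leibniz, pderiv_X]
      ring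
    · rcases b with _ | _ <;> simp [Rect.face, c, q, s1, s0] <;> field_simp <;> linear_combination (-(M.splVal 0 (K.lo 0) + M.splVal 0 (K.hi 0)) * (K.hi 0 - K.lo 0)) * e1


theorem exists_isBasisFunction (M : Patch) (hM : ∀ i, StrictMono (M i)) :
    ∃ φ, M.IsBasisFunction φ := by
  classical
  have m01 : ∀ i, M i 0 < M i 1 := fun i => hM i (by decide)
  have m12 : ∀ i, M i 1 < M i 2 := fun i => hM i (by decide)
  have m23 : ∀ i, M i 2 < M i 3 := fun i => hM i (by decide)
  have hK : ∀ m i, (M.cell m).lo i < (M.cell m).hi i := fun m i => hM i Fin.castSucc_lt_succ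
  have v0 : ∀ i, M.splVal i (M i 0) = 0 := fun i => by
    rw [splVal, if_neg (m01 i).ne, if_neg ((m01 i).trans (m12 i)).ne]
  have v3 : ∀ i, M.splVal i (M i 3) = 0 := fun i => by
    rw [splVal, if_neg ((m12 i).trans (m23 i)).ne', if_neg (m23 i).ne']
  have v1 : ∀ i, M.splVal i (M i 1) = M.len i 0 / (M.len i 0 + M.len i 1) := fun i => by
    rw [splVal, if_pos rfl]
  have v2 : ∀ i, M.splVal i (M i 2) = M.len i 2 / (M.len i 1 + M.len i 2) := fun i => by
    rw [splVal, if_neg (m12 i).ne', if_pos rfl]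
  have d0 : ∀ i, M.splDer i (M i 0) = 0 := fun i => by
    rw [splDer, if_neg (m01 i).ne, if_neg ((m01 i).trans (m12 i)).ne]
  have d3 : ∀ i, M.splDer i (M i 3) = 0 := fun i => by
    rw [splDer, if_neg ((m12 i).trans (m23 i)).ne', if_neg (m23 i).ne']
  have d1 : ∀ i, M.splDer i (M i 1) = 2 / (M.len i 0 + M.len i 1) := fun i => by
    rw [splDer, if_pos rfl]
  have d2 : ∀ i, M.splDer i (M i 2) = -2 / (M.len i 1 + M.len i 2) := fun i => by
    rw [splDer, if_neg (m12 i).ne', if_pos rfl]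
  have l0 : ∀ i, M.len i 0 = M i 1 - M i 0 := fun i => rfl
  have l1 : ∀ i, M.len i 1 = M i 2 - M i 1 := fun i => rfl
  have l2 : ∀ i, M.len i 2 = M i 3 - M i 2 := fun i => rfl
  have hs : ∀ m i, (M.splDer i ((M.cell m).lo i) + M.splDer i ((M.cell m).hi i)) *
      ((M.cell m).hi i - (M.cell m).lo i) =
      2 * (M.splVal i ((M.cell m).hi i) - M.splVal i ((M.cell m).lo i)) := by
    intro m i
    have h01 : M.len i 0 + M.len i 1 ≠ 0 := by rw [l0, l1]; linarith [m01 i, m12 i]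
    have h12 : M.len i 1 + M.len i 2 ≠ 0 := by rw [l1, l2]; linarith [m12 i, m23 i]
    have key : ∀ n : Fin 3, (M.splDer i (M i n.castSucc) + M.splDer i (M i n.succ)) *
        (M i n.succ - M i n.castSucc) = 2 * (M.splVal i (M i n.succ) - M.splVal i (M i n.castSucc)) := by
      intro n
      fin_cases n
      · change (M.splDer i (M i 0) + M.splDer i (M i 1)) * (M.len i 0) =
          2 * (M.splVal i (M i 1) - M.splVal i (M i 0))
        rw [d0, d1, v0, v1]
        field_simp
        ring
      · change (M.splDer i (M i 1) + M.splDer i (M i 2)) * (M.len i 1) =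
          2 * (M.splVal i (M i 2) - M.splVal i (M i 1))
        rw [d1, d2, v1, v2]
        field_simp
        ring
      · change (M.splDer i (M i 2) + M.splDer i (M i 3)) * (M.len i 2) =
          2 * (M.splVal i (M i 3) - M.splVal i (M i 2))
        rw [d2, d3, v2, v3]
        field_simp
        ring
    exact key (m i)
  have hgrid : ∀ K ∈ M.grid, ∃ m, K = M.cell m := fun K h => by
    obtain ⟨m, -, rfl⟩ := Finset.mem_image.1 h
    exact ⟨m, rfl⟩
  have hmem : ∀ m, M.cell m ∈ M.grid := fun m => Finset.mem_image_of_mem _ (Finset.mem_univ m)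
  have hdisj : ∀ m m' x, x ∈ (M.cell m).inner → x ∈ (M.cell m').inner → m = m' := by
    intro m m' x h h'
    funext i
    have a := h i
    have b := h' i
    simp only [cell] at a b
    by_contra hne
    rcases lt_or_gt_of_ne hne with hlt | hlt
    · have := (hM i).monotone (a := (m i).succ) (b := (m' i).castSucc) (by
        rw [Fin.le_def]; simpa using hlt)
      linarith
    · have := (hM i).monotone (a := (m' i).succ) (b := (m i).castSucc) (by
        rw [Fin.le_def]; simpa using hlt)
      linarith
  refine ⟨fun x => if h : ∃ m, x ∈ (M.cell m).inner then eval x (M.piece (M.cell h.choose)) else 0,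
    ?_, M.piece, ⟨?_, ?_, ?_, ?_, ?_, ?_⟩, ?_⟩
  · intro x hx
    refine dif_neg ?_
    rintro ⟨m, hm⟩
    refine hx fun i => ?_
    have a := hm i
    simp only [cell] at a
    have := (hM i).monotone (Fin.zero_le (m i).castSucc)
    have : M i (m i).succ ≤ M i 3 := (hM i).monotone (Fin.le_last (m i).succ)
    exact ⟨by linarith, by linarith⟩
  · exact fun K _ => M.piece_degree K
  · intro K hKG x hx
    obtain ⟨m, rfl⟩ := hgrid K hKG
    have h : ∃ m, x ∈ (M.cell m).inner := ⟨m, hx⟩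
    simp only [dif_pos h]
    rw [hdisj _ _ _ h.choose_spec hx]
  · intro a K hKG K' hKG' h h'
    obtain ⟨m, rfl⟩ := hgrid K hKG
    obtain ⟨m', rfl⟩ := hgrid K' hKG'
    rw [M.piece_vertex _ (hK m) a h, M.piece_vertex _ (hK m') a h']
  · intro a ha K hKG h
    obtain ⟨m, rfl⟩ := hgrid K hKG
    rw [M.piece_vertex _ (hK m) a h]
    have hlines : ∀ i, ∃ n : Fin 4, a i = M i n := fun i => (h i).elim (fun e => ⟨_, e⟩) fun e => ⟨_, e⟩
    have hz : ∀ i n, a i = M i n → M.splVal i (a i) = 0 ∨ (M i 0 < a i ∧ a i < M i 3) := by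
      intro i n hn
      fin_cases n
      · left; rw [hn]; exact v0 i
      · right; rw [hn]; exact ⟨m01 i, (m12 i).trans (m23 i)⟩
      · right; rw [hn]; exact ⟨(m01 i).trans (m12 i), m23 i⟩
      · left; rw [hn]; exact v3 i
    by_contra hne
    have hin : ∀ i, M i 0 < a i ∧ a i < M i 3 := by
      intro i
      obtain ⟨n, hn⟩ := hlines i
      refine (hz i n hn).resolve_left fun h0 => hne ?_
      fin_cases i
      · exact mul_eq_zero_of_left h0 _
      · exact mul_eq_zero_of_right _ h0
    refine ha.2 (mem_interior.2 ⟨M.inner, ?_, ?_, hin⟩)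
    · intro x hx
      have hc : ∀ i, ∃ n : Fin 3, M i n.castSucc ≤ x i ∧ x i ≤ M i n.succ := by
        intro i
        have := hx i
        by_cases c1 : x i ≤ M i 1
        · exact ⟨0, this.1.le, c1⟩
        · by_cases c2 : x i ≤ M i 2
          · exact ⟨1, (not_le.1 c1).le, c2⟩
          · exact ⟨2, (not_le.1 c2).le, this.2.le⟩
      choose n hn using hc
      exact Set.mem_iUnion₂.2 ⟨M.cell n, hmem n, hn⟩
    · have : M.inner = Set.univ.pi fun i => Set.Ioo (M i 0) (M i 3) := by
        ext x; simp [inner]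
      rw [this]
      exact isOpen_set_pi Set.finite_univ fun i _ => isOpen_Ioo
  · intro K hKG N hNG i b hKN
    obtain ⟨m, rfl⟩ := hgrid K hKG
    obtain ⟨m', rfl⟩ := hgrid N hNG
    have hj : (1 - i) ≠ i := by fin_cases i <;> decide
    rw [M.piece_normalMean _ (hK m) (hs m), M.piece_normalMean _ (hK m') (hs m'), hKN.1,
      (hKN.2 _ hj).1, (hKN.2 _ hj).2]
  · intro K hKG i b hb
    obtain ⟨m, rfl⟩ := hgrid K hKG
    rw [M.piece_normalMean _ (hK m) (hs m)]
    have hnb : ∀ n : Fin 3, (M.cell (Function.update m i n)).face i (!b) ≠ (M.cell m).face i b := by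
      intro n hn
      refine hb _ (hmem (Function.update m i n)) ⟨hn, fun j hj => ?_⟩
      simp [cell, Function.update_of_ne hj]
    have : M.splDer i ((M.cell m).face i b) = 0 := by
      simp only [Rect.face, cell, Function.update_self] at hnb ⊢
      generalize m i = k at hnb ⊢
      cases b <;> fin_cases k
      · exact d0 i
      · exact absurd rfl (hnb 0)
      · exact absurd rfl (hnb 1)
      · exact absurd rfl (hnb 1)
      · exact absurd rfl (hnb 2)
      · exact d3 i
    rw [this, zero_mul]
  · have h := M.piece_vertex _ (hK fun _ => 1) (fun i => M i 1) (fun i => Or.inl rfl)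
    rw [v1, v1] at h
    exact h

/-- The basis function `φ_K` (determined up to its values on the edges of the nine cells). -/
noncomputable def basisFunction (M : Patch) : Pt → ℝ := Classical.epsilon M.IsBasisFunction

theorem isBasisFunction_basisFunction (M : Patch) (hM : ∀ i, StrictMono (M i)) :
    M.IsBasisFunction M.basisFunction :=
  Classical.epsilon_spec (M.exists_isBasisFunction hM)

/-- The weights `w_1, w_2` (`i = 0`) and `w_3, w_4` (`i = 1`), for the neighbours of `K` on the
lower (`b = false`) and upper (`b = true`) side in the direction `i`. -/
noncomputable def weight (M : Patch) (i : Fin 2) (b : Bool) : ℝ :=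
  -(M.len i 1) ^ 2 /
    ((M.len i 1 + M.len i (if b then 2 else 0)) * (M.len i 0 + M.len i 1 + M.len i 2))

/-- The functional `λ_K`: a weighted sum of the mean values on `K` and its four neighbours. -/
noncomputable def functional (M : Patch) (v : Pt → ℝ) : ℝ :=
  (∑ i, ∑ b, M.weight i b *
      ⨍ x in (M.cell (Function.update (fun _ => 1) i (if b then 2 else 0))).closed, v x) +
    (1 - ∑ i, ∑ b, M.weight i b) * ⨍ x in (M.cell fun _ => 1).closed, v x

end Patch

/-! ### The extended grid -/

/-- The lines that extend the grid beyond its boundary. For a boundary edge `(i, b)` of `K`, two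
layers are attached locally; they end on the lines `x i = line₁ K i b` and `x i = line₂ K i b`.
Where a cell of the grid touches `K` beyond the edge (which, for a boundary edge, happens at
a concave corner), these are lines of the grid. For an interior edge of `K`, `line₁ K i b` is
the far side of the neighbour. -/
structure GridExtension (G : Finset Rect) where
  line₁ : Rect → Fin 2 → Bool → ℝ
  line₂ : Rect → Fin 2 → Bool → ℝ
  line₁_eq : ∀ K ∈ G, ∀ N ∈ G, ∀ i b, K.TouchesBeyond N i b → line₁ K i b = N.face i b
  line₂_eq : ∀ K ∈ G, ∀ N ∈ G, ∀ N' ∈ G, ∀ i b, IsBoundaryEdge G K i b →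
    K.TouchesBeyond N i b → N.IsNeighbor N' i b → line₂ K i b = N'.face i b

namespace GridExtension

variable {G : Finset Rect} (E : GridExtension G)

/-- The four lines in the direction `i` of the patch centred at `K` (`none`), or at the cell
attached to `K` on its upper (`some true`) or lower (`some false`) side in this direction. -/
def lines (K : Rect) (i : Fin 2) : Option Bool → Fin 4 → ℝ
  | none => ![E.line₁ K i false, K.lo i, K.hi i, E.line₁ K i true]
  | some true => ![K.lo i, K.hi i, E.line₁ K i true, E.line₂ K i true]
  | some false => ![E.line₂ K i false, E.line₁ K i false, K.lo i, K.hi i]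

open scoped Classical in
/-- The patches `M_K`, `K ∈ J_h`: those centred at the cells of the grid (`σ = none, none`),
at the cells attached to boundary edges (one `some`), and at the cells attached to convex
corners, where two boundary edges of a cell meet (two `some`). -/
noncomputable def patches : Finset Patch :=
  ((G ×ˢ (Finset.univ : Finset (Fin 2 → Option Bool))).filter
    fun q => ∀ i b, q.2 i = some b → IsBoundaryEdge G q.1 i b).image
      fun q i => E.lines q.1 i (q.2 i)

open scoped Classical in
/-- The extension is admissible with regularity constant `γ₀`. -/
structure IsAdmissible (γ₀ : ℝ) : Prop where
  /-- The lines of each patch are in order. -/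
  ordered : ∀ M ∈ E.patches, ∀ i, StrictMono (M i)
  /-- All cells, old and new, are shape regular. -/
  regular : ∀ M ∈ E.patches, ∀ m, (M.cell m).size / (M.cell m).inradius ≤ γ₀
  /-- Each cell of the grid is located in the supports of nine functions: the new cells do not
  overlap with remote parts of the grid. -/
  nine : ∀ T ∈ G, (E.patches.filter fun M => (M.inner ∩ T.inner).Nonempty).card = 9

/-- The extended domain. -/
def domain : Set Pt := ⋃ M ∈ E.patches, M.closed

/-- `Δ_T`, the union of the patches that contain `T`. -/
def delta (T : Rect) : Set Pt := ⋃ M ∈ E.patches, ⋃ _ : T.closed ⊆ M.closed, M.closed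

/-- The interpolation operator on the extended grid. -/
noncomputable def interpolant (v : Pt → ℝ) : Pt → ℝ :=
  fun x => ∑ M ∈ E.patches, M.functional v * M.basisFunction x

end GridExtension

/-! ### Sobolev seminorms through weak derivatives -/

/-- The partial derivative in the direction `i`. -/
noncomputable def partialDeriv (i : Fin 2) (f : Pt → ℝ) : Pt → ℝ :=
  fun x => fderiv ℝ f x (Pi.single i 1)

/-- `g` is the weak derivative `∂₀^a ∂₁^b v` on the open set `U`. -/
def IsWeakDeriv (U : Set Pt) (a b : ℕ) (v g : Pt → ℝ) : Prop :=
  LocallyIntegrableOn v U ∧ LocallyIntegrableOn g U ∧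
  ∀ ψ : Pt → ℝ, ContDiff ℝ ∞ ψ → HasCompactSupport ψ → tsupport ψ ⊆ U →
    ∫ x in U, v x * ((partialDeriv 0)^[a] ((partialDeriv 1)^[b] ψ)) x =
      (-1) ^ (a + b) * ∫ x in U, g x * ψ x

/-- The `L²(U)` norm of the weak derivative `∂₀^a ∂₁^b v`; it is `∞` if there is none. -/
noncomputable def weakDerivNorm (U : Set Pt) (a b : ℕ) (v : Pt → ℝ) : ℝ≥0∞ :=
  ⨅ (g : Pt → ℝ) (_ : IsWeakDeriv U a b v g), eLpNorm g 2 (volume.restrict U)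

/-- The Sobolev seminorm `|v|_{k,U}`; it is `∞` unless all weak derivatives of order `k` exist
and are in `L²(U)`. -/
noncomputable def sobolevSeminorm (k : ℕ) (U : Set Pt) (v : Pt → ℝ) : ℝ≥0∞ :=
  (∑ α ∈ Finset.HasAntidiagonal.antidiagonal k, weakDerivNorm U α.1 α.2 v ^ 2) ^ (1 / 2 : ℝ)

/-- `v ∈ H^s(U)`. -/
def MemSobolev (s : ℕ) (U : Set Pt) (v : Pt → ℝ) : Prop :=
  ∀ a b, a + b ≤ s → ∃ g, IsWeakDeriv U a b v g ∧ MemLp g 2 (volume.restrict U)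

end RRM

namespace RRM

/-! ### Partial derivatives of smooth functions -/

/-! On a cell `T` the operator is a quasi-interpolant built from quadratic splines, and the proof is
the classical one: reproduction of quadratics, local stability, and approximation by subtracting a
suitable quadratic.

Shape of the basis functions. A quadratic on a rectangle is determined by its vertex values and mean
normal derivatives, and these satisfy a trapezoidal rule in each direction. In each row of three
cells of a patch, this rule and the zero boundary data leave one free factor, so the data are
proportional to values and slopes of a univariate quadratic B-spline (`exists_row_proportional`).
Hence the conditions on `φ_K` force it to be the explicit `piece` on each cell (`eq_piece`).

Reproduction (a). On quadratics, `λ_K` takes `1` to `1`, each coordinate to the midpoint of `K`, its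
square to the product of the two lines bounding `K`, and `x y` to the product of the midpoints
(`functional_quadPoly`). These are the coefficients in Marsden's identity for quadratic B-splines.
Exactly nine patches act on `T`, one for each direction in which the centre can lie
(`exists_isLocalFamily`, `mem_range_of_inner_inter_nonempty`). Their outer lines may differ from row
to row, so this is not a tensor product of univariate identities; but at each vertex of `T` the
lines of at least one direction continue, and the mixed error terms are products of two differences
one of which is zero (`sum_mul_shape_eq`, `sum_functional_mul_piece`).

Stability (b). Shape regularity makes all sides of the nine patches comparable with `h_T`. The
weights are bounded, means are controlled by Cauchy–Schwarz, and derivatives of `piece` scale like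
negative powers of `h_T` (`eLpNorm_polyDeriv_localPoly_le`).

Approximation (c). Choose a quadratic `q` such that all derivatives of `v - q` of order below `s`
have mean zero over `T`, while those of order `s` are the ones of `v`. Iterating the Poincaré
inequality bounds the lower derivatives on each of the nine patches separately (`poincare`,
`eLpNorm_le_of_mean_zero`). Patches are convex and all contain `T`, so the possibly nonconvex `Δ_T`
never needs an inequality of its own. Since `q` is reproduced, `v - Πv = u - Πu` for `u = v - q`,
and stability finishes the proof. -/

theorem contDiff_partialDeriv {f : Pt → ℝ} (hf : ContDiff ℝ ∞ f) (i : Fin 2) :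
    ContDiff ℝ ∞ (partialDeriv i f) :=
  (hf.fderiv_right (m := ∞) (by simp)).clm_apply contDiff_const

theorem contDiff_partialDeriv_iterate {f : Pt → ℝ} (hf : ContDiff ℝ ∞ f) (i : Fin 2) (n : ℕ) :
    ContDiff ℝ ∞ ((partialDeriv i)^[n] f) := by
  induction n with
  | zero => exact hf
  | succ n ih => rw [Function.iterate_succ_apply']; exact contDiff_partialDeriv ih i

theorem tsupport_partialDeriv_subset (f : Pt → ℝ) (i : Fin 2) :
    tsupport (partialDeriv i f) ⊆ tsupport f :=
  tsupport_fderiv_apply_subset ℝ (Pi.single i 1)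

theorem tsupport_partialDeriv_iterate_subset (f : Pt → ℝ) (i : Fin 2) (n : ℕ) :
    tsupport ((partialDeriv i)^[n] f) ⊆ tsupport f := by
  induction n with
  | zero => exact subset_rfl
  | succ n ih =>
    rw [Function.iterate_succ_apply']
    exact (tsupport_partialDeriv_subset _ i).trans ih

theorem hasCompactSupport_of_tsupport_subset {f g : Pt → ℝ} (hf : HasCompactSupport f)
    (h : tsupport g ⊆ tsupport f) : HasCompactSupport g :=
  hf.of_isClosed_subset (isClosed_tsupport g) h

theorem partialDeriv_comm {f : Pt → ℝ} (hf : ContDiff ℝ ∞ f) (i j : Fin 2) :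
    partialDeriv i (partialDeriv j f) = partialDeriv j (partialDeriv i f) := by
  have hd : Differentiable ℝ (fderiv ℝ f) :=
    (hf.fderiv_right (m := ∞) (by simp)).differentiable (by simp)
  have key : ∀ (i j : Fin 2) x, partialDeriv i (partialDeriv j f) x =
      fderiv ℝ (fderiv ℝ f) x (Pi.single i 1) (Pi.single j 1) := by
    intro i j x
    unfold partialDeriv
    rw [fderiv_clm_apply (hd x) (differentiableAt_const _)]
    simp
  funext x
  rw [key, key]
  exact (hf.contDiffAt.isSymmSndFDerivAt
    (by simpa using WithTop.coe_le_coe.2 (le_top : (2 : ℕ∞) ≤ ⊤))).eq _ _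

theorem partialDeriv_iterate_comm {f : Pt → ℝ} (hf : ContDiff ℝ ∞ f) (i j : Fin 2) (n : ℕ) :
    (partialDeriv i)^[n] (partialDeriv j f) = partialDeriv j ((partialDeriv i)^[n] f) := by
  induction n with
  | zero => rfl
  | succ n ih =>
    rw [Function.iterate_succ_apply', Function.iterate_succ_apply', ih,
      partialDeriv_comm (contDiff_partialDeriv_iterate hf i n)]

/-! ### Polynomials as smooth functions. -/

theorem hasFDerivAt_eval (p : MvPolynomial (Fin 2) ℝ) (x : Pt) :
    HasFDerivAt (fun y : Pt => eval y p)
      (∑ i, eval x (pderiv i p) • ContinuousLinearMap.proj (R := ℝ) (φ := fun _ : Fin 2 => ℝ) i) x := by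
  induction p using MvPolynomial.induction_on with
  | C a => simpa using hasFDerivAt_const a x
  | add p q hp hq =>
    simp only [map_add, add_smul, Finset.sum_add_distrib]
    exact hp.add hq
  | mul_X p j hp =>
    have hX : HasFDerivAt (fun y : Pt => y j)
        (ContinuousLinearMap.proj (R := ℝ) (φ := fun _ : Fin 2 => ℝ) j) x :=
      (ContinuousLinearMap.proj (R := ℝ) (φ := fun _ : Fin 2 => ℝ) j).hasFDerivAt
    have h := hp.mul hX
    simp only [map_mul, eval_X]
    refine h.congr_fderiv ?_
    ext v
    fin_cases j <;> simp [Derivation.leibniz, pderiv_X, Fin.sum_univ_two] <;> ring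

theorem contDiff_eval (p : MvPolynomial (Fin 2) ℝ) : ContDiff ℝ ∞ fun y : Pt => eval y p := by
  induction p using MvPolynomial.induction_on with
  | C a => simpa using contDiff_const
  | add p q hp hq => simpa using hp.add hq
  | mul_X p j hp => simpa using hp.mul (contDiff_apply ℝ ℝ j)

theorem partialDeriv_eval (p : MvPolynomial (Fin 2) ℝ) (i : Fin 2) :
    partialDeriv i (fun y => eval y p) = fun y => eval y (pderiv i p) := by
  funext x
  unfold partialDeriv
  rw [(hasFDerivAt_eval p x).fderiv]
  fin_cases i <;> simp [Fin.sum_univ_two]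

/-- The partial derivative `∂₀^a ∂₁^b` of a polynomial. -/
noncomputable def polyDeriv (a b : ℕ) (p : MvPolynomial (Fin 2) ℝ) : MvPolynomial (Fin 2) ℝ :=
  (pderiv 1)^[b] ((pderiv 0)^[a] p)

theorem partialDeriv_iterate_eval (p : MvPolynomial (Fin 2) ℝ) (i : Fin 2) (n : ℕ) :
    (partialDeriv i)^[n] (fun y => eval y p) = fun y => eval y ((pderiv i)^[n] p) := by
  induction n with
  | zero => rfl
  | succ n ih => rw [Function.iterate_succ_apply', ih, partialDeriv_eval,
      Function.iterate_succ_apply']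

/-! ### Integration by parts against test functions. -/

theorem integral_mul_partialDeriv {f ψ : Pt → ℝ} (hf : ContDiff ℝ ∞ f) (hψ : ContDiff ℝ ∞ ψ)
    (hc : HasCompactSupport ψ) (i : Fin 2) :
    ∫ x, f x * partialDeriv i ψ x = - ∫ x, partialDeriv i f x * ψ x := by
  have hψ' := contDiff_partialDeriv hψ i
  have hf' := contDiff_partialDeriv hf i
  have hc' : HasCompactSupport (partialDeriv i ψ) :=
    hasCompactSupport_of_tsupport_subset hc (tsupport_partialDeriv_subset ψ i)
  refine integral_mul_fderiv_eq_neg_fderiv_mul_of_integrable ?_ ?_ ?_ ?_ ?_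
  · exact (hf'.continuous.mul hψ.continuous).integrable_of_hasCompactSupport hc.mul_left
  · exact (hf.continuous.mul hψ'.continuous).integrable_of_hasCompactSupport hc'.mul_left
  · exact (hf.continuous.mul hψ.continuous).integrable_of_hasCompactSupport hc.mul_left
  · exact fun x _ => hf.differentiable (by simp) x
  · exact fun x _ => hψ.differentiable (by simp) x

theorem integral_mul_partialDeriv_iterate {f ψ : Pt → ℝ} (hf : ContDiff ℝ ∞ f)
    (hψ : ContDiff ℝ ∞ ψ) (hc : HasCompactSupport ψ) (i : Fin 2) (n : ℕ) :
    ∫ x, f x * ((partialDeriv i)^[n] ψ) x = (-1) ^ n * ∫ x, ((partialDeriv i)^[n] f) x * ψ x := by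
  induction n generalizing f with
  | zero => simp
  | succ n ih =>
    rw [Function.iterate_succ_apply', integral_mul_partialDeriv hf
      (contDiff_partialDeriv_iterate hψ i n)
      (hasCompactSupport_of_tsupport_subset hc (tsupport_partialDeriv_iterate_subset ψ i n)),
      ih (contDiff_partialDeriv hf i), Function.iterate_succ_apply]
    ring

/-! ### Calculus of weak derivatives -/

theorem setIntegral_eq_integral_of_tsupport_subset {U : Set Pt} {f ψ : Pt → ℝ}
    (h : tsupport ψ ⊆ U) : ∫ x in U, f x * ψ x = ∫ x, f x * ψ x := by
  refine setIntegral_eq_integral_of_forall_compl_eq_zero fun x hx => ?_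
  rw [image_eq_zero_of_notMem_tsupport fun h' => hx (h h'), mul_zero]

theorem tsupport_mixed_subset (ψ : Pt → ℝ) (a b : ℕ) :
    tsupport ((partialDeriv 0)^[a] ((partialDeriv 1)^[b] ψ)) ⊆ tsupport ψ :=
  (tsupport_partialDeriv_iterate_subset _ 0 a).trans (tsupport_partialDeriv_iterate_subset ψ 1 b)

theorem contDiff_mixed {ψ : Pt → ℝ} (h : ContDiff ℝ ∞ ψ) (a b : ℕ) :
    ContDiff ℝ ∞ ((partialDeriv 0)^[a] ((partialDeriv 1)^[b] ψ)) :=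
  contDiff_partialDeriv_iterate (contDiff_partialDeriv_iterate h 1 b) 0 a

theorem isWeakDeriv_eval (U : Set Pt) (a b : ℕ) (p : MvPolynomial (Fin 2) ℝ) :
    IsWeakDeriv U a b (fun x => eval x p) (fun x => eval x (polyDeriv a b p)) := by
  refine ⟨(contDiff_eval _).continuous.locallyIntegrable.locallyIntegrableOn _,
    (contDiff_eval _).continuous.locallyIntegrable.locallyIntegrableOn _, fun ψ hψ hc hs => ?_⟩
  -- On the test function `∂₀` stands outside `∂₁`, so it is moved to the polynomial first. This
  -- dictates the order of composition in `polyDeriv`.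
  rw [setIntegral_eq_integral_of_tsupport_subset ((tsupport_mixed_subset ψ a b).trans hs),
    setIntegral_eq_integral_of_tsupport_subset hs,
    integral_mul_partialDeriv_iterate (contDiff_eval p) (contDiff_partialDeriv_iterate hψ 1 b)
      (hasCompactSupport_of_tsupport_subset hc (tsupport_partialDeriv_iterate_subset ψ 1 b)),
    partialDeriv_iterate_eval, integral_mul_partialDeriv_iterate (contDiff_eval _) hψ hc,
    partialDeriv_iterate_eval, pow_add, mul_assoc, polyDeriv]

namespace IsWeakDeriv

variable {U V : Set Pt} {a b : ℕ} {v w g h : Pt → ℝ}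

theorem mono (H : IsWeakDeriv U a b v g) (hVU : V ⊆ U) : IsWeakDeriv V a b v g := by
  refine ⟨H.1.mono_set hVU, H.2.1.mono_set hVU, fun ψ hψ hc hs => ?_⟩
  have := H.2.2 ψ hψ hc (hs.trans hVU)
  have hm := (tsupport_mixed_subset ψ a b)
  rwa [setIntegral_eq_integral_of_tsupport_subset (hm.trans (hs.trans hVU)),
    setIntegral_eq_integral_of_tsupport_subset (hs.trans hVU),
    ← setIntegral_eq_integral_of_tsupport_subset (hm.trans hs),
    ← setIntegral_eq_integral_of_tsupport_subset hs] at this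

/-- Local integrability suffices because the product lives on the compact support of `ψ`. This
justifies splitting the integrals that define weak derivatives. -/
theorem integrableOn_mul {ψ : Pt → ℝ} (hv : LocallyIntegrableOn v U)
    (hψ : Continuous ψ) (hc : HasCompactSupport ψ) (hs : tsupport ψ ⊆ U) :
    IntegrableOn (fun x => v x * ψ x) U := by
  have h1 : IntegrableOn v (tsupport ψ) := hv.integrableOn_compact_subset hs hc
  have h2 : IntegrableOn (fun x => v x * ψ x) (tsupport ψ) :=
    h1.mul_continuousOn hψ.continuousOn hc
  refine (integrableOn_iff_integrable_of_support_subset ?_).1 h2 |>.integrableOn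
  intro x hx
  by_contra h
  exact hx (by simp [image_eq_zero_of_notMem_tsupport h])

theorem sub (H : IsWeakDeriv U a b v g) (H' : IsWeakDeriv U a b w h) :
    IsWeakDeriv U a b (fun x => v x - w x) (fun x => g x - h x) := by
  refine ⟨H.1.sub H'.1, H.2.1.sub H'.2.1, fun ψ hψ hc hs => ?_⟩
  have hψ' := (contDiff_mixed hψ a b).continuous
  have hs' := (tsupport_mixed_subset ψ a b)
  have hc' := hasCompactSupport_of_tsupport_subset hc hs'
  simp only [sub_mul]
  rw [integral_sub (integrableOn_mul H.1 hψ' hc' (hs'.trans hs))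
    (integrableOn_mul H'.1 hψ' hc' (hs'.trans hs)),
    integral_sub (integrableOn_mul H.2.1 hψ.continuous hc hs)
    (integrableOn_mul H'.2.1 hψ.continuous hc hs), H.2.2 ψ hψ hc hs, H'.2.2 ψ hψ hc hs]
  ring

theorem congr_left (H : IsWeakDeriv U a b v g) (h : ∀ᵐ x ∂volume.restrict U, v x = w x)
    (hw : LocallyIntegrableOn w U) : IsWeakDeriv U a b w g := by
  refine ⟨hw, H.2.1, fun ψ hψ hc hs => ?_⟩
  rw [← H.2.2 ψ hψ hc hs]
  exact integral_congr_ae (h.mono fun x hx => by simp only [hx])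

theorem ae_eq (hU : IsOpen U) (H : IsWeakDeriv U a b v g) (H' : IsWeakDeriv U a b v h) :
    g =ᵐ[volume.restrict U] h := by
  have := hU.ae_eq_zero_of_integral_contDiff_smul_eq_zero (μ := volume) (H.2.1.sub H'.2.1) ?_
  · rw [Filter.EventuallyEq, ae_restrict_iff' hU.measurableSet]
    filter_upwards [this] with x hx hxU
    exact sub_eq_zero.1 (hx hxU)
  · intro ψ hψ hc hs
    have e := (H.2.2 ψ hψ hc hs).symm.trans (H'.2.2 ψ hψ hc hs)
    have e' := mul_left_cancel₀ (pow_ne_zero _ (by norm_num)) e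
    have h1 : ∫ x, ψ x • (g - h) x = ∫ x in U, (g x - h x) * ψ x := by
      rw [setIntegral_eq_integral_of_tsupport_subset hs]
      exact integral_congr_ae (.of_forall fun x => by simp [mul_comm])
    rw [h1]
    simp only [sub_mul]
    rw [integral_sub (integrableOn_mul H.2.1 hψ.continuous hc hs)
      (integrableOn_mul H'.2.1 hψ.continuous hc hs), e', sub_self]

/-- By the fundamental lemma of the calculus of variations all weak derivatives agree almost
everywhere, so the infimum runs over a single value. -/
theorem weakDerivNorm_eq (hU : IsOpen U) (H : IsWeakDeriv U a b v g) :
    weakDerivNorm U a b v = eLpNorm g 2 (volume.restrict U) := by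
  refine le_antisymm (iInf₂_le g H) (le_iInf₂ fun h H' => ?_)
  rw [eLpNorm_congr_ae (H.ae_eq hU H')]

/-- Testing the derivative of order `(a, b)` with `∂₀ψ` produces the one of order `(a + 1, b)`, as
partial derivatives of `ψ` commute. With `step_one` this turns derivatives of `v` into gradients of
lower derivatives, to which the Poincaré inequality applies. -/
theorem step_zero (H : IsWeakDeriv U a b v g) (H' : IsWeakDeriv U (a + 1) b v h) :
    IsWeakDeriv U 1 0 g h := by
  refine ⟨H.2.1, H'.2.1, fun ψ hψ hc hs => ?_⟩
  have e := H.2.2 _ (contDiff_partialDeriv hψ 0)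
    (hasCompactSupport_of_tsupport_subset hc (tsupport_partialDeriv_subset ψ 0))
    ((tsupport_partialDeriv_subset ψ 0).trans hs)
  have e' := H'.2.2 ψ hψ hc hs
  rw [partialDeriv_iterate_comm hψ, ← Function.iterate_succ_apply, e'] at e
  have hne : ((-1 : ℝ)) ^ (a + b) ≠ 0 := pow_ne_zero _ (by norm_num)
  refine mul_left_cancel₀ hne ?_
  simp only [Function.iterate_one, Function.iterate_zero, id]
  rw [← e]
  ring

theorem step_one (H : IsWeakDeriv U a b v g) (H' : IsWeakDeriv U a (b + 1) v h) :
    IsWeakDeriv U 0 1 g h := by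
  refine ⟨H.2.1, H'.2.1, fun ψ hψ hc hs => ?_⟩
  have e := H.2.2 _ (contDiff_partialDeriv hψ 1)
    (hasCompactSupport_of_tsupport_subset hc (tsupport_partialDeriv_subset ψ 1))
    ((tsupport_partialDeriv_subset ψ 1).trans hs)
  have e' := H'.2.2 ψ hψ hc hs
  rw [← Function.iterate_succ_apply, e'] at e
  have hne : ((-1 : ℝ)) ^ (a + b) ≠ 0 := pow_ne_zero _ (by norm_num)
  refine mul_left_cancel₀ hne ?_
  simp only [Function.iterate_one, Function.iterate_zero, id]
  rw [← e]
  ring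

end IsWeakDeriv

end RRM

namespace RRM

/-! ### The Poincaré inequality on convex open sets -/

theorem integral_fderiv_segment {ψ : Pt → ℝ} (hψ : ContDiff ℝ ∞ ψ) (e y : Pt) :
    ∫ r in (0 : ℝ)..1, fderiv ℝ ψ (y - r • e) e = ψ y - ψ (y - e) := by
  have hd : ∀ r : ℝ, HasDerivAt (fun r : ℝ => - ψ (y - r • e)) (fderiv ℝ ψ (y - r • e) e) r := by
    intro r
    have h1 : HasDerivAt (fun r : ℝ => y - r • e) (-e) r := by
      simpa using ((hasDerivAt_id r).smul_const e).const_sub y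
    have h2 := ((hψ.differentiable (by simp) (y - r • e)).hasFDerivAt.comp_hasDerivAt r h1).neg
    exact h2.congr_deriv (by simp)
  have hc : Continuous fun r : ℝ => fderiv ℝ ψ (y - r • e) e := by
    have := (hψ.continuous_fderiv (by simp))
    fun_prop
  rw [intervalIntegral.integral_eq_sub_of_hasDerivAt (fun r _ => hd r) (hc.intervalIntegrable _ _)]
  simp
  ring

theorem integrable_comp_add_smul {G : Pt → ℝ} (hG : Integrable G) (hm : StronglyMeasurable G)
    (e : Pt) : Integrable (fun q : Pt × ℝ => G (q.1 + q.2 • e))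
      ((volume : Measure Pt).prod (volume.restrict (Set.Ioc (0 : ℝ) 1))) := by
  have hm' : StronglyMeasurable fun q : Pt × ℝ => G (q.1 + q.2 • e) :=
    hm.comp_measurable (by fun_prop)
  refine (integrable_prod_iff' hm'.aestronglyMeasurable).2 ⟨.of_forall fun r => ?_, ?_⟩
  · exact hG.comp_add_right (r • e)
  · have : (fun r : ℝ => ∫ x, ‖G (x + r • e)‖) = fun _ => ∫ x, ‖G x‖ := by
      funext r
      exact integral_add_right_eq_self (fun x => ‖G x‖) (r • e)
    rw [this]
    exact integrable_const _

/-- The fundamental theorem of calculus along the segment from `x` to `x + e`, for a weak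
directional derivative. No mollification is needed: tested with `ψ`, Fubini and translation move the
line integral onto the smooth function, where the classical theorem holds. -/
theorem ae_sub_eq_integral_of_weak_directional {U : Set Pt} (hU : IsOpen U) (hconv : Convex ℝ U)
    {w G : Pt → ℝ} (hw : Integrable w) (hG : Integrable G) (hGm : StronglyMeasurable G) (e : Pt)
    (H : ∀ ψ : Pt → ℝ, ContDiff ℝ ∞ ψ → HasCompactSupport ψ → tsupport ψ ⊆ U →
      ∫ x, w x * fderiv ℝ ψ x e = - ∫ x, G x * ψ x) :
    ∀ᵐ x, x ∈ U ∩ (fun y => y + e) ⁻¹' U →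
      w (x + e) - w x = ∫ r in (0 : ℝ)..1, G (x + r • e) := by
  set V := U ∩ (fun y => y + e) ⁻¹' U
  have hV : IsOpen V := hU.inter (hU.preimage (by fun_prop))
  have hGi := integrable_comp_add_smul hG hGm e
  have hI : Integrable fun x => ∫ r in (0 : ℝ)..1, G (x + r • e) := by
    simp_rw [intervalIntegral.integral_of_le zero_le_one]
    exact hGi.integral_prod_left
  have hf : Integrable fun x => w (x + e) - w x - ∫ r in (0 : ℝ)..1, G (x + r • e) :=
    ((hw.comp_add_right e).sub hw).sub hI
  have := hV.ae_eq_zero_of_integral_contDiff_smul_eq_zero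
    (hf.locallyIntegrable.locallyIntegrableOn V) ?_
  · filter_upwards [this] with x hx hxV
    exact sub_eq_zero.1 (hx hxV)
  intro ψ hψ hc hs
  obtain ⟨B, hB⟩ := hc.exists_bound_of_continuous hψ.continuous
  have hψ' : Continuous fun x => fderiv ℝ ψ x e :=
    (hψ.continuous_fderiv (by simp)).clm_apply continuous_const
  have hc' : HasCompactSupport fun x => fderiv ℝ ψ x e :=
    hasCompactSupport_of_tsupport_subset hc (tsupport_fderiv_apply_subset ℝ e)
  obtain ⟨B', hB'⟩ := hc'.exists_bound_of_continuous hψ'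
  have hbd : ∀ f : Pt → ℝ, Integrable f → Integrable fun x => ψ x * f x := fun f hf =>
    hf.bdd_mul hψ.continuous.aestronglyMeasurable (.of_forall hB)
  have step : ∫ x, ψ x * ∫ r in (0 : ℝ)..1, G (x + r • e) =
      (∫ x, ψ x * w (x + e)) - ∫ x, ψ x * w x := by
    calc ∫ x, ψ x * ∫ r in (0 : ℝ)..1, G (x + r • e)
        = ∫ x, ∫ r in Set.Ioc (0 : ℝ) 1, ψ x * G (x + r • e) := by
          simp_rw [intervalIntegral.integral_of_le zero_le_one, integral_const_mul]
      _ = ∫ r in Set.Ioc (0 : ℝ) 1, ∫ x, ψ x * G (x + r • e) := by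
          refine integral_integral_swap ?_
          exact hGi.bdd_mul (hψ.continuous.comp continuous_fst).aestronglyMeasurable
            (.of_forall fun q => hB q.1)
      _ = ∫ r in Set.Ioc (0 : ℝ) 1, - ∫ x, w x * fderiv ℝ ψ (x - r • e) e := by
          refine setIntegral_congr_fun measurableSet_Ioc fun r hr => ?_
          have h1 : ∫ x, ψ x * G (x + r • e) = ∫ x, G x * ψ (x - r • e) := by
            rw [← integral_add_right_eq_self (fun x => G x * ψ (x - r • e)) (r • e)]
            refine integral_congr_ae (.of_forall fun x => ?_)
            simp [mul_comm]
          have h2 := H (fun x => ψ (x - r • e)) (hψ.comp (contDiff_id.sub contDiff_const))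
            (hc.comp_homeomorph (Homeomorph.subRight (r • e))) ?_
          · have h3 : ∀ x, fderiv ℝ (fun x => ψ (x - r • e)) x = fderiv ℝ ψ (x - r • e) :=
              fun x => fderiv_comp_sub (f := ψ) (r • e)
            simp only [h3] at h2
            simp only [h1, h2, neg_neg]
          · have ht : tsupport (fun x => ψ (x - r • e)) = (fun x => x - r • e) ⁻¹' tsupport ψ :=
              tsupport_comp_eq_preimage ψ (Homeomorph.subRight (r • e))
            rw [ht]
            intro x hx
            have hx' := hs hx
            -- Convexity keeps the translated test function admissible: if `y = x - r • e` and `y +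
            -- e` both lie in `U`, then so does `x`, a point of the segment between them.
            have := hconv hx'.1 hx'.2 (sub_nonneg.2 hr.2) hr.1.le (by ring)
            convert this using 1
            module
      _ = - ∫ r in Set.Ioc (0 : ℝ) 1, ∫ x, w x * fderiv ℝ ψ (x - r • e) e := integral_neg _
      _ = - ∫ x, ∫ r in Set.Ioc (0 : ℝ) 1, w x * fderiv ℝ ψ (x - r • e) e := by
          congr 1
          symm
          refine integral_integral_swap ?_
          refine Integrable.mul_bdd (c := B') (hw.comp_fst _) ?_ (.of_forall fun q => hB' _)
          exact (hψ'.comp (by fun_prop : Continuous fun q : Pt × ℝ => q.1 - q.2 • e)).aestronglyMeasurable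
      -- The integral over `r` is that of an exact derivative along the segment from `x - e` to `x`.
      _ = - ∫ x, (ψ x * w x - ψ (x - e) * w x) := by
          congr 1
          refine integral_congr_ae (.of_forall fun x => ?_)
          simp only [integral_const_mul]
          rw [← intervalIntegral.integral_of_le zero_le_one, integral_fderiv_segment hψ]
          ring
      _ = _ := by
          have h1 : ∫ x, ψ (x - e) * w x = ∫ x, ψ x * w (x + e) := by
            rw [← integral_add_right_eq_self (fun x => ψ (x - e) * w x) e]
            simp
          have h2 : Integrable fun x => ψ (x - e) * w x :=
            hw.bdd_mul (hψ.continuous.comp (by fun_prop)).aestronglyMeasurable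
              (.of_forall fun x => hB _)
          rw [integral_sub (hbd w hw) h2, h1]
          ring
  have e1 : ∀ x, ψ x • (w (x + e) - w x - ∫ r in (0 : ℝ)..1, G (x + r • e)) =
      ψ x * w (x + e) - ψ x * w x - ψ x * ∫ r in (0 : ℝ)..1, G (x + r • e) := fun x => by
    rw [smul_eq_mul]; ring
  simp_rw [e1]
  have e2 : Integrable fun x => ψ x * w (x + e) - ψ x * w x :=
    (hbd _ (hw.comp_add_right e)).sub (hbd _ hw)
  rw [integral_sub e2 (hbd _ hI),
    integral_sub (hbd _ (hw.comp_add_right e)) (hbd _ hw), step, sub_self]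

/-- Cauchy–Schwarz against the constant `1`. -/
theorem enorm_integral_sq_le {α : Type*} [MeasurableSpace α] (μ : Measure α) (f : α → ℝ)
    (hf : AEStronglyMeasurable f μ) :
    ‖∫ x, f x ∂μ‖ₑ ^ 2 ≤ μ Set.univ * ∫⁻ x, ‖f x‖ₑ ^ 2 ∂μ := by
  have h1 := enorm_integral_le_lintegral_enorm (μ := μ) f
  have h2 := ENNReal.lintegral_mul_le_Lp_mul_Lq μ (Real.HolderConjugate.two_two)
    (f := fun x => ‖f x‖ₑ) (g := fun _ => 1) hf.enorm aemeasurable_const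
  simp only [Pi.mul_apply, mul_one, ENNReal.one_rpow, lintegral_one] at h2
  calc ‖∫ x, f x ∂μ‖ₑ ^ 2 ≤ (∫⁻ x, ‖f x‖ₑ ∂μ) ^ 2 := by gcongr
    _ ≤ ((∫⁻ x, ‖f x‖ₑ ^ (2 : ℝ) ∂μ) ^ (1 / 2 : ℝ) * μ Set.univ ^ (1 / 2 : ℝ)) ^ 2 := by gcongr
    _ = μ Set.univ * ∫⁻ x, ‖f x‖ₑ ^ 2 ∂μ := by
      rw [mul_pow, ← ENNReal.rpow_natCast, ← ENNReal.rpow_natCast, ← ENNReal.rpow_mul,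
        ← ENNReal.rpow_mul]
      norm_num
      rw [mul_comm]

/-- Cauchy–Schwarz in `r` on the unit interval, followed by Fubini: every translate of `G` has the
same norm on the whole plane. -/
theorem lintegral_sq_translate_sub_le {U : Set Pt} (hU : IsOpen U) (hconv : Convex ℝ U)
    {w G : Pt → ℝ} (hw : Integrable w) (hG : Integrable G) (hGm : StronglyMeasurable G) (e : Pt)
    (H : ∀ ψ : Pt → ℝ, ContDiff ℝ ∞ ψ → HasCompactSupport ψ → tsupport ψ ⊆ U →
      ∫ x, w x * fderiv ℝ ψ x e = - ∫ x, G x * ψ x) :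
    ∫⁻ x in U ∩ (fun y => y + e) ⁻¹' U, ‖w (x + e) - w x‖ₑ ^ 2 ≤ ∫⁻ x, ‖G x‖ₑ ^ 2 := by
  have hV : MeasurableSet (U ∩ (fun y => y + e) ⁻¹' U) :=
    (hU.inter (hU.preimage (by fun_prop))).measurableSet
  have hm2 : Measurable fun q : Pt × ℝ => ‖G (q.1 + q.2 • e)‖ₑ ^ 2 :=
    ((hGm.comp_measurable (g := fun q : Pt × ℝ => q.1 + q.2 • e) (by fun_prop)).enorm).pow_const 2
  calc ∫⁻ x in U ∩ (fun y => y + e) ⁻¹' U, ‖w (x + e) - w x‖ₑ ^ 2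
      ≤ ∫⁻ x in U ∩ (fun y => y + e) ⁻¹' U,
          ∫⁻ r in Set.Ioc (0 : ℝ) 1, ‖G (x + r • e)‖ₑ ^ 2 := by
        refine lintegral_mono_ae ((ae_restrict_iff' hV).2 ?_)
        filter_upwards [ae_sub_eq_integral_of_weak_directional hU hconv hw hG hGm e H] with x hx hxV
        rw [hx hxV, intervalIntegral.integral_of_le zero_le_one]
        refine (enorm_integral_sq_le _ _ ?_).trans ?_
        · exact (hGm.comp_measurable (g := fun r : ℝ => x + r • e)
            (by fun_prop)).aestronglyMeasurable
        · simp
    _ ≤ ∫⁻ x, ∫⁻ r in Set.Ioc (0 : ℝ) 1, ‖G (x + r • e)‖ₑ ^ 2 := setLIntegral_le_lintegral _ _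
    _ = ∫⁻ r in Set.Ioc (0 : ℝ) 1, ∫⁻ x, ‖G (x + r • e)‖ₑ ^ 2 :=
        lintegral_lintegral_swap hm2.aemeasurable
    _ = ∫⁻ r in Set.Ioc (0 : ℝ) 1, ∫⁻ x, ‖G x‖ₑ ^ 2 := by
        refine lintegral_congr fun r => ?_
        exact lintegral_add_right_eq_self (fun x => ‖G x‖ₑ ^ 2) (r • e)
    _ = _ := by simp

end RRM

namespace RRM

/-! ### From translates to the Poincaré inequality. -/

theorem fderiv_apply_eq_partialDeriv (ψ : Pt → ℝ) (x e : Pt) :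
    fderiv ℝ ψ x e = e 0 * partialDeriv 0 ψ x + e 1 * partialDeriv 1 ψ x := by
  have : e = e 0 • (Pi.single 0 1 : Pt) + e 1 • (Pi.single 1 1 : Pt) := by
    ext i; fin_cases i <;> simp
  conv_lhs => rw [this]
  simp [partialDeriv]

/-- The derivative along `e` is `e 0 * g₀ + e 1 * g₁`, and the factor `2` comes from `(a + b)² ≤ 2a²
+ 2b²`. Extension by zero makes the functions integrable on the plane; the jump across the boundary
is harmless because test functions are supported in `U`. -/
theorem lintegral_sq_translate_sub_le_of_isWeakDeriv {U : Set Pt} (hU : IsOpen U)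
    (hconv : Convex ℝ U) {w g₀ g₁ : Pt → ℝ} {h : ℝ}
    (hm₀ : StronglyMeasurable g₀) (hm₁ : StronglyMeasurable g₁)
    (hw : IntegrableOn w U) (hg₀ : IntegrableOn g₀ U) (hg₁ : IntegrableOn g₁ U)
    (H₀ : IsWeakDeriv U 1 0 w g₀) (H₁ : IsWeakDeriv U 0 1 w g₁) (e : Pt) (he : ∀ i, |e i| ≤ h) :
    ∫⁻ x in U ∩ (fun y => y + e) ⁻¹' U, ‖U.indicator w (x + e) - U.indicator w x‖ₑ ^ 2 ≤
      ENNReal.ofReal (2 * h ^ 2) * (∫⁻ x in U, ‖g₀ x‖ₑ ^ 2 + ‖g₁ x‖ₑ ^ 2) := by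
  have hUm := hU.measurableSet
  set G : Pt → ℝ := fun x => e 0 * g₀ x + e 1 * g₁ x
  have hGi : IntegrableOn G U := (hg₀.const_mul _).add (hg₁.const_mul _)
  have hGm : StronglyMeasurable G := (hm₀.const_mul _).add (hm₁.const_mul _)
  refine (lintegral_sq_translate_sub_le hU hconv (hw.integrable_indicator hUm)
    (hGi.integrable_indicator hUm) (hGm.indicator hUm) e ?_).trans ?_
  · intro ψ hψ hc hs
    have a₀ := H₀.2.2 ψ hψ hc hs
    have a₁ := H₁.2.2 ψ hψ hc hs
    simp only [Function.iterate_one, Function.iterate_zero, id, add_zero, zero_add, pow_one] at a₀ a₁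
    have hp : ∀ i, IntegrableOn (fun x => w x * partialDeriv i ψ x) U := fun i =>
      IsWeakDeriv.integrableOn_mul H₀.1 (contDiff_partialDeriv hψ i).continuous
        (hasCompactSupport_of_tsupport_subset hc (tsupport_partialDeriv_subset ψ i))
        ((tsupport_partialDeriv_subset ψ i).trans hs)
    have hq₀ := IsWeakDeriv.integrableOn_mul H₀.2.1 hψ.continuous hc hs
    have hq₁ := IsWeakDeriv.integrableOn_mul H₁.2.1 hψ.continuous hc hs
    have l : ∀ f k : Pt → ℝ, ∫ x, U.indicator f x * k x = ∫ x in U, f x * k x := fun f k => by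
      rw [← integral_indicator hUm]
      refine integral_congr_ae (.of_forall fun x => ?_)
      by_cases hx : x ∈ U <;> simp [hx]
    rw [l, l]
    have s1 : ∀ x, w x * fderiv ℝ ψ x e =
        e 0 * (w x * partialDeriv 0 ψ x) + e 1 * (w x * partialDeriv 1 ψ x) := fun x => by
      rw [fderiv_apply_eq_partialDeriv]; ring
    have s2 : ∀ x, G x * ψ x = e 0 * (g₀ x * ψ x) + e 1 * (g₁ x * ψ x) := fun x => by
      simp only [G]; ring
    simp_rw [s1, s2]
    rw [integral_add ((hp 0).const_mul _) ((hp 1).const_mul _),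
      integral_add (hq₀.const_mul _) (hq₁.const_mul _)]
    simp_rw [integral_const_mul]
    rw [a₀, a₁]
    ring
  · have : ∫⁻ x, ‖U.indicator G x‖ₑ ^ 2 = ∫⁻ x in U, ‖G x‖ₑ ^ 2 := by
      rw [← lintegral_indicator hUm]
      refine lintegral_congr fun x => ?_
      by_cases hx : x ∈ U <;> simp [hx]
    rw [this, ← lintegral_const_mul' _ _ ENNReal.ofReal_ne_top]
    refine lintegral_mono fun x => ?_
    simp only [Real.enorm_eq_ofReal_abs, ← ENNReal.ofReal_pow (abs_nonneg _), sq_abs]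
    rw [← ENNReal.ofReal_add (sq_nonneg _) (sq_nonneg _), ← ENNReal.ofReal_mul (by positivity)]
    refine ENNReal.ofReal_le_ofReal ?_
    have b : ∀ i, e i ^ 2 ≤ h ^ 2 := fun i => sq_le_sq' (abs_le.1 (he i)).1 (abs_le.1 (he i)).2
    calc (e 0 * g₀ x + e 1 * g₁ x) ^ 2
        ≤ 2 * (e 0 ^ 2 * g₀ x ^ 2 + e 1 ^ 2 * g₁ x ^ 2) := by
          nlinarith [sq_nonneg (e 0 * g₀ x - e 1 * g₁ x)]
      _ ≤ 2 * (h ^ 2 * g₀ x ^ 2 + h ^ 2 * g₁ x ^ 2) := by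
        nlinarith [mul_le_mul_of_nonneg_right (b 0) (sq_nonneg (g₀ x)),
          mul_le_mul_of_nonneg_right (b 1) (sq_nonneg (g₁ x))]
      _ = _ := by ring

/-- Substitute `y = x + e`. The difference `e` ranges over the square `[-h, h]²` of area `(2h)²`,
and for each fixed `e` the translation estimate applies. -/
theorem lintegral_lintegral_sq_sub_le {U T : Set Pt} (hU : IsOpen U) (hconv : Convex ℝ U)
    {h : ℝ} (hUh : ∀ x ∈ U, ∀ y ∈ U, ∀ i, |x i - y i| ≤ h)
    (hT : MeasurableSet T) (hTU : T ⊆ U) {w g₀ g₁ : Pt → ℝ} (hmw : StronglyMeasurable w)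
    (hm₀ : StronglyMeasurable g₀) (hm₁ : StronglyMeasurable g₁)
    (hw : IntegrableOn w U) (hg₀ : IntegrableOn g₀ U) (hg₁ : IntegrableOn g₁ U)
    (H₀ : IsWeakDeriv U 1 0 w g₀) (H₁ : IsWeakDeriv U 0 1 w g₁) :
    ∫⁻ x in U, ∫⁻ y in T, ‖w y - w x‖ₑ ^ 2 ≤
      ENNReal.ofReal ((2 * h) ^ 2) *
        (ENNReal.ofReal (2 * h ^ 2) * (∫⁻ x in U, ‖g₀ x‖ₑ ^ 2 + ‖g₁ x‖ₑ ^ 2)) := by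
  have hUm := hU.measurableSet
  set B := ENNReal.ofReal (2 * h ^ 2) * (∫⁻ x in U, ‖g₀ x‖ₑ ^ 2 + ‖g₁ x‖ₑ ^ 2)
  set u := U.indicator w with hu
  have hum : StronglyMeasurable u := hmw.indicator hUm
  set Q : Set Pt := Set.Icc (fun _ => -h) (fun _ => h)
  have hF : Measurable fun q : Pt × Pt => ‖u (q.1 + q.2) - u q.1‖ₑ ^ 2 := by
    have h1 := hum.measurable
    have h2 : Measurable fun q : Pt × Pt => u (q.1 + q.2) - u q.1 := by fun_prop
    exact h2.enorm.pow_const 2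
  set F : Pt → Pt → ℝ≥0∞ := fun x e =>
    U.indicator 1 x * U.indicator 1 (x + e) * ‖u (x + e) - u x‖ₑ ^ 2 with hFd
  have hFm : Measurable (Function.uncurry F) := by
    have h1 : Measurable (U.indicator (1 : Pt → ℝ≥0∞)) := measurable_one.indicator hUm
    have h2 : Measurable fun q : Pt × Pt => U.indicator (1 : Pt → ℝ≥0∞) q.1 *
      U.indicator (1 : Pt → ℝ≥0∞) (q.1 + q.2) := by fun_prop
    exact h2.mul hF
  have hD : ∀ e, ∫⁻ x, F x e ≤ Q.indicator (fun _ => B) e := by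
    intro e
    have hV : MeasurableSet (U ∩ (fun y => y + e) ⁻¹' U) :=
      (hU.inter (hU.preimage (by fun_prop))).measurableSet
    have e1 : ∫⁻ x, F x e = ∫⁻ x in U ∩ (fun y => y + e) ⁻¹' U, ‖u (x + e) - u x‖ₑ ^ 2 := by
      rw [← lintegral_indicator hV]
      refine lintegral_congr fun x => ?_
      by_cases h1 : x ∈ U <;> by_cases h2 : x + e ∈ U <;> simp [hFd, h1, h2]
    by_cases heQ : e ∈ Q
    · rw [Set.indicator_of_mem heQ, e1]
      exact lintegral_sq_translate_sub_le_of_isWeakDeriv hU hconv hm₀ hm₁ hw hg₀ hg₁ H₀ H₁ e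
        fun i => abs_le.2 ⟨heQ.1 i, heQ.2 i⟩
    · have : U ∩ (fun y => y + e) ⁻¹' U = ∅ := by
        rw [Set.eq_empty_iff_forall_notMem]
        rintro x ⟨h1, h2⟩
        refine heQ ⟨fun i => ?_, fun i => ?_⟩ <;>
          · have := abs_le.1 (hUh _ h2 _ h1 i)
            simp only [Pi.add_apply, add_sub_cancel_left] at this
            linarith
      rw [e1, this]
      simp
  calc ∫⁻ x in U, ∫⁻ y in T, ‖w y - w x‖ₑ ^ 2
      ≤ ∫⁻ x in U, ∫⁻ e, F x e := by
        refine setLIntegral_mono' hUm fun x hx => ?_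
        rw [← lintegral_indicator hT,
          ← lintegral_add_left_eq_self (T.indicator fun y => ‖w y - w x‖ₑ ^ 2) x]
        refine lintegral_mono fun e => ?_
        by_cases h1 : x + e ∈ T
        · have h2 := hTU h1
          simp [hFd, hu, h1, hx, h2]
        · simp [h1]
    _ ≤ ∫⁻ x, ∫⁻ e, F x e := setLIntegral_le_lintegral _ _
    _ = ∫⁻ e, ∫⁻ x, F x e := lintegral_lintegral_swap hFm.aemeasurable
    _ ≤ ∫⁻ e, Q.indicator (fun _ => B) e := lintegral_mono hD
    _ = B * volume Q := by rw [lintegral_indicator measurableSet_Icc, setLIntegral_const]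
    _ = _ := by
      rw [Real.volume_Icc_pi]
      simp only [sub_neg_eq_add, Finset.prod_const, Finset.card_univ, Fintype.card_fin]
      rcases le_total 0 h with h0 | h0
      · rw [← ENNReal.ofReal_pow (by linarith), mul_comm, ← two_mul]
      · rcases h0.eq_or_lt with rfl | h0
        · simp
        -- A negative diameter bound is possible only if `U` is empty.
        · have : B = 0 := by
            have hUe : U = ∅ := by
              rw [Set.eq_empty_iff_forall_notMem]
              intro x hx
              have := hUh x hx x hx 0
              simp at this
              linarith
            simp [B, hUe]
          simp [this]

theorem integrableOn_of_memLp_two {U : Set Pt} (hU : volume U ≠ ⊤) {f : Pt → ℝ}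
    (hf : MemLp f 2 (volume.restrict U)) : IntegrableOn f U := by
  have : IsFiniteMeasure (volume.restrict U) := ⟨by simpa using hU.lt_top⟩
  exact hf.integrable (by norm_num)

/-- The Poincaré inequality for functions with mean zero over a subset. -/
theorem poincare {U T : Set Pt} (hU : IsOpen U) (hconv : Convex ℝ U) (hUfin : volume U ≠ ⊤)
    {h : ℝ} (hUh : ∀ x ∈ U, ∀ y ∈ U, ∀ i, |x i - y i| ≤ h)
    (hT : MeasurableSet T) (hTU : T ⊆ U) {w g₀ g₁ : Pt → ℝ}
    (hw : MemLp w 2 (volume.restrict U)) (hg₀ : MemLp g₀ 2 (volume.restrict U))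
    (hg₁ : MemLp g₁ 2 (volume.restrict U))
    (H₀ : IsWeakDeriv U 1 0 w g₀) (H₁ : IsWeakDeriv U 0 1 w g₁) (hmean : ∫ x in T, w x = 0) :
    volume T * ∫⁻ x in U, ‖w x‖ₑ ^ 2 ≤ ENNReal.ofReal (8 * h ^ 4) *
      ((∫⁻ x in U, ‖g₀ x‖ₑ ^ 2) + ∫⁻ x in U, ‖g₁ x‖ₑ ^ 2) := by
  -- Replacing the functions by strongly measurable representatives makes the translated integrands
  -- jointly measurable, as Fubini requires.
  have red : ∀ {f : Pt → ℝ}, MemLp f 2 (volume.restrict U) → ∃ f', StronglyMeasurable f' ∧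
      f =ᵐ[volume.restrict U] f' ∧ IntegrableOn f' U := fun hf => by
    obtain ⟨f', h1, h2⟩ := hf.1
    exact ⟨f', h1, h2, (integrableOn_of_memLp_two hUfin hf).congr h2⟩
  obtain ⟨w', hwm, hww, hwi⟩ := red hw
  obtain ⟨k₀, hkm₀, hkk₀, hki₀⟩ := red hg₀
  obtain ⟨k₁, hkm₁, hkk₁, hki₁⟩ := red hg₁
  have chg : ∀ {a b : ℕ} {g k : Pt → ℝ}, IsWeakDeriv U a b w g → g =ᵐ[volume.restrict U] k →
      IntegrableOn k U → IsWeakDeriv U a b w' k := by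
    intro a b g k H hgk hk
    have H' := H.congr_left hww hwi.locallyIntegrableOn
    refine ⟨H'.1, hk.locallyIntegrableOn, fun ψ hψ hc hs => ?_⟩
    rw [H'.2.2 ψ hψ hc hs]
    congr 1
    exact integral_congr_ae (hgk.mono fun x hx => by simp only [hx])
  have main := lintegral_lintegral_sq_sub_le hU hconv hUh hT hTU hwm hkm₀ hkm₁ hwi hki₀ hki₁
    (chg H₀ hkk₀ hki₀) (chg H₁ hkk₁ hki₁)
  have sq : ∀ {f k : Pt → ℝ}, f =ᵐ[volume.restrict U] k →
      ∫⁻ x in U, ‖f x‖ₑ ^ 2 = ∫⁻ x in U, ‖k x‖ₑ ^ 2 := fun hfk =>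
    lintegral_congr_ae (hfk.mono fun x hx => by simp only [hx])
  have hTfin : volume T ≠ ⊤ := ne_top_of_le_ne_top hUfin (measure_mono hTU)
  have hmean' : ∫ x in T, w' x = 0 := by
    rw [← hmean]
    exact integral_congr_ae (ae_restrict_of_ae_restrict_of_subset hTU hww.symm)
  rw [sq hww, sq hkk₀, sq hkk₁]
  by_cases hT0 : volume T = 0
  · simp [hT0]
  rw [← lintegral_const_mul' _ _ hTfin]
  have hsplit : (∫⁻ x in U, ‖k₀ x‖ₑ ^ 2 + ‖k₁ x‖ₑ ^ 2) =
      (∫⁻ x in U, ‖k₀ x‖ₑ ^ 2) + ∫⁻ x in U, ‖k₁ x‖ₑ ^ 2 :=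
    lintegral_add_left (hkm₀.enorm.pow_const 2) _
  refine le_trans ?_ (main.trans (le_of_eq ?_))
  · refine lintegral_mono fun x => ?_
    have hwT : IntegrableOn w' T := hwi.mono_set hTU
    have : IsFiniteMeasure (volume.restrict T) := ⟨by simpa using hTfin.lt_top⟩
    -- Mean zero turns `|T| w(x)` into an integral of differences. After Cauchy–Schwarz, one of the
    -- two factors `|T|` cancels.
    have e1 : ∫ y in T, (w' y - w' x) = - (volume.real T * w' x) := by
      rw [integral_sub hwT (integrable_const _), hmean']
      simp [measureReal_def]
    have e2 := enorm_integral_sq_le (volume.restrict T) (fun y => w' y - w' x)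
      (hwm.sub stronglyMeasurable_const).aestronglyMeasurable
    rw [e1, Measure.restrict_apply_univ, enorm_neg, enorm_mul, mul_pow,
      Real.enorm_of_nonneg measureReal_nonneg, measureReal_def, ENNReal.ofReal_toReal hTfin,
      pow_two, mul_assoc] at e2
    exact (ENNReal.mul_le_mul_iff_right hT0 hTfin).1 e2
  · rw [hsplit, ← mul_assoc, ← ENNReal.ofReal_mul (by positivity)]
    congr 2
    ring

end RRM

namespace RRM

/-! ### Quadratic polynomials in two variables -/

/-- The quadratic polynomial with the given coefficients. -/
noncomputable def quadPoly (a b c d e f : ℝ) : MvPolynomial (Fin 2) ℝ :=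
  C a + C b * X 0 + C c * X 1 + C d * X 0 ^ 2 + C e * (X 0 * X 1) + C f * X 1 ^ 2

theorem eval_quadPoly (a b c d e f : ℝ) (x : Pt) : eval x (quadPoly a b c d e f) =
    a + b * x 0 + c * x 1 + d * x 0 ^ 2 + e * (x 0 * x 1) + f * x 1 ^ 2 := by
  simp [quadPoly]

theorem eval_pderiv_zero_quadPoly (a b c d e f : ℝ) (x : Pt) :
    eval x (pderiv 0 (quadPoly a b c d e f)) = b + 2 * d * x 0 + e * x 1 := by
  simp [quadPoly, Derivation.leibniz, pderiv_X]
  ring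

theorem eval_pderiv_one_quadPoly (a b c d e f : ℝ) (x : Pt) :
    eval x (pderiv 1 (quadPoly a b c d e f)) = c + e * x 0 + 2 * f * x 1 := by
  simp [quadPoly, Derivation.leibniz, pderiv_X]
  ring

theorem exists_eq_quadPoly {p : MvPolynomial (Fin 2) ℝ} (hp : p.totalDegree ≤ 2) :
    ∃ a b c d e f, p = quadPoly a b c d e f := by
  rw [p.as_sum]
  refine Finset.sum_induction _ (fun q => ∃ a b c d e f, q = quadPoly a b c d e f) ?_ ?_ ?_
  · rintro _ _ ⟨a, b, c, d, e, f, rfl⟩ ⟨a', b', c', d', e', f', rfl⟩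
    refine ⟨a + a', b + b', c + c', d + d', e + e', f + f', ?_⟩
    simp only [quadPoly, C_add]
    ring
  · exact ⟨0, 0, 0, 0, 0, 0, by simp [quadPoly]⟩
  · intro n hn
    have hdeg : n 0 + n 1 ≤ 2 := by
      have := (le_totalDegree hn).trans hp
      rwa [Finsupp.sum_fintype _ _ (fun _ => rfl), Fin.sum_univ_two] at this
    have hmon : monomial n (coeff n p) = C (coeff n p) * (X 0 ^ n 0 * X 1 ^ n 1) := by
      rw [monomial_eq, Finsupp.prod_fintype _ _ (fun _ => by simp), Fin.prod_univ_two]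
    rw [hmon]
    generalize coeff n p = t
    generalize n 0 = i at hdeg
    generalize n 1 = j at hdeg
    have hi : i ≤ 2 := by omega
    interval_cases i
    · have hj : j ≤ 2 := by omega
      interval_cases j
      · exact ⟨t, 0, 0, 0, 0, 0, by simp [quadPoly]⟩
      · exact ⟨0, 0, t, 0, 0, 0, by simp [quadPoly]⟩
      · exact ⟨0, 0, 0, 0, 0, t, by simp [quadPoly]⟩
    · have hj : j ≤ 1 := by omega
      interval_cases j
      · exact ⟨0, t, 0, 0, 0, 0, by simp [quadPoly]⟩
      · exact ⟨0, 0, 0, 0, t, 0, by simp [quadPoly]⟩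
    · have hj : j = 0 := by omega
      subst hj
      exact ⟨0, 0, 0, t, 0, 0, by simp [quadPoly]⟩

theorem inv_mul_integral_affine (A B : ℝ) {u w : ℝ} (h : u < w) :
    (w - u)⁻¹ * ∫ t in u..w, (A + B * t) = A + B * ((u + w) / 2) := by
  have : w - u ≠ 0 := sub_ne_zero.2 h.ne'
  rw [intervalIntegral.integral_add (Continuous.intervalIntegrable (by fun_prop) _ _)
    (Continuous.intervalIntegrable (by fun_prop) _ _), intervalIntegral.integral_const,
    intervalIntegral.integral_const_mul, integral_id, smul_eq_mul]
  field_simp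
  ring

namespace Rect

variable {K : Rect}

theorem normalMean_zero_quadPoly (hK : ∀ i, K.lo i < K.hi i) (a b c d e f : ℝ) (s : Bool) :
    K.normalMean (quadPoly a b c d e f) 0 s =
      b + 2 * d * K.face 0 s + e * ((K.lo 1 + K.hi 1) / 2) := by
  unfold normalMean
  rw [← inv_mul_integral_affine _ _ (hK 1)]
  congr 1
  refine intervalIntegral.integral_congr fun t _ => ?_
  simp only [eval_pderiv_zero_quadPoly]
  simp

theorem normalMean_one_quadPoly (hK : ∀ i, K.lo i < K.hi i) (a b c d e f : ℝ) (s : Bool) :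
    K.normalMean (quadPoly a b c d e f) 1 s =
      c + 2 * f * K.face 1 s + e * ((K.lo 0 + K.hi 0) / 2) := by
  unfold normalMean
  rw [← inv_mul_integral_affine _ _ (hK 0)]
  congr 1
  refine intervalIntegral.integral_congr fun t _ => ?_
  simp only [eval_pderiv_one_quadPoly]
  simp
  ring

/-- The trapezoidal rule, exact because the averaged normal derivative of a quadratic is affine
across the cell. The two instances are the linear relations between the eight numbers (four vertex
values, four normal means) attached to the six-dimensional space of quadratics. -/
theorem normalMean_add_normalMean (hK : ∀ i, K.lo i < K.hi i) {p : MvPolynomial (Fin 2) ℝ}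
    (hp : p.totalDegree ≤ 2) (i : Fin 2) :
    (K.normalMean p i false + K.normalMean p i true) * (K.hi i - K.lo i) =
      (eval (Function.update K.lo i (K.hi i)) p + eval (Function.update K.hi i (K.hi i)) p) -
      (eval (Function.update K.lo i (K.lo i)) p + eval (Function.update K.hi i (K.lo i)) p) := by
  obtain ⟨a, b, c, d, e, f, rfl⟩ := exists_eq_quadPoly hp
  fin_cases i
  · simp [normalMean_zero_quadPoly hK, eval_quadPoly, face]
    ring
  · simp [normalMean_one_quadPoly hK, eval_quadPoly, face]
    ring

/-- Differences of opposite normal means give the pure second derivatives and the alternating sum of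
vertex values gives the mixed one; the lower coefficients follow. -/
theorem eq_of_vertex_normalMean (hK : ∀ i, K.lo i < K.hi i) {p q : MvPolynomial (Fin 2) ℝ}
    (hp : p.totalDegree ≤ 2) (hq : q.totalDegree ≤ 2)
    (hv : ∀ a, K.IsVertex a → eval a p = eval a q)
    (hn : ∀ i b, K.normalMean p i b = K.normalMean q i b) : p = q := by
  obtain ⟨a, b, c, d, e, f, rfl⟩ := exists_eq_quadPoly hp
  obtain ⟨a', b', c', d', e', f', rfl⟩ := exists_eq_quadPoly hq
  have h0 : K.hi 0 - K.lo 0 ≠ 0 := sub_ne_zero.2 (hK 0).ne'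
  have h1 : K.hi 1 - K.lo 1 ≠ 0 := sub_ne_zero.2 (hK 1).ne'
  have n0t := hn 0 true
  have n0f := hn 0 false
  have n1t := hn 1 true
  have n1f := hn 1 false
  simp only [normalMean_zero_quadPoly hK, normalMean_one_quadPoly hK, face] at n0t n0f n1t n1f
  have v00 := hv ![K.lo 0, K.lo 1] (fun i => by fin_cases i <;> simp)
  have v10 := hv ![K.hi 0, K.lo 1] (fun i => by fin_cases i <;> simp)
  have v01 := hv ![K.lo 0, K.hi 1] (fun i => by fin_cases i <;> simp)
  have v11 := hv ![K.hi 0, K.hi 1] (fun i => by fin_cases i <;> simp)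
  simp [eval_quadPoly] at v00 v10 v01 v11
  simp only [if_true, Bool.false_eq_true, if_false] at n0t n0f n1t n1f
  obtain rfl : d = d' := mul_right_cancel₀ h0 (by linear_combination (n0t - n0f) / 2)
  obtain rfl : f = f' := mul_right_cancel₀ h1 (by linear_combination (n1t - n1f) / 2)
  obtain rfl : e = e' := mul_right_cancel₀ (mul_ne_zero h0 h1)
    (by linear_combination v11 - v10 - v01 + v00)
  obtain rfl : b = b' := by linear_combination n0t
  obtain rfl : c = c' := by linear_combination n1t
  obtain rfl : a = a' := by linear_combination v00
  rfl

end Rect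

/-! ### The basis functions -/

namespace Patch

variable {M : Patch}

theorem len_pos (hM : ∀ i, StrictMono (M i)) (i : Fin 2) (j : Fin 3) : 0 < M.len i j :=
  sub_pos.2 (hM i Fin.castSucc_lt_succ)

theorem cell_lt (hM : ∀ i, StrictMono (M i)) (m : Fin 2 → Fin 3) (i : Fin 2) :
    (M.cell m).lo i < (M.cell m).hi i := hM i Fin.castSucc_lt_succ

theorem splVal_zero (hM : ∀ i, StrictMono (M i)) (i : Fin 2) : M.splVal i (M i 0) = 0 := by
  rw [splVal, if_neg ((hM i).injective.ne (by decide)), if_neg ((hM i).injective.ne (by decide))]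

theorem splVal_one (i : Fin 2) :
    M.splVal i (M i 1) = M.len i 0 / (M.len i 0 + M.len i 1) := by
  rw [splVal, if_pos rfl]

theorem splVal_two (hM : ∀ i, StrictMono (M i)) (i : Fin 2) :
    M.splVal i (M i 2) = M.len i 2 / (M.len i 1 + M.len i 2) := by
  rw [splVal, if_neg ((hM i).injective.ne (by decide)), if_pos rfl]

theorem splVal_three (hM : ∀ i, StrictMono (M i)) (i : Fin 2) : M.splVal i (M i 3) = 0 := by
  rw [splVal, if_neg ((hM i).injective.ne (by decide)), if_neg ((hM i).injective.ne (by decide))]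

theorem splDer_zero (hM : ∀ i, StrictMono (M i)) (i : Fin 2) : M.splDer i (M i 0) = 0 := by
  rw [splDer, if_neg ((hM i).injective.ne (by decide)), if_neg ((hM i).injective.ne (by decide))]

theorem splDer_one (i : Fin 2) : M.splDer i (M i 1) = 2 / (M.len i 0 + M.len i 1) := by
  rw [splDer, if_pos rfl]

theorem splDer_two (hM : ∀ i, StrictMono (M i)) (i : Fin 2) :
    M.splDer i (M i 2) = -2 / (M.len i 1 + M.len i 2) := by
  rw [splDer, if_neg ((hM i).injective.ne (by decide)), if_pos rfl]

theorem splDer_three (hM : ∀ i, StrictMono (M i)) (i : Fin 2) : M.splDer i (M i 3) = 0 := by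
  rw [splDer, if_neg ((hM i).injective.ne (by decide)), if_neg ((hM i).injective.ne (by decide))]

theorem splDer_add_splDer (hM : ∀ i, StrictMono (M i)) (i : Fin 2) (n : Fin 3) :
    (M.splDer i (M i n.castSucc) + M.splDer i (M i n.succ)) * M.len i n =
      2 * (M.splVal i (M i n.succ) - M.splVal i (M i n.castSucc)) := by
  have l0 := len_pos hM i 0
  have l1 := len_pos hM i 1
  have l2 := len_pos hM i 2
  have h01 : M.len i 0 + M.len i 1 ≠ 0 := by positivity
  have h12 : M.len i 1 + M.len i 2 ≠ 0 := by positivity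
  fin_cases n
  · change (M.splDer i (M i 0) + M.splDer i (M i 1)) * (M.len i 0) =
      2 * (M.splVal i (M i 1) - M.splVal i (M i 0))
    rw [splDer_zero hM, splDer_one, splVal_zero hM, splVal_one]
    field_simp
    ring
  · change (M.splDer i (M i 1) + M.splDer i (M i 2)) * (M.len i 1) =
      2 * (M.splVal i (M i 2) - M.splVal i (M i 1))
    rw [splDer_one, splDer_two hM, splVal_one, splVal_two hM]
    field_simp
    ring
  · change (M.splDer i (M i 2) + M.splDer i (M i 3)) * (M.len i 2) =
      2 * (M.splVal i (M i 3) - M.splVal i (M i 2))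
    rw [splDer_two hM, splDer_three hM, splVal_two hM, splVal_three hM]
    field_simp
    ring

theorem cell_mem_grid (M : Patch) (m : Fin 2 → Fin 3) : M.cell m ∈ M.grid := by
  classical exact Finset.mem_image_of_mem _ (Finset.mem_univ m)

theorem exists_of_mem_grid {K : Rect} (h : K ∈ M.grid) : ∃ m, K = M.cell m := by
  classical
  obtain ⟨m, -, rfl⟩ := Finset.mem_image.1 h
  exact ⟨m, rfl⟩

theorem cell_closed_subset (hM : ∀ i, StrictMono (M i)) (m : Fin 2 → Fin 3) :
    (M.cell m).closed ⊆ M.closed := fun _ hx i =>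
  ⟨((hM i).monotone (Fin.zero_le _)).trans (hx i).1,
    (hx i).2.trans ((hM i).monotone (Fin.le_last _))⟩

theorem cell_inner_subset (hM : ∀ i, StrictMono (M i)) (m : Fin 2 → Fin 3) :
    (M.cell m).inner ⊆ M.inner := fun _ hx i =>
  ⟨((hM i).monotone (Fin.zero_le _)).trans_lt (hx i).1,
    (hx i).2.trans_le ((hM i).monotone (Fin.le_last _))⟩

theorem region_grid_subset (hM : ∀ i, StrictMono (M i)) : region M.grid ⊆ M.closed := by
  refine Set.iUnion₂_subset fun K hK => ?_
  obtain ⟨m, rfl⟩ := exists_of_mem_grid hK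
  exact cell_closed_subset hM m

/-- A point on an outer line leaves the closed patch under arbitrarily small shifts in the direction
`i`, so it is not interior. -/
theorem mem_frontier_region (hM : ∀ i, StrictMono (M i)) {K : Rect} (hK : K ∈ M.grid) {a : Pt}
    (ha : a ∈ K.closed) {i : Fin 2} (hi : a i = M i 0 ∨ a i = M i 3) :
    a ∈ frontier (region M.grid) := by
  refine ⟨subset_closure (Set.mem_iUnion₂.2 ⟨K, hK, ha⟩), fun hint => ?_⟩
  have hnhds : M.closed ∈ nhds a :=
    Filter.mem_of_superset (mem_interior_iff_mem_nhds.1 hint) (region_grid_subset hM)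
  have hc : Filter.Tendsto (fun t : ℝ => Function.update a i t) (nhds (a i)) (nhds a) := by
    have : Continuous fun t : ℝ => Function.update a i t := continuous_const.update i continuous_id
    simpa using this.tendsto (a i)
  have hev := hc.eventually hnhds
  rcases hi with hi | hi
  · obtain ⟨t, ht, h⟩ := ((hev.filter_mono nhdsWithin_le_nhds).and
      (self_mem_nhdsWithin (a := a i) (s := Set.Iio (a i)))).exists
    have h1 := (ht i).1
    simp only [Function.update_self] at h1
    exact absurd h (by simp [← hi] at h1; simpa using h1)
  · obtain ⟨t, ht, h⟩ := ((hev.filter_mono nhdsWithin_le_nhds).and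
      (self_mem_nhdsWithin (a := a i) (s := Set.Ioi (a i)))).exists
    have h1 := (ht i).2
    simp only [Function.update_self] at h1
    exact absurd h (by simp [← hi] at h1; simpa using h1)

/-- The index of a cell that has the line with the given index as a side. -/
def cellIndex : Fin 4 → Fin 3 := ![0, 1, 2, 2]

theorem cellIndex_spec (k : Fin 4) : k = (cellIndex k).castSucc ∨ k = (cellIndex k).succ := by
  fin_cases k <;> decide

/-! ### Uniqueness of the basis function. -/

section Uniqueness

variable {φ : Pt → ℝ} {p : Rect → MvPolynomial (Fin 2) ℝ}

/-- The value at the vertex with the given indices. -/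
noncomputable def nodal (M : Patch) (p : Rect → MvPolynomial (Fin 2) ℝ) (k : Fin 2 → Fin 4) : ℝ :=
  eval (fun i => M i (k i)) (p (M.cell fun i => cellIndex (k i)))

theorem isVertex_cell (M : Patch) (m : Fin 2 → Fin 3) (k : Fin 2 → Fin 4)
    (h : ∀ i, k i = (m i).castSucc ∨ k i = (m i).succ) :
    (M.cell m).IsVertex fun i => M i (k i) := fun i =>
  (h i).imp (fun e => by simp [cell, e]) (fun e => by simp [cell, e])

theorem eval_eq_nodal (H : IsReducedMorley₀ M.grid φ p) (m : Fin 2 → Fin 3) (k : Fin 2 → Fin 4)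
    (h : ∀ i, k i = (m i).castSucc ∨ k i = (m i).succ) :
    eval (fun i => M i (k i)) (p (M.cell m)) = M.nodal p k :=
  H.vertex_continuous _ _ (M.cell_mem_grid m) _ (M.cell_mem_grid _) (M.isVertex_cell m k h)
    (M.isVertex_cell _ k fun i => cellIndex_spec (k i))

theorem nodal_boundary (hM : ∀ i, StrictMono (M i)) (H : IsReducedMorley₀ M.grid φ p)
    (k : Fin 2 → Fin 4) (i : Fin 2) (h : k i = 0 ∨ k i = 3) : M.nodal p k = 0 := by
  have hv := M.isVertex_cell _ k fun i => cellIndex_spec (k i)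
  refine H.vertex_boundary _ ?_ _ (M.cell_mem_grid _) hv
  refine mem_frontier_region hM (M.cell_mem_grid fun i => cellIndex (k i)) (i := i) (fun j => ?_) (by
    simpa only [(hM i).injective.eq_iff] using h)
  have := cell_lt hM (fun i => cellIndex (k i)) j
  rcases hv j with e | e <;> beta_reduce at e <;> constructor <;> linarith

theorem normalMean_boundary_false (hM : ∀ i, StrictMono (M i)) (H : IsReducedMorley₀ M.grid φ p)
    (m : Fin 2 → Fin 3) (i : Fin 2) (h : m i = 0) :
    (M.cell m).normalMean (p (M.cell m)) i false = 0 := by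
  refine H.edge_boundary _ (M.cell_mem_grid m) i false fun N hN hn => ?_
  obtain ⟨n, rfl⟩ := exists_of_mem_grid hN
  have := hn.1
  simp only [Rect.face, cell, h] at this
  have h1 := (hM i).injective this
  simp at h1

theorem normalMean_boundary_true (hM : ∀ i, StrictMono (M i)) (H : IsReducedMorley₀ M.grid φ p)
    (m : Fin 2 → Fin 3) (i : Fin 2) (h : m i = 2) :
    (M.cell m).normalMean (p (M.cell m)) i true = 0 := by
  refine H.edge_boundary _ (M.cell_mem_grid m) i true fun N hN hn => ?_
  obtain ⟨n, rfl⟩ := exists_of_mem_grid hN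
  have := hn.1
  simp only [Rect.face, cell, h] at this
  have h1 := (hM i).injective this
  generalize n i = j at h1
  revert h1
  fin_cases j <;> decide

theorem normalMean_interior (H : IsReducedMorley₀ M.grid φ p)
    (m : Fin 2 → Fin 3) (i : Fin 2) (j j' : Fin 3) (h : j'.castSucc = j.succ) :
    (M.cell (Function.update m i j)).normalMean (p (M.cell (Function.update m i j))) i true =
    (M.cell (Function.update m i j')).normalMean (p (M.cell (Function.update m i j'))) i false := by
  refine H.edge_continuous _ (M.cell_mem_grid _) _ (M.cell_mem_grid _) i true ⟨?_, fun l hl => ?_⟩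
  · simp [Rect.face, cell, h]
  · simp [cell, Function.update_of_ne hl]

/-- The mean of the nodal values at the two ends of the edge on the line `k` in the direction `i`,
in the row of the cell `m`. -/
noncomputable def nodalMean (M : Patch) (p : Rect → MvPolynomial (Fin 2) ℝ) (m : Fin 2 → Fin 3)
    (i : Fin 2) (k : Fin 4) : ℝ :=
  (M.nodal p (Function.update (fun l => (m l).castSucc) i k) +
    M.nodal p (Function.update (fun l => (m l).succ) i k)) / 2

theorem normalMean_add_eq_nodalMean (hM : ∀ i, StrictMono (M i))
    (H : IsReducedMorley₀ M.grid φ p) (m : Fin 2 → Fin 3) (i : Fin 2) :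
    ((M.cell m).normalMean (p (M.cell m)) i false + (M.cell m).normalMean (p (M.cell m)) i true) *
      M.len i (m i) = 2 * (M.nodalMean p m i (m i).succ - M.nodalMean p m i (m i).castSucc) := by
  have h := Rect.normalMean_add_normalMean (cell_lt hM m) (H.degree _ (M.cell_mem_grid m)) i
  have hpt : ∀ (s : Fin 2 → Fin 4) (k : Fin 4), (∀ l, s l = (m l).castSucc ∨ s l = (m l).succ) →
      (k = (m i).castSucc ∨ k = (m i).succ) →
      eval (Function.update (fun l => M l (s l)) i (M i k)) (p (M.cell m)) =
        M.nodal p (Function.update s i k) := by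
    intro s k hs hk
    rw [← eval_eq_nodal H m]
    · congr 2
      funext l
      by_cases hl : l = i
      · subst hl; simp
      · simp [hl]
    · intro l
      by_cases hl : l = i
      · subst hl; simpa using hk
      · simpa [hl] using hs l
  have e1 := hpt (fun l => (m l).castSucc) (m i).succ (fun l => .inl rfl) (.inr rfl)
  have e2 := hpt (fun l => (m l).succ) (m i).succ (fun l => .inr rfl) (.inr rfl)
  have e3 := hpt (fun l => (m l).castSucc) (m i).castSucc (fun l => .inl rfl) (.inl rfl)
  have e4 := hpt (fun l => (m l).succ) (m i).castSucc (fun l => .inr rfl) (.inl rfl)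
  simp only [cell] at h
  rw [show M.cell m = ⟨fun i => M i (m i).castSucc, fun i => M i (m i).succ⟩ from rfl] at e1 e2 e3 e4
  rw [e1, e2, e3, e4] at h
  simp only [nodalMean, len, cell]
  rw [h]
  ring

theorem nodalMean_update (M : Patch) (p : Rect → MvPolynomial (Fin 2) ℝ) (m : Fin 2 → Fin 3)
    (i : Fin 2) (j : Fin 3) (k : Fin 4) :
    M.nodalMean p (Function.update m i j) i k = M.nodalMean p m i k := by
  have : ∀ f : Fin 3 → Fin 4, Function.update (fun l => f (Function.update m i j l)) i k =
      Function.update (fun l => f (m l)) i k := by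
    intro f
    funext l
    by_cases hl : l = i
    · subst hl; simp
    · simp [hl]
  simp only [nodalMean, this Fin.castSucc, this Fin.succ]

/-- In each row of cells, mean nodal values and normal means are proportional to the values and
slopes of the spline. -/
theorem exists_row_proportional (hM : ∀ i, StrictMono (M i)) (H : IsReducedMorley₀ M.grid φ p)
    (m : Fin 2 → Fin 3) (i : Fin 2) : ∃ ρ : ℝ,
      (∀ k, M.nodalMean p m i k = ρ * M.splVal i (M i k)) ∧
      ∀ b, (M.cell m).normalMean (p (M.cell m)) i b =
        ρ * M.splDer i ((M.cell m).face i b) := by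
  have l0 := len_pos hM i 0
  have l1 := len_pos hM i 1
  have l2 := len_pos hM i 2
  have E := fun j => normalMean_add_eq_nodalMean hM H (Function.update m i j) i
  simp only [nodalMean_update, Function.update_self] at E
  have E0 := E 0
  have E1 := E 1
  have E2 := E 2
  have A0 : M.nodalMean p m i 0 = 0 := by
    simp only [nodalMean]
    rw [nodal_boundary hM H _ i (by simp), nodal_boundary hM H _ i (by simp)]
    simp
  have A3 : M.nodalMean p m i 3 = 0 := by
    simp only [nodalMean]
    rw [nodal_boundary hM H _ i (by simp), nodal_boundary hM H _ i (by simp)]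
    simp
  have B0 := normalMean_boundary_false hM H (Function.update m i 0) i (by simp)
  have B3 := normalMean_boundary_true hM H (Function.update m i 2) i (by simp)
  have I1 := normalMean_interior H m i 0 1 rfl
  have I2 := normalMean_interior H m i 1 2 rfl
  change _ = 2 * (M.nodalMean p m i 1 - M.nodalMean p m i 0) at E0
  change _ = 2 * (M.nodalMean p m i 2 - M.nodalMean p m i 1) at E1
  change _ = 2 * (M.nodalMean p m i 3 - M.nodalMean p m i 2) at E2
  have hm : M.cell m = M.cell (Function.update m i (m i)) := by simp
  -- The row now has four unknowns, the mean values `A1`, `A2` and the slopes `n1`, `n2` at the two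
  -- inner lines, and three trapezoidal equations, one for each cell. The solutions form a line,
  -- spanned by the spline.
  rw [B0, A0, I1] at E0
  rw [I2] at E1
  rw [B3, A3] at E2
  set n1 := (M.cell (Function.update m i 1)).normalMean (p (M.cell (Function.update m i 1))) i false
  set n2 := (M.cell (Function.update m i 2)).normalMean (p (M.cell (Function.update m i 2))) i false
  set A1 := M.nodalMean p m i 1
  set A2 := M.nodalMean p m i 2
  have h01 : M.len i 0 + M.len i 1 ≠ 0 := by positivity
  have h12 : M.len i 1 + M.len i 2 ≠ 0 := by positivity
  have hn1 : n1 = 2 * A1 / M.len i 0 := by field_simp; linarith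
  have hn2 : n2 = - 2 * A2 / M.len i 2 := by field_simp; linarith
  have hA : A2 = A1 * (M.len i 0 + M.len i 1) / M.len i 0 *
      (M.len i 2 / (M.len i 1 + M.len i 2)) := by
    rw [hn1, hn2] at E1
    field_simp at E1 ⊢
    linarith
  have hN : ∀ j b, (M.cell (Function.update m i j)).normalMean
      (p (M.cell (Function.update m i j))) i b =
      A1 * (M.len i 0 + M.len i 1) / M.len i 0 *
        M.splDer i ((M.cell (Function.update m i j)).face i b) := by
    intro j b
    have q1 : n1 = A1 * (M.len i 0 + M.len i 1) / M.len i 0 * M.splDer i (M i 1) := by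
      rw [splDer_one, hn1]; field_simp
    have q2 : n2 = A1 * (M.len i 0 + M.len i 1) / M.len i 0 * M.splDer i (M i 2) := by
      rw [splDer_two hM, hn2, hA]; field_simp
    simp only [Rect.face, cell, Function.update_self] at *
    fin_cases j <;> cases b
    · refine B0.trans ?_
      change _ = _ * M.splDer i (M i 0)
      rw [splDer_zero hM, mul_zero]
    · exact I1.trans q1
    · exact q1
    · exact I2.trans q2
    · exact q2
    · refine B3.trans ?_
      change _ = _ * M.splDer i (M i 3)
      rw [splDer_three hM, mul_zero]
  -- The factor is `A1` divided by the spline's value at the line `M i 1`.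
  refine ⟨A1 * (M.len i 0 + M.len i 1) / M.len i 0, fun k => ?_, fun b => ?_⟩
  · fin_cases k
    · change M.nodalMean p m i 0 = _ * M.splVal i (M i 0)
      rw [A0, splVal_zero hM, mul_zero]
    · change A1 = _ * M.splVal i (M i 1)
      rw [splVal_one]; field_simp
    · change A2 = _ * M.splVal i (M i 2)
      rw [splVal_two hM, hA]
    · change M.nodalMean p m i 3 = _ * M.splVal i (M i 3)
      rw [A3, splVal_three hM, mul_zero]
  · rw [hm]
    exact hN (m i) b

/-- In an outer row of cells the nodal values on the outer line vanish, so row means are half the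
nodal values on the inner line. Proportionality in the lowest row carries the prescribed value at
`(1, 1)` along the line with index `1`; the leftmost and rightmost columns then carry it to the
other interior vertices. -/
theorem nodal_eq (hM : ∀ i, StrictMono (M i)) (H : IsReducedMorley₀ M.grid φ p)
    (h11 : M.nodal p (fun _ => 1) = M.splVal 0 (M 0 1) * M.splVal 1 (M 1 1)) (k : Fin 2 → Fin 4) :
    M.nodal p k = M.splVal 0 (M 0 (k 0)) * M.splVal 1 (M 1 (k 1)) := by
  have l := len_pos hM
  have s1 : ∀ i, M.splVal i (M i 1) ≠ 0 := fun i => by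
    have := l i 0
    have := l i 1
    rw [splVal_one]; positivity
  have s2 : ∀ i, M.splVal i (M i 2) ≠ 0 := fun i => by
    have := l i 1
    have := l i 2
    rw [splVal_two hM]; positivity
  have hz : ∀ (k : Fin 2 → Fin 4) i, k i = 0 ∨ k i = 3 →
      M.nodal p k = M.splVal 0 (M 0 (k 0)) * M.splVal 1 (M 1 (k 1)) := by
    intro k i hk
    have h0 : M.splVal i (M i (k i)) = 0 := by
      rcases hk with e | e <;> rw [e]
      exacts [splVal_zero hM i, splVal_three hM i]
    rw [nodal_boundary hM H k i hk]
    fin_cases i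
    · simp only [Fin.zero_eta] at h0; rw [h0, zero_mul]
    · simp only [Fin.mk_one] at h0; rw [h0, mul_zero]
  have hk : ∀ k : Fin 2 → Fin 4, k = ![k 0, k 1] := fun k => by
    funext i; fin_cases i <;> rfl
  have row : ∀ t, M.nodal p ![t, 1] = M.splVal 0 (M 0 t) * M.splVal 1 (M 1 1) := by
    intro t
    obtain ⟨ρ, hρ, -⟩ := exists_row_proportional hM H (fun _ => 0) 0
    have e : ∀ t, M.nodalMean p (fun _ => 0) 0 t = M.nodal p ![t, 1] / 2 := by
      intro t
      have e1 : Function.update (fun _ : Fin 2 => (0 : Fin 3).castSucc) 0 t = ![t, 0] := by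
        funext i; fin_cases i <;> rfl
      have e2 : Function.update (fun _ : Fin 2 => (0 : Fin 3).succ) 0 t = ![t, 1] := by
        funext i; fin_cases i <;> rfl
      rw [nodalMean, e1, e2, nodal_boundary hM H ![t, 0] 1 (Or.inl rfl), zero_add]
    have h1 := hρ 1
    rw [e, show (![1, 1] : Fin 2 → Fin 4) = fun _ => 1 by funext i; fin_cases i <;> rfl, h11] at h1
    have hρ' : 2 * ρ = M.splVal 1 (M 1 1) :=
      mul_right_cancel₀ (s1 0) (by linear_combination -2 * h1)
    have ht := hρ t
    rw [e] at ht
    rw [← hρ']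
    linear_combination 2 * ht
  have col : ∀ (m : Fin 3) (t : Fin 4) (hm : m = 0 ∧ t = 1 ∨ m = 2 ∧ t = 2) (l : Fin 4),
      M.nodal p ![t, l] = M.splVal 0 (M 0 t) * M.splVal 1 (M 1 l) := by
    intro m t hm r
    obtain ⟨ρ, hρ, -⟩ := exists_row_proportional hM H (fun _ => m) 1
    have e : ∀ r, M.nodalMean p (fun _ => m) 1 r = M.nodal p ![t, r] / 2 := by
      intro r
      have e1 : Function.update (fun _ : Fin 2 => m.castSucc) 1 r = ![m.castSucc, r] := by
        funext i; fin_cases i <;> rfl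
      have e2 : Function.update (fun _ : Fin 2 => m.succ) 1 r = ![m.succ, r] := by
        funext i; fin_cases i <;> rfl
      rw [nodalMean, e1, e2]
      rcases hm with ⟨rfl, rfl⟩ | ⟨rfl, rfl⟩
      · rw [nodal_boundary hM H ![Fin.castSucc 0, r] 0 (Or.inl rfl), zero_add]; rfl
      · rw [nodal_boundary hM H ![Fin.succ 2, r] 0 (Or.inr rfl), add_zero]; rfl
    have h1 := hρ 1
    rw [e, row] at h1
    have hρ' : 2 * ρ = M.splVal 0 (M 0 t) :=
      mul_right_cancel₀ (s1 1) (by linear_combination -2 * h1)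
    have ht := hρ r
    rw [e] at ht
    rw [← hρ']
    linear_combination 2 * ht
  by_cases h : k 0 = 0 ∨ k 0 = 3
  · exact hz k 0 h
  · have : k 0 = 1 ∨ k 0 = 2 := by
      generalize k 0 = t at h
      revert h
      fin_cases t <;> decide
    rw [hk k]
    rcases this with e | e <;> rw [e]
    · exact col 0 1 (.inl ⟨rfl, rfl⟩) _
    · exact col 2 2 (.inr ⟨rfl, rfl⟩) _

/-- Vertex values agree by `nodal_eq`. They also fix the factor in each row, namely the mean of the
other spline's two end values, and hence the normal means. A quadratic is determined by these data.
-/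
theorem eq_piece (hM : ∀ i, StrictMono (M i)) (H : IsReducedMorley₀ M.grid φ p)
    (h11 : eval (fun i => M i 1) (p (M.cell fun _ => 1)) =
      (M.len 0 0 / (M.len 0 0 + M.len 0 1)) * (M.len 1 0 / (M.len 1 0 + M.len 1 1)))
    (m : Fin 2 → Fin 3) : p (M.cell m) = M.piece (M.cell m) := by
  have hnod := nodal_eq hM H (by
    rw [splVal_one, splVal_one, ← h11]
    rfl)
  have s1 : ∀ i, M.splVal i (M i 1) ≠ 0 := fun i => by
    have := len_pos hM i 0
    have := len_pos hM i 1
    rw [splVal_one]; positivity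
  refine Rect.eq_of_vertex_normalMean (cell_lt hM m) (H.degree _ (M.cell_mem_grid m))
    (M.piece_degree _) (fun a ha => ?_) fun i b => ?_
  · rw [M.piece_vertex _ (cell_lt hM m) a ha]
    have : ∀ i, ∃ k : Fin 4, a i = M i k ∧ (k = (m i).castSucc ∨ k = (m i).succ) := fun i =>
      (ha i).elim (fun e => ⟨_, e, .inl rfl⟩) fun e => ⟨_, e, .inr rfl⟩
    choose k hk hkm using this
    have hak : a = fun i => M i (k i) := funext hk
    rw [hak, eval_eq_nodal H m k hkm, hnod]
  · rw [M.piece_normalMean _ (cell_lt hM m) (fun i => splDer_add_splDer hM i (m i))]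
    obtain ⟨ρ, hρ, hn⟩ := exists_row_proportional hM H m i
    rw [hn, mul_comm]
    congr 1
    have h1 := hρ 1
    refine mul_right_cancel₀ (s1 i) ?_
    rw [← h1, nodalMean, hnod, hnod]
    fin_cases i <;> simp [cell] <;> ring

end Uniqueness

theorem basisFunction_eq_zero (hM : ∀ i, StrictMono (M i)) {x : Pt} (hx : x ∉ M.closed) :
    M.basisFunction x = 0 :=
  (M.isBasisFunction_basisFunction hM).1 x hx

/-- However `basisFunction` is chosen, it is this polynomial in the interior of the cell; only
values on edges are left open. -/
theorem basisFunction_eq_eval_piece (hM : ∀ i, StrictMono (M i)) (m : Fin 2 → Fin 3) {x : Pt}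
    (hx : x ∈ (M.cell m).inner) : M.basisFunction x = eval x (M.piece (M.cell m)) := by
  obtain ⟨-, p, hp, h11⟩ := M.isBasisFunction_basisFunction hM
  rw [hp.pieces _ (M.cell_mem_grid m) x hx, eq_piece hM hp h11]

end Patch

end RRM

namespace RRM

/-! ### Integrals over rectangles -/

namespace Rect

variable {K : Rect}

theorem closed_eq_pi (K : Rect) : K.closed = Set.univ.pi fun i => Set.Icc (K.lo i) (K.hi i) := by
  ext x; simp only [closed, Set.mem_ofPred_eq, Set.mem_univ_pi, Set.mem_Icc]

theorem inner_eq_pi (K : Rect) : K.inner = Set.univ.pi fun i => Set.Ioo (K.lo i) (K.hi i) := by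
  ext x; simp [inner]

theorem isCompact_closed (K : Rect) : IsCompact K.closed := by
  rw [closed_eq_pi]; exact isCompact_univ_pi fun _ => isCompact_Icc

theorem measurableSet_closed (K : Rect) : MeasurableSet K.closed :=
  K.isCompact_closed.isClosed.measurableSet

theorem isOpen_inner (K : Rect) : IsOpen K.inner := by
  rw [inner_eq_pi]; exact isOpen_set_pi Set.finite_univ fun _ _ => isOpen_Ioo

theorem inner_subset_closed (K : Rect) : K.inner ⊆ K.closed := fun _ hx i =>
  ⟨(hx i).1.le, (hx i).2.le⟩

theorem inner_ae_eq_closed (K : Rect) : K.inner =ᵐ[volume] K.closed := by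
  rw [inner_eq_pi, closed_eq_pi, Set.pi_univ_Icc]
  exact Measure.univ_pi_Ioo_ae_eq_Icc

theorem restrict_inner (K : Rect) : volume.restrict K.inner = volume.restrict K.closed :=
  Measure.restrict_congr_set K.inner_ae_eq_closed

theorem volume_closed (K : Rect) :
    volume K.closed = ENNReal.ofReal (K.hi 0 - K.lo 0) * ENNReal.ofReal (K.hi 1 - K.lo 1) := by
  rw [closed_eq_pi, Set.pi_univ_Icc, Real.volume_Icc_pi, Fin.prod_univ_two]

theorem volume_real_closed (hK : ∀ i, K.lo i < K.hi i) :
    volume.real K.closed = (K.hi 0 - K.lo 0) * (K.hi 1 - K.lo 1) := by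
  have h0 := sub_pos.2 (hK 0)
  have h1 := sub_pos.2 (hK 1)
  rw [measureReal_def, volume_closed, ← ENNReal.ofReal_mul h0.le,
    ENNReal.toReal_ofReal (by positivity)]

theorem integral_monomial (hK : ∀ i, K.lo i < K.hi i) (m n : ℕ) :
    ∫ x in K.closed, x 0 ^ m * x 1 ^ n =
      ((K.hi 0 ^ (m + 1) - K.lo 0 ^ (m + 1)) / (m + 1)) *
        ((K.hi 1 ^ (n + 1) - K.lo 1 ^ (n + 1)) / (n + 1)) := by
  have h1 : ∀ i (n : ℕ), ∫ t in Set.Icc (K.lo i) (K.hi i), t ^ n =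
      (K.hi i ^ (n + 1) - K.lo i ^ (n + 1)) / (n + 1) := fun i n => by
    rw [integral_Icc_eq_integral_Ioc, ← intervalIntegral.integral_of_le (hK i).le, integral_pow]
  have := integral_fintype_prod_eq_prod (𝕜 := ℝ)
    (μ := fun i : Fin 2 => (volume : Measure ℝ).restrict (Set.Icc (K.lo i) (K.hi i)))
    fun (i : Fin 2) (t : ℝ) => t ^ (![m, n] i)
  rw [← Measure.restrict_pi_pi, ← closed_eq_pi, ← volume_pi] at this
  simp only [Fin.prod_univ_two, h1] at this
  simpa using this

theorem integrableOn_monomial (K : Rect) (m n : ℕ) :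
    IntegrableOn (fun x : Pt => x 0 ^ m * x 1 ^ n) K.closed :=
  (by fun_prop : Continuous fun x : Pt => x 0 ^ m * x 1 ^ n).continuousOn.integrableOn_compact
    K.isCompact_closed

theorem integrableOn_eval (K : Rect) (p : MvPolynomial (Fin 2) ℝ) :
    IntegrableOn (fun x => eval x p) K.closed :=
  (contDiff_eval p).continuous.continuousOn.integrableOn_compact K.isCompact_closed

theorem average_quadPoly (hK : ∀ i, K.lo i < K.hi i) (a b c d e f : ℝ) :
    ⨍ x in K.closed, eval x (quadPoly a b c d e f) =
      a + b * ((K.lo 0 + K.hi 0) / 2) + c * ((K.lo 1 + K.hi 1) / 2) +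
      d * ((K.lo 0 ^ 2 + K.lo 0 * K.hi 0 + K.hi 0 ^ 2) / 3) +
      e * (((K.lo 0 + K.hi 0) / 2) * ((K.lo 1 + K.hi 1) / 2)) +
      f * ((K.lo 1 ^ 2 + K.lo 1 * K.hi 1 + K.hi 1 ^ 2) / 3) := by
  have h0 := sub_ne_zero.2 (hK 0).ne'
  have h1 := sub_ne_zero.2 (hK 1).ne'
  have e1 : ∀ x : Pt, eval x (quadPoly a b c d e f) =
      a * (x 0 ^ 0 * x 1 ^ 0) + b * (x 0 ^ 1 * x 1 ^ 0) + c * (x 0 ^ 0 * x 1 ^ 1) +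
      d * (x 0 ^ 2 * x 1 ^ 0) + e * (x 0 ^ 1 * x 1 ^ 1) + f * (x 0 ^ 0 * x 1 ^ 2) := fun x => by
    rw [eval_quadPoly]; ring
  have I := fun (t : ℝ) m n => (K.integrableOn_monomial m n).const_mul t
  rw [setAverage_eq, volume_real_closed hK]
  simp_rw [e1]
  rw [integral_add (((((I a 0 0).fun_add (I b 1 0)).fun_add (I c 0 1)).fun_add (I d 2 0)).fun_add (I e 1 1))
      (I f 0 2),
    integral_add ((((I a 0 0).fun_add (I b 1 0)).fun_add (I c 0 1)).fun_add (I d 2 0)) (I e 1 1),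
    integral_add (((I a 0 0).fun_add (I b 1 0)).fun_add (I c 0 1)) (I d 2 0),
    integral_add ((I a 0 0).fun_add (I b 1 0)) (I c 0 1), integral_add (I a 0 0) (I b 1 0)]
  simp_rw [integral_const_mul, integral_monomial hK]
  rw [smul_eq_mul]
  push_cast
  field_simp
  ring

end Rect

namespace Patch

variable {M : Patch}

/-! ### The functionals -/

/-- The neighbours' contributions to a linear function cancel, so `λ_K` sees only the midpoint of
`K`. -/
theorem weight_first_moment (hM : ∀ i, StrictMono (M i)) (i : Fin 2) :
    M.weight i false * ((M i 0 + M i 1) / 2 - (M i 1 + M i 2) / 2) +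
      M.weight i true * ((M i 2 + M i 3) / 2 - (M i 1 + M i 2) / 2) = 0 := by
  have l0 := len_pos hM i 0
  have l1 := len_pos hM i 1
  have l2 := len_pos hM i 2
  have e0 : M i 1 = M i 0 + M.len i 0 := (add_sub_cancel (M i 0) (M i 1)).symm
  have e1 : M i 2 = M i 1 + M.len i 1 := (add_sub_cancel (M i 1) (M i 2)).symm
  have e2 : M i 3 = M i 2 + M.len i 2 := (add_sub_cancel (M i 2) (M i 3)).symm
  simp only [weight, e2, e1, e0, if_true, Bool.false_eq_true, if_false]
  field_simp
  ring

/-- With `a`, `b` the two lines of `K`, the right side is `ab - (a² + ab + b²)/3`: the neighbours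
correct the mean of the square over `K` to the product `ab`. -/
theorem weight_second_moment (hM : ∀ i, StrictMono (M i)) (i : Fin 2) :
    M.weight i false * ((M i 0 ^ 2 + M i 0 * M i 1 + M i 1 ^ 2) / 3 -
      (M i 1 ^ 2 + M i 1 * M i 2 + M i 2 ^ 2) / 3) +
      M.weight i true * ((M i 2 ^ 2 + M i 2 * M i 3 + M i 3 ^ 2) / 3 -
      (M i 1 ^ 2 + M i 1 * M i 2 + M i 2 ^ 2) / 3) = - (M i 2 - M i 1) ^ 2 / 3 := by
  have l0 := len_pos hM i 0
  have l1 := len_pos hM i 1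
  have l2 := len_pos hM i 2
  have e0 : M i 1 = M i 0 + M.len i 0 := (add_sub_cancel (M i 0) (M i 1)).symm
  have e1 : M i 2 = M i 1 + M.len i 1 := (add_sub_cancel (M i 1) (M i 2)).symm
  have e2 : M i 3 = M i 2 + M.len i 2 := (add_sub_cancel (M i 2) (M i 3)).symm
  simp only [weight, e2, e1, e0, if_true, Bool.false_eq_true, if_false]
  field_simp
  ring

/-- In each variable this is the polar form of the polynomial evaluated at the two lines of `K`,
which is its B-spline coefficient. The mixed term factors because each neighbour is displaced in one
direction only. -/
theorem functional_quadPoly (hM : ∀ i, StrictMono (M i)) (a b c d e f : ℝ) :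
    M.functional (fun x => eval x (quadPoly a b c d e f)) =
      a + b * ((M 0 1 + M 0 2) / 2) + c * ((M 1 1 + M 1 2) / 2) + d * (M 0 1 * M 0 2) +
      e * (((M 0 1 + M 0 2) / 2) * ((M 1 1 + M 1 2) / 2)) + f * (M 1 1 * M 1 2) := by
  simp only [functional, Fin.sum_univ_two, Fintype.sum_bool,
    Rect.average_quadPoly (cell_lt hM _)]
  have p0 := weight_first_moment hM 0
  have p1 := weight_first_moment hM 1
  have q0 := weight_second_moment hM 0
  have q1 := weight_second_moment hM 1
  simp [cell]
  linear_combination (b + e * ((M 1 1 + M 1 2) / 2)) * p0 + (c + e * ((M 0 1 + M 0 2) / 2)) * p1 +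
    d * q0 + f * q1

theorem functional_congr {u v : Pt → ℝ} (hM : ∀ i, StrictMono (M i))
    (h : ∀ᵐ x ∂volume.restrict M.closed, u x = v x) : M.functional u = M.functional v := by
  have key : ∀ m, ⨍ x in (M.cell m).closed, u x = ⨍ x in (M.cell m).closed, v x := fun m =>
    average_congr (ae_restrict_of_ae_restrict_of_subset (cell_closed_subset hM m) h)
  simp only [functional, key]

theorem functional_sub {u v : Pt → ℝ} (hM : ∀ i, StrictMono (M i))
    (hu : IntegrableOn u M.closed) (hv : IntegrableOn v M.closed) :
    M.functional (fun x => u x - v x) = M.functional u - M.functional v := by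
  have key : ∀ m, ⨍ x in (M.cell m).closed, (u x - v x) =
      (⨍ x in (M.cell m).closed, u x) - ⨍ x in (M.cell m).closed, v x := fun m => by
    simp only [setAverage_eq]
    rw [integral_sub (hu.mono_set (cell_closed_subset hM m))
      (hv.mono_set (cell_closed_subset hM m)), smul_sub]
  simp only [functional, key, mul_sub, Finset.sum_sub_distrib]
  ring

theorem abs_weight_le (hM : ∀ i, StrictMono (M i)) (i : Fin 2) (b : Bool) :
    |M.weight i b| ≤ 1 := by
  have l0 := len_pos hM i 0
  have l1 := len_pos hM i 1
  have l2 := len_pos hM i 2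
  have l3 : 0 < M.len i (if b then 2 else 0) := len_pos hM i _
  rw [weight, abs_div, abs_neg, abs_of_nonneg (sq_nonneg _), abs_of_pos (by positivity),
    div_le_one (by positivity)]
  nlinarith [mul_pos l3 l0, mul_pos l3 l1, mul_pos l3 l2, mul_pos l1 l0, mul_pos l1 l2]

theorem volume_closed_ne_top (M : Patch) : volume M.closed ≠ ⊤ := by
  have : M.closed = (⟨fun i => M i 0, fun i => M i 3⟩ : Rect).closed := rfl
  rw [this]
  exact (Rect.isCompact_closed _).measure_lt_top.ne

/-- The square of the mean over a cell is bounded by the mean square. -/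
theorem enorm_average_le {κ : ℝ} (hκ : 0 < κ) (hM : ∀ i, StrictMono (M i)) {m : Fin 2 → Fin 3}
    (hl : ∀ i, κ ≤ M.len i (m i)) {u : Pt → ℝ}
    (hu : AEStronglyMeasurable u (volume.restrict M.closed)) :
    ‖⨍ x in (M.cell m).closed, u x‖ₑ ≤
      ENNReal.ofReal κ⁻¹ * eLpNorm u 2 (volume.restrict M.closed) := by
  set S := (M.cell m).closed with hS
  have hSM : S ⊆ M.closed := cell_closed_subset hM m
  have hvol : ENNReal.ofReal (κ ^ 2) ≤ volume S := by
    rw [Rect.volume_closed, pow_two, ENNReal.ofReal_mul hκ.le]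
    exact mul_le_mul' (ENNReal.ofReal_le_ofReal (hl 0)) (ENNReal.ofReal_le_ofReal (hl 1))
  have hpos : volume S ≠ 0 :=
    ((ENNReal.ofReal_pos.2 (by positivity)).trans_le hvol).ne'
  have hfin : volume S ≠ ⊤ := (Rect.isCompact_closed _).measure_lt_top.ne
  have e1 : (⨍ x in S, u x) = (volume.real S)⁻¹ * ∫ x in S, u x := setAverage_eq _ _ _
  have hreal : ‖(volume.real S)⁻¹‖ₑ = (volume S)⁻¹ := by
    rw [Real.enorm_of_nonneg (by positivity), measureReal_def, ← ENNReal.toReal_inv,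
      ENNReal.ofReal_toReal (ENNReal.inv_ne_top.2 hpos)]
  have e2 := enorm_integral_sq_le (volume.restrict S) u
    (hu.mono_measure (Measure.restrict_mono_set _ hSM))
  have e3 : eLpNorm u 2 (volume.restrict M.closed) ^ 2 = ∫⁻ x in M.closed, ‖u x‖ₑ ^ 2 := by
    rw [eLpNorm_eq_lintegral_rpow_enorm_toReal (by norm_num) (by norm_num), ← ENNReal.rpow_natCast,
      ← ENNReal.rpow_mul]
    simp
  have e4 : ∫⁻ x in S, ‖u x‖ₑ ^ 2 ≤ ∫⁻ x in M.closed, ‖u x‖ₑ ^ 2 := lintegral_mono_set hSM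
  refine (ENNReal.pow_le_pow_left_iff (n := 2) (by norm_num)).1 ?_
  rw [e1, enorm_mul, hreal, mul_pow, mul_pow, e3, ← ENNReal.ofReal_pow (by positivity)]
  calc (volume S)⁻¹ ^ 2 * ‖∫ x in S, u x‖ₑ ^ 2
      ≤ (volume S)⁻¹ ^ 2 * (volume S * ∫⁻ x in M.closed, ‖u x‖ₑ ^ 2) := by
        refine mul_le_mul_right (e2.trans ?_) _
        rw [Measure.restrict_apply_univ]
        exact mul_le_mul_right e4 _
    _ = (volume S)⁻¹ * ∫⁻ x in M.closed, ‖u x‖ₑ ^ 2 := by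
        rw [← mul_assoc, pow_two, mul_assoc (volume S)⁻¹, ENNReal.inv_mul_cancel hpos hfin, mul_one]
    _ ≤ ENNReal.ofReal (κ⁻¹ ^ 2) * ∫⁻ x in M.closed, ‖u x‖ₑ ^ 2 := by
        refine mul_le_mul_left ?_ _
        rw [inv_pow, ENNReal.ofReal_inv_of_pos (by positivity)]
        exact ENNReal.inv_le_inv.2 hvol

/-- The four neighbours have weights of modulus at most `1`, so the centre has one of modulus at
most `5`; together `9`. -/
theorem enorm_functional_le {κ : ℝ} (hκ : 0 < κ) (hM : ∀ i, StrictMono (M i))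
    (hl : ∀ i j, κ ≤ M.len i j) {u : Pt → ℝ}
    (hu : AEStronglyMeasurable u (volume.restrict M.closed)) :
    ‖M.functional u‖ₑ ≤ ENNReal.ofReal (9 * κ⁻¹) * eLpNorm u 2 (volume.restrict M.closed) := by
  set B := ENNReal.ofReal κ⁻¹ * eLpNorm u 2 (volume.restrict M.closed) with hB
  have h1 : ∀ m, ‖⨍ x in (M.cell m).closed, u x‖ₑ ≤ B := fun m =>
    enorm_average_le hκ hM (fun i => hl i (m i)) hu
  have h2 : ∀ i b, ‖M.weight i b‖ₑ ≤ 1 := fun i b => by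
    rw [Real.enorm_eq_ofReal_abs]
    exact ENNReal.ofReal_le_one.2 (abs_weight_le hM i b)
  have h3 : ‖1 - ∑ i, ∑ b, M.weight i b‖ₑ ≤ 5 := by
    have h := abs_weight_le hM
    simp only [Fin.sum_univ_two, Fintype.sum_bool, Real.enorm_eq_ofReal_abs]
    rw [show (5 : ℝ≥0∞) = ENNReal.ofReal 5 by norm_num]
    refine ENNReal.ofReal_le_ofReal ?_
    have a1 := abs_le.1 (h 0 true)
    have a2 := abs_le.1 (h 0 false)
    have a3 := abs_le.1 (h 1 true)
    have a4 := abs_le.1 (h 1 false)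
    exact abs_le.2 ⟨by linarith [a1.2, a2.2, a3.2, a4.2], by linarith [a1.1, a2.1, a3.1, a4.1]⟩
  have h4 : ∀ i b m, ‖M.weight i b * ⨍ x in (M.cell m).closed, u x‖ₑ ≤ B := fun i b m => by
    rw [enorm_mul]
    simpa using mul_le_mul' (h2 i b) (h1 m)
  have h5 : ‖(1 - ∑ i, ∑ b, M.weight i b) * ⨍ x in (M.cell fun _ => 1).closed, u x‖ₑ ≤ 5 * B := by
    rw [enorm_mul]
    exact mul_le_mul' h3 (h1 _)
  calc ‖M.functional u‖ₑ ≤ (B + B + (B + B)) + 5 * B := by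
        rw [functional]
        refine (enorm_add_le _ _).trans (add_le_add ?_ h5)
        simp only [Fin.sum_univ_two, Fintype.sum_bool]
        exact (enorm_add_le _ _).trans (add_le_add
          ((enorm_add_le _ _).trans (add_le_add (h4 _ _ _) (h4 _ _ _)))
          ((enorm_add_le _ _).trans (add_le_add (h4 _ _ _) (h4 _ _ _))))
    _ = 9 * B := by ring
    _ = _ := by
      rw [hB, ← mul_assoc, ENNReal.ofReal_mul (by norm_num)]
      norm_num

end Patch

end RRM

namespace RRM

/-! ### The patches around a cell -/

/-- The index of a cell in a patch whose centre lies in the direction given by the argument, as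
seen from this cell. -/
def pos : Option Bool → Fin 3
  | none => 1
  | some true => 0
  | some false => 2

theorem pos_injective : Function.Injective pos := by
  intro a b h
  revert h
  rcases a with _ | _ | _ <;> rcases b with _ | _ | _ <;> simp [pos]

/-- The lines `L` in the direction `i` of a patch, in relation to the cell `T`: the centre of the
patch has the position `o` as seen from `T`, and `l false`, `l true` are the outer lines of the
cells next to `T` in this direction, as far as these lines matter. -/
def LinesAt (T : Rect) (L : Fin 4 → ℝ) (i : Fin 2) (l : Bool → ℝ) : Option Bool → Prop
  | none => L 0 = l false ∧ L 1 = T.lo i ∧ L 2 = T.hi i ∧ L 3 = l true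
  | some true => L 0 = T.lo i ∧ L 1 = T.hi i ∧ L 2 = l true
  | some false => L 1 = l false ∧ L 2 = T.lo i ∧ L 3 = T.hi i

theorem LinesAt.cell_eq {T : Rect} {M : Patch} {l : Fin 2 → Bool → ℝ} {τ : Fin 2 → Option Bool}
    (h : ∀ i, LinesAt T (M i) i (l i) (τ i)) : M.cell (fun i => pos (τ i)) = T := by
  have key : ∀ i, M i (pos (τ i)).castSucc = T.lo i ∧ M i (pos (τ i)).succ = T.hi i := by
    intro i
    have hi := h i
    generalize τ i = o at hi ⊢
    rcases o with _ | _ | _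
    · exact ⟨hi.2.1, hi.2.2.1⟩
    · exact ⟨hi.2.1, hi.2.2⟩
    · exact ⟨hi.1, hi.2.1⟩
  ext i
  exacts [(key i).1, (key i).2]

theorem LinesAt.congr_rect {T N : Rect} {L : Fin 4 → ℝ} {i : Fin 2} {l : Bool → ℝ}
    {o : Option Bool} (h : LinesAt N L i l o) (hN : N.lo i = T.lo i ∧ N.hi i = T.hi i) :
    LinesAt T L i l o := by
  rcases o with _ | _ | _ <;> simp only [LinesAt, hN] at h ⊢ <;> exact h

/-- The nine patches around `T`, with the lines that matter on `T`. -/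
structure IsLocalFamily (T : Rect) (P : (Fin 2 → Option Bool) → Patch)
    (l : Fin 2 → Bool → Option Bool → ℝ) : Prop where
  linesAt : ∀ τ i, LinesAt T (P τ i) i (fun b => l i b (τ (1 - i))) (τ i)
  /-- At each vertex of `T`, the lines in one of the two directions continue. -/
  vertex : ∀ s : Fin 2 → Bool, ∃ i, l i (s i) none = l i (s i) (some (s (1 - i)))

/-! ### Neighbouring cells and the lines of their patches. -/

theorem Rect.IsNeighbor.touchesBeyond {T N : Rect} {i : Fin 2} {b : Bool} (h : T.IsNeighbor N i b)
    (hN : ∀ i, N.lo i < N.hi i) (hT : ∀ i, T.lo i < T.hi i) : T.TouchesBeyond N i b := by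
  refine ⟨h.1, fun j => if j = i then T.face i b else T.lo j, fun j => ?_, fun j => ?_⟩
  · have := hT j
    by_cases hj : j = i
    · subst hj
      cases b <;> simp [face] <;> linarith
    · simp [hj]; linarith
  · by_cases hj : j = i
    · subst hj
      have := hN j
      have h1 := h.1
      cases b <;> simp [face] at h1 ⊢ <;> constructor <;> linarith
    · have := hT j
      have := h.2 j hj
      simp [hj]
      constructor <;> linarith

theorem Rect.IsNeighbor.symm {T N : Rect} {i : Fin 2} {b : Bool} (h : T.IsNeighbor N i b) :
    N.IsNeighbor T i (!b) :=
  ⟨by rw [Bool.not_not, h.1], fun j hj => ⟨(h.2 j hj).1.symm, (h.2 j hj).2.symm⟩⟩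

theorem Rect.mem_closed_of_face {K : Rect} (hK : ∀ i, K.lo i < K.hi i) {x : Pt}
    (h : ∀ i, ∃ b, x i = K.face i b) : x ∈ K.closed := fun i => by
  obtain ⟨b, hb⟩ := h i
  have := hK i
  cases b <;> simp [face] at hb <;> constructor <;> linarith

theorem Rect.IsNeighbor.face_eq {T N : Rect} {i : Fin 2} {b : Bool} (h : T.IsNeighbor N i b)
    {j : Fin 2} (hj : j ≠ i) (c : Bool) : N.face j c = T.face j c := by
  cases c <;> simp [face, h.2 j hj]

theorem linesAt_some (T : Rect) {G : Finset Rect} (E : GridExtension G) (i : Fin 2) (b : Bool)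
    (l : Bool → ℝ) (hl : l b = E.line₁ T i b) : LinesAt T (E.lines T i (some b)) i l (some b) := by
  cases b <;> simp [LinesAt, GridExtension.lines, hl]

/-- Here `T` is an outer cell of the patch centred at `N`: the side of `T` away from `N` is an
outermost line of that patch. -/
theorem linesAt_neighbor (T N : Rect) {G : Finset Rect} (E : GridExtension G) (i : Fin 2) (b : Bool)
    (l : Bool → ℝ) (h : N.face i (!b) = T.face i b) (h1 : E.line₁ N i (!b) = T.face i (!b))
    (hl : l b = N.face i b) : LinesAt T (E.lines N i none) i l (some b) := by
  cases b <;> simp [LinesAt, GridExtension.lines, hl, Rect.face] at h h1 ⊢ <;> exact ⟨by assumption, by assumption⟩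

theorem linesAt_none (T N : Rect) {G : Finset Rect} (E : GridExtension G) (i : Fin 2)
    (l : Bool → ℝ) (h : N.lo i = T.lo i ∧ N.hi i = T.hi i) (hl : ∀ b, l b = E.line₁ N i b) :
    LinesAt T (E.lines N i none) i l none := by
  simp [LinesAt, GridExtension.lines, hl, h]

namespace GridExtension

variable {G : Finset Rect} (E : GridExtension G)

open scoped Classical in
/-- The neighbour of `T` across an interior edge, and `T` itself for a boundary edge. -/
noncomputable def across (G : Finset Rect) (T : Rect) (i : Fin 2) (b : Bool) : Rect :=
  if h : ∃ N ∈ G, T.IsNeighbor N i b then h.choose else T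

theorem across_cases (G : Finset Rect) (T : Rect) (i : Fin 2) (b : Bool) :
    (across G T i b ∈ G ∧ T.IsNeighbor (across G T i b) i b) ∨
      (across G T i b = T ∧ IsBoundaryEdge G T i b) := by
  by_cases h : ∃ N ∈ G, T.IsNeighbor N i b
  · left
    rw [across, dif_pos h]
    exact h.choose_spec
  · right
    rw [across, dif_neg h]
    exact ⟨rfl, fun N hN hn => h ⟨N, hN, hn⟩⟩

/-- The outer lines of the cells next to `T` in the direction `i`, in the row of `T` and in the
rows next to it. -/
noncomputable def outerLine (T : Rect) (i : Fin 2) (b : Bool) : Option Bool → ℝ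
  | none => E.line₁ T i b
  | some c => E.line₁ (across G T (1 - i) c) i b

theorem mem_patches {K : Rect} (hK : K ∈ G) (σ : Fin 2 → Option Bool)
    (h : ∀ i b, σ i = some b → IsBoundaryEdge G K i b) :
    (fun i => E.lines K i (σ i)) ∈ E.patches := by
  classical
  refine Finset.mem_image.2 ⟨(K, σ), ?_, rfl⟩
  simp only [Finset.mem_filter, Finset.mem_product, Finset.mem_univ, and_true]
  exact ⟨hK, h⟩

theorem fin_two_eq_or (i j : Fin 2) : j = i ∨ j = 1 - i := by
  revert i j; decide

theorem one_sub_ne (i : Fin 2) : 1 - i ≠ i := by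
  revert i; decide

theorem one_sub_one_sub (i : Fin 2) : 1 - (1 - i) = i := by
  revert i; decide

variable {T : Rect}

/-- Next to an interior edge, the line beyond the neighbour continues into the next row. -/
theorem outerLine_eq_of_isNeighbor (hG : ∀ K ∈ G, ∀ i, K.lo i < K.hi i) (hT : T ∈ G)
    (s : Fin 2 → Bool) (i : Fin 2) {N : Rect} (hN : N ∈ G) (hTN : T.IsNeighbor N i (s i))
    (o : Option Bool) (ho : o = none ∨ o = some (s (1 - i))) :
    E.outerLine T i (s i) o = N.face i (s i) := by
  have h0 : E.line₁ T i (s i) = N.face i (s i) :=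
    E.line₁_eq T hT N hN i _ (hTN.touchesBeyond (hG N hN) (hG T hT))
  rcases ho with rfl | rfl
  · exact h0
  simp only [outerLine]
  rcases across_cases G T (1 - i) (s (1 - i)) with ⟨hU, hTU⟩ | ⟨h, -⟩
  -- The cell in the next row and `N` both contain the vertex of `T` selected by `s`, so `N` touches
  -- that cell beyond its edge and determines its first outer line.
  · refine E.line₁_eq _ hU N hN i _ ⟨?_, fun j => T.face j (s j), ?_, ?_⟩
    · rw [hTN.1, hTU.face_eq (one_sub_ne i).symm]
    · refine Rect.mem_closed_of_face (hG _ hU) fun j => ?_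
      rcases fin_two_eq_or i j with rfl | rfl
      · exact ⟨s j, (hTU.face_eq (one_sub_ne j).symm _).symm⟩
      · exact ⟨_, hTU.1.symm⟩
    · refine Rect.mem_closed_of_face (hG _ hN) fun j => ?_
      rcases fin_two_eq_or i j with rfl | rfl
      · exact ⟨_, hTN.1.symm⟩
      · exact ⟨s (1 - i), (hTN.face_eq (one_sub_ne i) _).symm⟩
  · rw [h, h0]

/-- If both edges of `T` at the vertex are boundary edges, the centre is the cell attached to `T`
diagonally, and all lines are those of `T`. Otherwise there is a neighbour `N` across one of them;
the centre is then the grid cell beyond `N` in the other direction, or the cell attached to `N`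
there. In the second case the far side of `N` is the line that continues. -/
theorem exists_patch_corner (hG : ∀ K ∈ G, ∀ i, K.lo i < K.hi i) (hT : T ∈ G) (s : Fin 2 → Bool) :
    (∃ M ∈ E.patches, ∀ i, LinesAt T (M i) i
      (fun b => E.outerLine T i b (some (s (1 - i)))) (some (s i))) ∧
      ∃ i, E.outerLine T i (s i) none = E.outerLine T i (s i) (some (s (1 - i))) := by
  by_cases hb : ∀ i, IsBoundaryEdge G T i (s i)
  · have ha : ∀ i, across G T i (s i) = T := fun i =>
      (across_cases G T i (s i)).elim (fun h => absurd h.2 (hb i _ h.1)) And.left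
    refine ⟨⟨_, E.mem_patches hT (fun i => some (s i)) fun i b e => ?_, fun i => ?_⟩, 0, ?_⟩
    · obtain rfl := Option.some.inj e
      exact hb i
    · exact linesAt_some T E i (s i) _ (by simp only [outerLine, ha])
    · simp only [outerLine, ha]
  · push Not at hb
    obtain ⟨i, hi⟩ := hb
    simp only [IsBoundaryEdge] at hi
    push Not at hi
    obtain ⟨N, hN, hTN⟩ := hi
    have hline := E.outerLine_eq_of_isNeighbor hG hT s i hN hTN
    have hi' := one_sub_ne i
    have hii := one_sub_one_sub i
    have haN : ∃ N' ∈ G, N' = across G T i (s i) ∧ T.IsNeighbor N' i (s i) := by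
      rcases across_cases G T i (s i) with h | h
      · exact ⟨_, h.1, rfl, h.2⟩
      · exact absurd hTN (h.2 N hN)
    refine ⟨?_, i, by rw [hline _ (.inl rfl), hline _ (.inr rfl)]⟩
    clear hline
    obtain ⟨N, hN, hNa, hTN⟩ := haN
    have hline := E.outerLine_eq_of_isNeighbor hG hT s i hN hTN
    have hNT : E.line₁ N i (!(s i)) = T.face i (!(s i)) :=
      E.line₁_eq N hN T hT i _ (hTN.symm.touchesBeyond (hG T hT) (hG N hN))
    rcases across_cases G N (1 - i) (s (1 - i)) with ⟨hD, hND⟩ | ⟨-, hNb⟩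
    · set D := across G N (1 - i) (s (1 - i))
      have hDi : ∀ c, D.face i c = N.face i c := fun c => hND.face_eq hi'.symm c
      have hDj : D.face (1 - i) (!(s (1 - i))) = T.face (1 - i) (s (1 - i)) := by
        rw [hND.1, hTN.face_eq hi']
      have hx : (D.closed ∩ T.closed).Nonempty := by
        refine ⟨fun j => T.face j (s j), Rect.mem_closed_of_face (hG _ hD) fun j => ?_,
          Rect.mem_closed_of_face (hG _ hT) fun j => ⟨s j, rfl⟩⟩
        rcases fin_two_eq_or i j with rfl | rfl
        · exact ⟨!(s j), by rw [hDi, hTN.1]⟩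
        · exact ⟨_, hDj.symm⟩
      refine ⟨_, E.mem_patches hD (fun _ => none) (by simp), fun j => ?_⟩
      rcases fin_two_eq_or i j with rfl | rfl
      · refine linesAt_neighbor T D E j (s j) _ (by rw [hDi, hTN.1]) ?_ ?_
        · exact E.line₁_eq D hD T hT j _ ⟨by rw [Bool.not_not, hDi, hTN.1], hx⟩
        · rw [hline _ (.inr rfl), hDi]
      · refine linesAt_neighbor T D E _ _ _ hDj ?_ ?_
        · exact E.line₁_eq D hD T hT _ _ ⟨by rw [Bool.not_not, hDj], hx⟩
        · simp only [outerLine, hii, ← hNa]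
          exact E.line₁_eq N hN D hD _ _ (hND.touchesBeyond (hG D hD) (hG N hN))
    -- No grid cell lies beyond `N`, so the centre is the cell attached to `N` in the direction `1 -
    -- i`.
    · refine ⟨_, E.mem_patches hN (fun j => if j = i then none else some (s j)) (fun j b e => ?_),
        fun j => ?_⟩
      · rcases fin_two_eq_or i j with rfl | rfl
        · simp at e
        · simp only [hi', if_false, Option.some.injEq] at e
          rw [← e]
          exact hNb
      · rcases fin_two_eq_or i j with rfl | rfl
        · simp only [if_true]
          exact linesAt_neighbor T N E j (s j) _ hTN.1 hNT (hline _ (.inr rfl))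
        · simp only [hi', if_false]
          have h1 := linesAt_some N E (1 - i) (s (1 - i))
            (fun b => E.outerLine T (1 - i) b (some (s (1 - (1 - i)))))
            (by simp only [outerLine, hii, ← hNa])
          have h2 := hTN.2 _ hi'
          exact h1.congr_rect h2

theorem exists_patch_edge (hG : ∀ K ∈ G, ∀ i, K.lo i < K.hi i) (hT : T ∈ G) (i : Fin 2) (b : Bool) :
    ∃ M ∈ E.patches, LinesAt T (M i) i (fun b => E.outerLine T i b none) (some b) ∧
      LinesAt T (M (1 - i)) (1 - i) (fun c => E.outerLine T (1 - i) c (some b)) none := by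
  have hii := one_sub_one_sub i
  have hi' := one_sub_ne i
  rcases across_cases G T i b with ⟨hN, hTN⟩ | ⟨h, hb⟩
  · refine ⟨_, E.mem_patches hN (fun _ => none) (by simp), ?_, ?_⟩
    · refine linesAt_neighbor T _ E i b _ hTN.1 ?_ ?_
      · exact E.line₁_eq _ hN T hT i _ (hTN.symm.touchesBeyond (hG T hT) (hG _ hN))
      · exact E.line₁_eq T hT _ hN i _ (hTN.touchesBeyond (hG _ hN) (hG T hT))
    · exact linesAt_none T _ E (1 - i) _ (hTN.2 _ hi') fun c => by simp only [outerLine, hii]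
  · refine ⟨_, E.mem_patches hT (fun j => if j = i then some b else none) (fun j c e => ?_), ?_, ?_⟩
    · rcases fin_two_eq_or i j with rfl | rfl
      · simp only [if_true, Option.some.injEq] at e
        rw [← e]; exact hb
      · simp [hi'] at e
    · simp only [if_true]
      exact linesAt_some T E i b _ rfl
    · simp only [hi', if_false]
      exact linesAt_none T T E (1 - i) _ ⟨rfl, rfl⟩ fun c => by simp only [outerLine, hii, h]

theorem exists_isLocalFamily (hG : ∀ K ∈ G, ∀ i, K.lo i < K.hi i) (hT : T ∈ G) :
    ∃ P, (∀ τ, P τ ∈ E.patches) ∧ IsLocalFamily T P (E.outerLine T) := by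
  have key : ∀ τ : Fin 2 → Option Bool, ∃ M ∈ E.patches, ∀ i,
      LinesAt T (M i) i (fun b => E.outerLine T i b (τ (1 - i))) (τ i) := by
    intro τ
    rcases h0 : τ 0 with _ | b
    · rcases h1 : τ 1 with _ | c
      · refine ⟨_, E.mem_patches hT (fun _ => none) (by simp), fun i => ?_⟩
        have h : ∀ i, τ i = none := fun i => by fin_cases i <;> assumption
        rw [h, h]
        exact linesAt_none T T E i _ ⟨rfl, rfl⟩ fun c => rfl
      · obtain ⟨M, hM, ha, hb⟩ := E.exists_patch_edge hG hT 1 c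
        refine ⟨M, hM, fun i => ?_⟩
        fin_cases i
        · simpa [h0, h1] using hb
        · simpa [h0, h1] using ha
    · rcases h1 : τ 1 with _ | c
      · obtain ⟨M, hM, ha, hb⟩ := E.exists_patch_edge hG hT 0 b
        refine ⟨M, hM, fun i => ?_⟩
        fin_cases i
        · simpa [h0, h1] using ha
        · simpa [h0, h1] using hb
      · obtain ⟨⟨M, hM, h⟩, -⟩ := E.exists_patch_corner hG hT ![b, c]
        refine ⟨M, hM, fun i => ?_⟩
        have := h i
        fin_cases i
        · simpa [h0, h1] using this
        · simpa [h0, h1] using this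
  choose P hP hl using key
  exact ⟨P, hP, hl, fun s => (E.exists_patch_corner hG hT s).2⟩

/-- The patches that meet the interior of `T` are those of the local family. -/
theorem mem_range_of_inner_inter_nonempty {γ₀ : ℝ} (hE : E.IsAdmissible γ₀)
    (hTi : T.inner.Nonempty) (hT : T ∈ G)
    {P : (Fin 2 → Option Bool) → Patch} (hP : ∀ τ, P τ ∈ E.patches)
    (hl : IsLocalFamily T P (E.outerLine T)) :
    Function.Injective P ∧
      ∀ M ∈ E.patches, (M.inner ∩ T.inner).Nonempty → ∃ τ, P τ = M := by
  classical
  have hcell : ∀ τ, (P τ).cell (fun i => pos (τ i)) = T := fun τ =>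
    LinesAt.cell_eq (l := fun i b => E.outerLine T i b (τ (1 - i))) (hl.linesAt τ)
  -- The position of `T` inside a patch recovers the direction of the centre.
  have hinj : Function.Injective P := by
    intro τ τ' h
    funext i
    have h1 := congrArg (fun K => Rect.lo K i) ((hcell τ).trans (hcell τ').symm)
    simp only [Patch.cell, h] at h1
    exact pos_injective (Fin.castSucc_injective _ ((hE.ordered _ (hP τ') i).injective h1))
  refine ⟨hinj, fun M hM hMT => ?_⟩
  have hsub : Finset.univ.image P ⊆
      E.patches.filter fun M => (M.inner ∩ T.inner).Nonempty := by
    intro M hM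
    obtain ⟨τ, -, rfl⟩ := Finset.mem_image.1 hM
    refine Finset.mem_filter.2 ⟨hP τ, ?_⟩
    obtain ⟨x, hx⟩ := hTi
    refine ⟨x, ?_, hx⟩
    rw [← hcell τ] at hx
    exact Patch.cell_inner_subset (hE.ordered _ (hP τ)) _ hx
  -- The nine distinct local patches exhaust the nine that admissibility permits over `T`.
  have heq := Finset.eq_of_subset_of_card_le hsub (by
    rw [Finset.card_image_of_injective _ hinj]
    rw [Finset.card_univ, show Fintype.card (Fin 2 → Option Bool) = 9 by simp]
    convert (hE.nine T hT).le)
  have : M ∈ Finset.univ.image P := heq ▸ Finset.mem_filter.2 ⟨hM, hMT⟩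
  obtain ⟨τ, -, h⟩ := Finset.mem_image.1 this
  exact ⟨τ, h⟩

end GridExtension

end RRM

namespace RRM

/-! ### Reproduction of quadratic polynomials -/

/-- Splines on a cell in terms of three fixed functions with the values `w`: those that belong to
the centre (`none`) and to the two neighbours (`some b`), with the parameters `γ b`. -/
def shape (γ : Bool → ℝ) (w : Option Bool → ℝ) : Option Bool → ℝ
  | none => w none - γ false * w (some false) - γ true * w (some true)
  | some b => γ b * w (some b)

/-- Reproduction by sums of products of splines whose parameters vary from row to row and from
column to column, provided that at each vertex they vary in one of the directions only. -/
theorem sum_mul_shape_eq (γ γ' : Bool → Option Bool → ℝ) (w w' : Option Bool → ℝ)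
    (Λ Λ' : Option Bool → Option Bool → ℝ) (c c' : ℝ) (F F' : Bool → ℝ)
    (hn : ∀ k, Λ none k = c) (hn' : ∀ k, Λ' none k = c')
    (hF : ∀ b k, γ b k * Λ (some b) k = F b + γ b k * c)
    (hF' : ∀ b k, γ' b k * Λ' (some b) k = F' b + γ' b k * c')
    (hv : ∀ b b', γ b none = γ b (some b') ∨ γ' b' none = γ' b' (some b)) :
    ∑ o, ∑ o', Λ o o' * Λ' o' o * (shape (fun b => γ b o') w o * shape (fun b => γ' b o) w' o') =
      (c * w none + ∑ b, F b * w (some b)) * (c' * w' none + ∑ b, F' b * w' (some b)) := by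
  have hz : ∀ b b', (γ b none - γ b (some b')) * (γ' b' none - γ' b' (some b)) = 0 := fun b b' =>
    (hv b b').elim (fun h => by rw [h]; ring) fun h => by rw [h]; ring
  have corner : ∀ b b', Λ (some b) (some b') * Λ' (some b') (some b) *
      (γ b (some b') * w (some b) * (γ' b' (some b) * w' (some b'))) =
      (F b + γ b (some b') * c) * (F' b' + γ' b' (some b) * c') * (w (some b) * w' (some b')) := by
    intro b b'
    rw [← hF, ← hF']; ring
  have edge : ∀ b (s : ℝ), Λ (some b) none * c' * (γ b none * w (some b) * s) =
      (F b + γ b none * c) * c' * (w (some b) * s) := by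
    intro b s
    rw [← hF]; ring
  have edge' : ∀ b (s : ℝ), c * Λ' (some b) none * (s * (γ' b none * w' (some b))) =
      (F' b + γ' b none * c') * c * (s * w' (some b)) := by
    intro b s
    rw [← hF']; ring
  simp only [Fintype.sum_option, Fintype.sum_bool, shape, hn, hn', corner, edge, edge']
  -- Terms with an `F` or `F'` telescope as in one variable. What remains is `c c'` times the
  -- products in `hz`, in which one of the two parameter differences vanishes.
  linear_combination c * c' * (w (some true) * w' (some true) * hz true true +
    w (some true) * w' (some false) * hz true false +
    w (some false) * w' (some true) * hz false true +
    w (some false) * w' (some false) * hz false false)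

theorem sum_fin_two_arrow {α : Type*} [Fintype α] (f : (Fin 2 → α) → ℝ) :
    ∑ τ, f τ = ∑ o, ∑ o', f ![o, o'] := by
  rw [← Fintype.sum_prod_type']
  exact Fintype.sum_equiv (finTwoArrowEquiv α) _ _ fun τ => by
    congr 1
    funext i
    fin_cases i <;> rfl

/-- The parameters of the splines on `T` in the direction `i` for the outer lines `l`. -/
noncomputable def splParam (T : Rect) (i : Fin 2) (l : Bool → ℝ) (b : Bool) : ℝ :=
  (T.hi i - T.lo i) / (if b then l true - T.lo i else T.hi i - l false)

/-- The values of the three functions from which the linear interpolants of splines are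
combined. -/
def linWeight (t : ℝ) : Option Bool → ℝ
  | none => 1
  | some true => t
  | some false => 1 - t

/-- The values at the centre of the three functions from which the linear interpolants of splines
are combined. -/
noncomputable def meanWeight : Option Bool → ℝ
  | none => 1
  | some _ => 1 / 2

/-- The second differences of the three functions from which splines are combined. -/
def curvWeight (t : ℝ) : Option Bool → ℝ
  | none => 0
  | some _ => t * (t - 1)

/-- The product of the two lines at the centre cell of a patch at the given position. -/
def centreProd (T : Rect) (i : Fin 2) (l : Bool → ℝ) : Option Bool → ℝ
  | none => T.lo i * T.hi i
  | some true => T.hi i * l true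
  | some false => l false * T.lo i

/-- The midpoint of the centre cell of a patch at the given position. -/
noncomputable def centreMid (T : Rect) (i : Fin 2) (l : Bool → ℝ) : Option Bool → ℝ
  | none => (T.lo i + T.hi i) / 2
  | some true => (T.hi i + l true) / 2
  | some false => (l false + T.lo i) / 2

namespace LinesAt

variable {T : Rect} {M : Patch} {i : Fin 2} {l : Bool → ℝ} {o : Option Bool}

theorem centre (h : LinesAt T (M i) i l o) :
    (M i 1 + M i 2) / 2 = centreMid T i l o ∧ M i 1 * M i 2 = centreProd T i l o := by
  rcases o with _ | _ | _ <;> simp only [LinesAt] at h <;> simp [centreMid, centreProd, h]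

/-- The values and slopes of the spline at the sides of `T`. -/
theorem spline (h : LinesAt T (M i) i l o) (hM : ∀ i, StrictMono (M i)) :
    M.splVal i (T.lo i) = shape (splParam T i l) (linWeight 0) o ∧
    M.splVal i (T.hi i) = shape (splParam T i l) (linWeight 1) o ∧
    (M.splDer i (T.hi i) - M.splDer i (T.lo i)) * (T.hi i - T.lo i) =
      2 * shape (splParam T i l) (fun o => if o = none then 0 else 1) o := by
  have m01 : M i 0 < M i 1 := hM i (by decide)
  have m12 : M i 1 < M i 2 := hM i (by decide)
  have m23 : M i 2 < M i 3 := hM i (by decide)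
  have l0 : M.len i 0 = M i 1 - M i 0 := rfl
  have l1 : M.len i 1 = M i 2 - M i 1 := rfl
  have l2 : M.len i 2 = M i 3 - M i 2 := rfl
  rcases o with _ | _ | _
  · obtain ⟨h0, h1, h2, h3⟩ := h
    have e1 : M i 2 - M i 0 ≠ 0 := by linarith
    have e2 : M i 3 - M i 1 ≠ 0 := by linarith
    rw [← h1, ← h2, Patch.splVal_one, Patch.splVal_two hM, Patch.splDer_one, Patch.splDer_two hM,
      l0, l1, l2]
    simp only [shape, splParam, linWeight, ← h0, ← h3, ← h1, ← h2]
    simp only [Bool.false_eq_true, if_false, if_true, reduceCtorEq]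
    rw [show M i 1 - M i 0 + (M i 2 - M i 1) = M i 2 - M i 0 by ring,
      show M i 2 - M i 1 + (M i 3 - M i 2) = M i 3 - M i 1 by ring]
    refine ⟨?_, ?_, ?_⟩ <;> field_simp <;> ring
  · obtain ⟨h1, h2, h3⟩ := h
    have e2 : M i 3 - M i 1 ≠ 0 := by linarith
    rw [← h2, ← h3, Patch.splVal_three hM, Patch.splVal_two hM, Patch.splDer_three hM,
      Patch.splDer_two hM, l1, l2]
    simp only [shape, splParam, linWeight, ← h1, ← h2, ← h3]
    simp only [Bool.false_eq_true, if_false, reduceCtorEq]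
    rw [show M i 2 - M i 1 + (M i 3 - M i 2) = M i 3 - M i 1 by ring]
    refine ⟨?_, ?_, ?_⟩ <;> field_simp <;> ring
  · obtain ⟨h1, h2, h3⟩ := h
    have e1 : M i 2 - M i 0 ≠ 0 := by linarith
    rw [← h1, ← h2, Patch.splVal_zero hM, Patch.splVal_one, Patch.splDer_zero hM,
      Patch.splDer_one, l0, l1]
    simp only [shape, splParam, linWeight, ← h1, ← h2, ← h3]
    simp only [if_true, if_false, reduceCtorEq]
    rw [show M i 1 - M i 0 + (M i 2 - M i 1) = M i 2 - M i 0 by ring]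
    refine ⟨?_, ?_, ?_⟩ <;> field_simp <;> ring

end LinesAt

/-- The reference coordinate on the side of `T`. -/
noncomputable def refCoord (T : Rect) (x : Pt) (i : Fin 2) : ℝ := (x i - T.lo i) / (T.hi i - T.lo i)

/-- The polynomial is a sum of three products of univariate splines' parts (linear times linear, and
quadratic rest times mean, in both orders). Each product has the form handled by `sum_mul_shape_eq`.
-/
theorem eval_piece_eq_shape {T : Rect} (hT : ∀ i, T.lo i < T.hi i) {M : Patch}
    (hM : ∀ i, StrictMono (M i)) {l : Fin 2 → Bool → ℝ} {τ : Fin 2 → Option Bool}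
    (h : ∀ i, LinesAt T (M i) i (l i) (τ i)) (x : Pt) :
    eval x (M.piece T) =
      shape (splParam T 0 (l 0)) (linWeight (refCoord T x 0)) (τ 0) *
        shape (splParam T 1 (l 1)) (linWeight (refCoord T x 1)) (τ 1) +
      shape (splParam T 0 (l 0)) (curvWeight (refCoord T x 0)) (τ 0) *
        shape (splParam T 1 (l 1)) meanWeight (τ 1) +
      shape (splParam T 0 (l 0)) meanWeight (τ 0) *
        shape (splParam T 1 (l 1)) (curvWeight (refCoord T x 1)) (τ 1) := by
  have hL : ∀ i, T.hi i - T.lo i ≠ 0 := fun i => sub_ne_zero.2 (hT i).ne'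
  have lin : ∀ i, eval x (M.linPart T i) =
      shape (splParam T i (l i)) (linWeight (refCoord T x i)) (τ i) := by
    intro i
    obtain ⟨h1, h2, -⟩ := (h i).spline hM
    have := hL i
    simp only [Patch.linPart, map_add, map_mul, map_sub, eval_C, eval_X, h1, h2]
    rcases τ i with _ | _ | _ <;> simp only [shape, linWeight, refCoord] <;> field_simp <;> ring
  have mean : ∀ i, (M.splVal i (T.lo i) + M.splVal i (T.hi i)) / 2 =
      shape (splParam T i (l i)) meanWeight (τ i) := by
    intro i
    obtain ⟨h1, h2, -⟩ := (h i).spline hM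
    rw [h1, h2]
    rcases τ i with _ | _ | _ <;> simp only [shape, linWeight, meanWeight] <;> ring
  have curv : ∀ i, (M.splDer i (T.hi i) - M.splDer i (T.lo i)) / (2 * (T.hi i - T.lo i)) *
      ((x i - T.lo i) * (x i - T.hi i)) =
      shape (splParam T i (l i)) (curvWeight (refCoord T x i)) (τ i) := by
    intro i
    obtain ⟨-, -, h3⟩ := (h i).spline hM
    have := hL i
    have e : shape (splParam T i (l i)) (curvWeight (refCoord T x i)) (τ i) =
        shape (splParam T i (l i)) (fun o => if o = none then 0 else 1) (τ i) *
          (refCoord T x i * (refCoord T x i - 1)) := by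
      rcases τ i with _ | _ | _ <;> simp [shape, curvWeight]
      ring
    rw [e, show shape (splParam T i (l i)) (fun o => if o = none then 0 else 1) (τ i) =
      (M.splDer i (T.hi i) - M.splDer i (T.lo i)) * (T.hi i - T.lo i) / 2 by rw [h3]; ring, refCoord]
    field_simp
    ring
  have hsub : (1 : Fin 2) - 1 = 0 := rfl
  simp only [Patch.piece, Patch.quadPart, map_add, map_mul, map_sub, eval_C, eval_X, sub_zero, hsub]
  rw [lin, lin, mean, mean, ← curv 0, ← curv 1]
  ring

/-- Marsden's identity on `T`. Each of the six coefficients of the polynomial is paired with each of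
the three products in the piece; `sum_mul_shape_eq` shows that the sums do not depend on the outer
lines, and they recombine to the polynomial. -/
theorem sum_functional_mul_piece {T : Rect} (hT : ∀ i, T.lo i < T.hi i)
    {P : (Fin 2 → Option Bool) → Patch} {l : Fin 2 → Bool → Option Bool → ℝ}
    (hl : IsLocalFamily T P l) (hP : ∀ τ i, StrictMono (P τ i)) {p : MvPolynomial (Fin 2) ℝ}
    (hp : p.totalDegree ≤ 2) (x : Pt) :
    ∑ τ, (P τ).functional (fun y => eval y p) * eval x ((P τ).piece T) = eval x p := by
  obtain ⟨a, b, c, d, e, f, rfl⟩ := exists_eq_quadPoly hp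
  have hL : ∀ i, T.hi i - T.lo i ≠ 0 := fun i => sub_ne_zero.2 (hT i).ne'
  set γ : Fin 2 → Bool → Option Bool → ℝ := fun i b k => splParam T i (fun b => l i b k) b with hγ
  set mid : Fin 2 → Option Bool → Option Bool → ℝ := fun i o k => centreMid T i (fun b => l i b k) o
    with hmid
  set prd : Fin 2 → Option Bool → Option Bool → ℝ := fun i o k => centreProd T i (fun b => l i b k) o
    with hprd
  -- Patches centred in the row `k`, not displaced in the direction `i`, contain both outer lines of
  -- that row; their ordering gives nonzero denominators.
  have hne : ∀ i k, l i true k - T.lo i ≠ 0 ∧ T.hi i - l i false k ≠ 0 := by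
    intro i k
    have h := hl.linesAt (Function.update (fun _ => none) (1 - i) k) i
    have hM := hP (Function.update (fun _ => none) (1 - i) k) i
    have hi : i ≠ 1 - i := (GridExtension.one_sub_ne i).symm
    simp only [Function.update_self, Function.update_of_ne hi, LinesAt] at h
    obtain ⟨h0, h1, h2, h3⟩ := h
    rw [← h0, ← h1, ← h2, ← h3]
    exact ⟨sub_ne_zero.2 (hM (by decide)).ne', sub_ne_zero.2 (hM (by decide)).ne'⟩
  have hv : ∀ b b', γ 0 b none = γ 0 b (some b') ∨ γ 1 b' none = γ 1 b' (some b) := by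
    intro b b'
    obtain ⟨i, hi⟩ := hl.vertex ![b, b']
    have key : ∀ (i : Fin 2) (b : Bool) (k k' : Option Bool), l i b k = l i b k' →
        γ i b k = γ i b k' := fun i b k k' h => by
      cases b <;> simp [hγ, splParam, h]
    fin_cases i
    · exact .inl (key _ _ _ _ hi)
    · exact .inr (key _ _ _ _ hi)
  -- Multiplied by the spline parameter, the change of the coefficient from the centre to its
  -- neighbour no longer involves the outer line. This and `hFp` are why the sum is the same in
  -- every row.
  have hFm : ∀ i b k, γ i b k * mid i (some b) k =
      (if b then 1 else -1) * ((T.hi i - T.lo i) / 2) + γ i b k * ((T.lo i + T.hi i) / 2) := by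
    intro i b k
    have h1 := (hne i k).1
    have h2 := (hne i k).2
    cases b <;> simp [hγ, hmid, splParam, centreMid] <;> field_simp <;> ring
  have hFp : ∀ i b k, γ i b k * prd i (some b) k =
      (if b then T.hi i else - T.lo i) * (T.hi i - T.lo i) + γ i b k * (T.lo i * T.hi i) := by
    intro i b k
    have h1 := (hne i k).1
    have h2 := (hne i k).2
    cases b <;> simp [hγ, hprd, splParam, centreProd] <;> field_simp <;> ring
  have hF1 : ∀ i b k, γ i b k * 1 = 0 + γ i b k * 1 := fun i b k => by ring
  have term : ∀ o o', (P ![o, o']).functional (fun y => eval y (quadPoly a b c d e f)) *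
      eval x ((P ![o, o']).piece T) =
      (a + b * mid 0 o o' + c * mid 1 o' o + d * prd 0 o o' + e * (mid 0 o o' * mid 1 o' o) +
        f * prd 1 o' o) *
      (shape (fun b => γ 0 b o') (linWeight (refCoord T x 0)) o *
        shape (fun b => γ 1 b o) (linWeight (refCoord T x 1)) o' +
      shape (fun b => γ 0 b o') (curvWeight (refCoord T x 0)) o *
        shape (fun b => γ 1 b o) meanWeight o' +
      shape (fun b => γ 0 b o') meanWeight o *
        shape (fun b => γ 1 b o) (curvWeight (refCoord T x 1)) o') := by
    intro o o'
    have hlin := hl.linesAt ![o, o']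
    have c0 := (hlin 0).centre
    have c1 := (hlin 1).centre
    rw [Patch.functional_quadPoly (hP _), eval_piece_eq_shape hT (hP _) hlin, c0.1, c0.2, c1.1, c1.2]
    rfl
  have S := fun (w w' : Option Bool → ℝ) (Λ Λ' : Option Bool → Option Bool → ℝ) (c c' : ℝ)
      (F F' : Bool → ℝ) hn hn' hF hF' =>
    sum_mul_shape_eq (γ 0) (γ 1) w w' Λ Λ' c c' F F' hn hn' hF hF' hv
  have S1 := fun w w' => S w w' (fun _ _ => 1) (fun _ _ => 1) 1 1 (fun _ => 0) (fun _ => 0)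
    (fun _ => rfl) (fun _ => rfl) (hF1 0) (hF1 1)
  have hnm : ∀ i k, mid i none k = (T.lo i + T.hi i) / 2 := fun _ _ => rfl
  have hnp : ∀ i k, prd i none k = T.lo i * T.hi i := fun _ _ => rfl
  have Sx := fun w w' => S w w' (mid 0) (fun _ _ => 1) _ 1 _ (fun _ => 0)
    (hnm 0) (fun _ => rfl) (hFm 0) (hF1 1)
  have Sy := fun w w' => S w w' (fun _ _ => 1) (mid 1) 1 _ (fun _ => 0) _
    (fun _ => rfl) (hnm 1) (hF1 0) (hFm 1)
  have Sxx := fun w w' => S w w' (prd 0) (fun _ _ => 1) _ 1 _ (fun _ => 0)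
    (hnp 0) (fun _ => rfl) (hFp 0) (hF1 1)
  have Syy := fun w w' => S w w' (fun _ _ => 1) (prd 1) 1 _ (fun _ => 0) _
    (fun _ => rfl) (hnp 1) (hF1 0) (hFp 1)
  have Sxy := fun w w' => S w w' (mid 0) (mid 1) _ _ _ _
    (hnm 0) (hnm 1) (hFm 0) (hFm 1)
  have total : ∀ w w', ∑ o, ∑ o', (a + b * mid 0 o o' + c * mid 1 o' o + d * prd 0 o o' +
      e * (mid 0 o o' * mid 1 o' o) + f * prd 1 o' o) *
      (shape (fun b => γ 0 b o') w o * shape (fun b => γ 1 b o) w' o') =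
      a * ((1 * w none + ∑ b : Bool, 0 * w (some b)) * (1 * w' none + ∑ b : Bool, 0 * w' (some b))) +
      b * (((T.lo 0 + T.hi 0) / 2 * w none + ∑ b : Bool,
        ((if b then 1 else -1) * ((T.hi 0 - T.lo 0) / 2)) * w (some b)) *
          (1 * w' none + ∑ b : Bool, 0 * w' (some b))) +
      c * ((1 * w none + ∑ b : Bool, 0 * w (some b)) * ((T.lo 1 + T.hi 1) / 2 * w' none +
        ∑ b : Bool, ((if b then 1 else -1) * ((T.hi 1 - T.lo 1) / 2)) * w' (some b))) +
      d * ((T.lo 0 * T.hi 0 * w none + ∑ b : Bool,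
        ((if b then T.hi 0 else - T.lo 0) * (T.hi 0 - T.lo 0)) * w (some b)) *
          (1 * w' none + ∑ b : Bool, 0 * w' (some b))) +
      e * (((T.lo 0 + T.hi 0) / 2 * w none + ∑ b : Bool,
        ((if b then 1 else -1) * ((T.hi 0 - T.lo 0) / 2)) * w (some b)) *
          ((T.lo 1 + T.hi 1) / 2 * w' none +
        ∑ b : Bool, ((if b then 1 else -1) * ((T.hi 1 - T.lo 1) / 2)) * w' (some b))) +
      f * ((1 * w none + ∑ b : Bool, 0 * w (some b)) * (T.lo 1 * T.hi 1 * w' none +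
        ∑ b : Bool, ((if b then T.hi 1 else - T.lo 1) * (T.hi 1 - T.lo 1)) * w' (some b))) := by
    intro w w'
    rw [← S1 w w', ← Sx w w', ← Sy w w', ← Sxx w w', ← Sxy w w', ← Syy w w']
    simp only [Finset.mul_sum, ← Finset.sum_add_distrib]
    refine Finset.sum_congr rfl fun o _ => Finset.sum_congr rfl fun o' _ => ?_
    ring
  rw [sum_fin_two_arrow]
  simp only [term]
  simp only [mul_add, Finset.sum_add_distrib] at total ⊢
  simp only [total]
  have hx : ∀ i, x i = T.lo i + (T.hi i - T.lo i) * refCoord T x i := fun i => by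
    have := hL i
    rw [refCoord]; field_simp; ring
  rw [eval_quadPoly, hx 0, hx 1]
  simp only [Fintype.sum_bool, linWeight, curvWeight, meanWeight, if_true, Bool.false_eq_true, if_false]
  ring

end RRM

namespace RRM

/-! ### Derivatives of quadratic polynomials -/

theorem pderiv_zero_quadPoly (a b c d e f : ℝ) :
    pderiv 0 (quadPoly a b c d e f) = quadPoly b (2 * d) e 0 0 0 :=
  MvPolynomial.funext fun x => by rw [eval_pderiv_zero_quadPoly, eval_quadPoly]; ring

theorem pderiv_one_quadPoly (a b c d e f : ℝ) :
    pderiv 1 (quadPoly a b c d e f) = quadPoly c e (2 * f) 0 0 0 :=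
  MvPolynomial.funext fun x => by rw [eval_pderiv_one_quadPoly, eval_quadPoly]; ring

theorem quadPoly_zero : quadPoly 0 0 0 0 0 0 = 0 := by simp [quadPoly]

theorem totalDegree_quadPoly_le (a b c d e f : ℝ) : (quadPoly a b c d e f).totalDegree ≤ 2 := by
  have hC : ∀ (t : ℝ) (q : MvPolynomial (Fin 2) ℝ), q.totalDegree ≤ 2 → (C t * q).totalDegree ≤ 2 :=
    fun t q hq => (totalDegree_mul _ _).trans (by simpa using hq)
  unfold quadPoly
  refine (totalDegree_add _ _).trans (max_le ((totalDegree_add _ _).trans (max_le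
    ((totalDegree_add _ _).trans (max_le ((totalDegree_add _ _).trans (max_le
    ((totalDegree_add _ _).trans (max_le (by simp) (hC _ _ (by simp)))) (hC _ _ (by simp))))
    (hC _ _ (by simp)))) (hC _ _ ((totalDegree_mul _ _).trans (by simp))))) (hC _ _ (by simp)))

/-- Lets the stability bound be used for third derivatives too, where the interpolant contributes
nothing. -/
theorem polyDeriv_eq_zero_of_order_three {p : MvPolynomial (Fin 2) ℝ} (hp : p.totalDegree ≤ 2)
    {a b : ℕ} (hab : a + b = 3) : polyDeriv a b p = 0 := by
  obtain ⟨_, _, _, _, _, _, rfl⟩ := exists_eq_quadPoly hp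
  have ha : a ≤ 3 := by omega
  obtain rfl : b = 3 - a := by omega
  interval_cases a <;>
    simp [polyDeriv, pderiv_zero_quadPoly, pderiv_one_quadPoly, quadPoly_zero]

theorem polyDeriv_sum {ι : Type*} (s : Finset ι) (c : ι → ℝ) (p : ι → MvPolynomial (Fin 2) ℝ)
    (a b : ℕ) : polyDeriv a b (∑ τ ∈ s, C (c τ) * p τ) = ∑ τ ∈ s, C (c τ) * polyDeriv a b (p τ) := by
  have key : ∀ (i : Fin 2) (n : ℕ) (p : ι → MvPolynomial (Fin 2) ℝ),
      (pderiv i)^[n] (∑ τ ∈ s, C (c τ) * p τ) = ∑ τ ∈ s, C (c τ) * (pderiv i)^[n] (p τ) := by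
    intro i n
    induction n with
    | zero => intro p; rfl
    | succ n ih =>
      intro p
      simp only [Function.iterate_succ_apply]
      rw [← ih]
      congr 1
      rw [map_sum]
      exact Finset.sum_congr rfl fun τ _ => by simp [Derivation.leibniz]
  rw [polyDeriv, key, key]
  rfl

namespace Patch

variable {M : Patch}

/-! ### Shape regularity -/

/-- All sides of a shape regular patch are comparable with the size of any of its cells. -/
theorem len_bounds (hM : ∀ i, StrictMono (M i)) {γ₀ : ℝ}
    (hreg : ∀ m, (M.cell m).size / (M.cell m).inradius ≤ γ₀) (m : Fin 2 → Fin 3) :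
    1 ≤ γ₀ / 2 ∧ ∀ i j, (M.cell m).size ≤ (γ₀ / 2) ^ 2 * M.len i j ∧
      M.len i j ≤ γ₀ / 2 * (M.cell m).size := by
  have hl := len_pos hM
  have hside : ∀ n i, (M.cell n).hi i - (M.cell n).lo i = M.len i (n i) := fun n i => rfl
  -- The inradius is half the shorter side, hence `γ₀ / 2`.
  have hg : ∀ n : Fin 2 → Fin 3, max (M.len 0 (n 0)) (M.len 1 (n 1)) ≤
      γ₀ / 2 * min (M.len 0 (n 0)) (M.len 1 (n 1)) := by
    intro n
    have := hreg n
    simp only [Rect.size, Rect.inradius, hside] at this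
    have hmin : 0 < min (M.len 0 (n 0)) (M.len 1 (n 1)) := lt_min (hl _ _) (hl _ _)
    rw [div_le_iff₀ (by positivity)] at this
    linarith
  -- Every column of the patch crosses every row in a cell, so sides in different directions are
  -- comparable with factor `γ₀ / 2`. Comparing sides in the same direction goes through the other
  -- one and costs its square.
  have h01 : ∀ n : Fin 2 → Fin 3, M.len 0 (n 0) ≤ γ₀ / 2 * M.len 1 (n 1) ∧ M.len 1 (n 1) ≤ γ₀ / 2 * M.len 0 (n 0) ∧
      1 ≤ γ₀ / 2 := by
    intro n
    have h := hg n
    have hmin : 0 < min (M.len 0 (n 0)) (M.len 1 (n 1)) := lt_min (hl _ _) (hl _ _)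
    have hpos : 0 < max (M.len 0 (n 0)) (M.len 1 (n 1)) := (hl _ _).trans_le (le_max_left _ _)
    have hγ : 1 ≤ γ₀ / 2 := by
      have := (min_le_max (a := M.len 0 (n 0)) (b := M.len 1 (n 1))).trans h
      by_contra hc
      push Not at hc
      nlinarith
    have h1 := min_le_left (M.len 0 (n 0)) (M.len 1 (n 1))
    have h2 := min_le_right (M.len 0 (n 0)) (M.len 1 (n 1))
    have h3 := le_max_left (M.len 0 (n 0)) (M.len 1 (n 1))
    have h4 := le_max_right (M.len 0 (n 0)) (M.len 1 (n 1))
    refine ⟨?_, ?_, hγ⟩ <;> nlinarith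
  have hγ := (h01 m).2.2
  set g := γ₀ / 2
  have hsize : (M.cell m).size = max (M.len 0 (m 0)) (M.len 1 (m 1)) := rfl
  have hs0 : M.len 0 (m 0) ≤ (M.cell m).size := hsize ▸ le_max_left _ _
  have hs1 : M.len 1 (m 1) ≤ (M.cell m).size := hsize ▸ le_max_right _ _
  refine ⟨hγ, fun i j => ?_⟩
  have h := h01 m
  have l0 := hl 0 (m 0)
  have l1 := hl 1 (m 1)
  fin_cases i
  · have hj := h01 ![j, m 1]
    simp only [Matrix.cons_val_zero, Matrix.cons_val_one] at hj
    refine ⟨?_, hj.1.trans (by gcongr)⟩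
    have : (M.cell m).size ≤ g * M.len 1 (m 1) := by
      rw [hsize]; exact max_le h.1 (by nlinarith)
    calc (M.cell m).size ≤ g * M.len 1 (m 1) := this
      _ ≤ g * (g * M.len 0 j) := by gcongr; exact hj.2.1
      _ = _ := by ring_nf; rfl
  · have hj := h01 ![m 0, j]
    simp only [Matrix.cons_val_zero, Matrix.cons_val_one] at hj
    refine ⟨?_, hj.2.1.trans (by gcongr)⟩
    have : (M.cell m).size ≤ g * M.len 0 (m 0) := by
      rw [hsize]; exact max_le (by nlinarith) h.2.1
    calc (M.cell m).size ≤ g * M.len 0 (m 0) := this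
      _ ≤ g * (g * M.len 1 j) := by gcongr; exact hj.1
      _ = _ := by ring_nf; rfl

/-! ### Bounds for the basis functions -/

theorem splVal_mem (hM : ∀ i, StrictMono (M i)) (i : Fin 2) (t : ℝ) :
    0 ≤ M.splVal i t ∧ M.splVal i t ≤ 1 := by
  have l0 := len_pos hM i 0
  have l1 := len_pos hM i 1
  have l2 := len_pos hM i 2
  rw [splVal]
  split_ifs
  · exact ⟨by positivity, (div_le_one (by positivity)).2 (by linarith)⟩
  · exact ⟨by positivity, (div_le_one (by positivity)).2 (by linarith)⟩
  · simp

theorem abs_splDer_le (i : Fin 2) (t : ℝ) {κ : ℝ} (hκ : 0 < κ)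
    (h : ∀ j, κ ≤ M.len i j) : |M.splDer i t| ≤ κ⁻¹ := by
  have l0 := h 0
  have l1 := h 1
  have l2 := h 2
  have key : ∀ s, 2 * κ ≤ s → 2 / s ≤ κ⁻¹ := fun s hs => by
    rw [div_le_iff₀ (by linarith)]
    calc (2 : ℝ) = κ⁻¹ * (2 * κ) := by field_simp
      _ ≤ _ := by gcongr
  rw [splDer]
  split_ifs
  · rw [abs_of_nonneg (div_nonneg (by norm_num) (by linarith))]
    exact key _ (by linarith)
  · rw [neg_div, abs_neg, abs_of_nonneg (div_nonneg (by norm_num) (by linarith))]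
    exact key _ (by linarith)
  · simpa using hκ.le

/-- Spline values lie in `[0, 1]` and spline slopes are at most `κ⁻¹`, so each derivative costs a
factor `κ⁻¹`, while the extent of `T` enters through `h / κ`. The constant `6 = 4 + 1 + 1` comes
from the undifferentiated polynomial: the product of the linear parts and two quadratic rests. -/
theorem abs_eval_polyDeriv_piece_le (hM : ∀ i, StrictMono (M i)) {T : Rect} {κ h : ℝ} (hκ : 0 < κ)
    (hκh : κ ≤ h) (hlen : ∀ i j, κ ≤ M.len i j) (hTκ : ∀ i, κ ≤ T.hi i - T.lo i)
    (hTh : ∀ i, T.hi i - T.lo i ≤ h) {a b : ℕ} (hab : a + b ≤ 2) {x : Pt} (hx : x ∈ T.closed) :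
    |eval x (polyDeriv a b (M.piece T))| ≤ 6 * (h / κ) ^ 2 * κ⁻¹ ^ (a + b) := by
  have hTpos : ∀ i, 0 < T.hi i - T.lo i := fun i => hκ.trans_le (hTκ i)
  set s : Fin 2 → ℝ := fun i => (M.splVal i (T.hi i) - M.splVal i (T.lo i)) / (T.hi i - T.lo i)
    with hs
  set q : Fin 2 → ℝ := fun i => (M.splDer i (T.hi i) - M.splDer i (T.lo i)) /
    (2 * (T.hi i - T.lo i)) * ((M.splVal (1 - i) (T.lo (1 - i)) +
      M.splVal (1 - i) (T.hi (1 - i))) / 2) with hq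
  set L : Fin 2 → ℝ := fun i => M.splVal i (T.lo i) + s i * (x i - T.lo i) with hL
  have hsb : ∀ i, |s i| ≤ κ⁻¹ := by
    intro i
    have h1 := splVal_mem hM i (T.hi i)
    have h2 := splVal_mem hM i (T.lo i)
    rw [hs]
    simp only
    rw [abs_div, abs_of_pos (hTpos i), div_le_iff₀ (hTpos i)]
    calc |M.splVal i (T.hi i) - M.splVal i (T.lo i)| ≤ 1 :=
          abs_le.2 ⟨by linarith, by linarith⟩
      _ = κ⁻¹ * κ := by field_simp
      _ ≤ _ := by gcongr; exact hTκ i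
  have hqb : ∀ i, |q i| ≤ κ⁻¹ ^ 2 := by
    intro i
    have h1 := abs_le.1 (abs_splDer_le i (T.hi i) hκ (hlen i))
    have h2 := abs_le.1 (abs_splDer_le i (T.lo i) hκ (hlen i))
    have h3 := splVal_mem hM (1 - i) (T.hi (1 - i))
    have h4 := splVal_mem hM (1 - i) (T.lo (1 - i))
    have hpos := hTpos i
    have e1 : |(M.splDer i (T.hi i) - M.splDer i (T.lo i)) / (2 * (T.hi i - T.lo i))| ≤ κ⁻¹ ^ 2 := by
      rw [abs_div, abs_of_pos (show 0 < 2 * (T.hi i - T.lo i) by linarith),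
        div_le_iff₀ (by linarith)]
      calc |M.splDer i (T.hi i) - M.splDer i (T.lo i)| ≤ 2 * κ⁻¹ :=
            abs_le.2 ⟨by linarith, by linarith⟩
        _ = κ⁻¹ ^ 2 * (2 * κ) := by field_simp
        _ ≤ _ := by gcongr; exact hTκ i
    have e2 : |(M.splVal (1 - i) (T.lo (1 - i)) + M.splVal (1 - i) (T.hi (1 - i))) / 2| ≤ 1 :=
      abs_le.2 ⟨by linarith, by linarith⟩
    rw [hq]
    simp only
    rw [abs_mul]
    calc _ ≤ κ⁻¹ ^ 2 * 1 := mul_le_mul e1 e2 (abs_nonneg _) (by positivity)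
      _ = _ := mul_one _
  have hxb : ∀ i, |x i - T.lo i| ≤ h ∧ |x i - T.hi i| ≤ h := fun i => by
    have := hx i
    have := hTh i
    exact ⟨abs_le.2 ⟨by linarith, by linarith⟩, abs_le.2 ⟨by linarith, by linarith⟩⟩
  have hh : 0 < h := hκ.trans_le hκh
  set R := h / κ with hR
  have hR1 : 1 ≤ R := (one_le_div hκ).2 hκh
  have hhR : h = R * κ := by rw [hR]; field_simp
  have hLb : ∀ i, |L i| ≤ 2 * R := by
    intro i
    have h2 := splVal_mem hM i (T.lo i)
    calc |L i| ≤ |M.splVal i (T.lo i)| + |s i * (x i - T.lo i)| := abs_add_le _ _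
      _ ≤ 1 + κ⁻¹ * h := by
        rw [abs_mul]
        exact add_le_add (abs_le.2 ⟨by linarith, h2.2⟩)
          (mul_le_mul (hsb i) (hxb i).1 (abs_nonneg _) (by positivity))
      _ = 1 + R := by rw [hhR]; field_simp
      _ ≤ _ := by linarith
  have hR2 : 1 ≤ R ^ 2 := one_le_pow₀ hR1
  have hRR : R ≤ R ^ 2 := by nlinarith
  have hp0 : eval x (M.piece T) = L 0 * L 1 + q 0 * ((x 0 - T.lo 0) * (x 0 - T.hi 0)) +
      q 1 * ((x 1 - T.lo 1) * (x 1 - T.hi 1)) := by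
    simp [piece, linPart, quadPart, hL, hq, hs]
  have d0 : ∀ y : Pt, eval y (pderiv 0 (M.piece T)) = s 0 * (M.splVal 1 (T.lo 1) + s 1 * (y 1 - T.lo 1)) +
      q 0 * ((y 0 - T.lo 0) + (y 0 - T.hi 0)) := by
    intro y
    simp [piece, linPart, quadPart, hq, hs, Derivation.leibniz, pderiv_X]
    ring
  have d1 : ∀ y : Pt, eval y (pderiv 1 (M.piece T)) = s 1 * (M.splVal 0 (T.lo 0) + s 0 * (y 0 - T.lo 0)) +
      q 1 * ((y 1 - T.lo 1) + (y 1 - T.hi 1)) := by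
    intro y
    simp [piece, linPart, quadPart, hq, hs, Derivation.leibniz, pderiv_X]
    ring
  have p0 : pderiv 0 (M.piece T) = quadPoly (s 0 * (M.splVal 1 (T.lo 1) - s 1 * T.lo 1) -
      q 0 * (T.lo 0 + T.hi 0)) (2 * q 0) (s 0 * s 1) 0 0 0 :=
    MvPolynomial.funext fun y => by rw [d0, eval_quadPoly]; ring
  have p1 : pderiv 1 (M.piece T) = quadPoly (s 1 * (M.splVal 0 (T.lo 0) - s 0 * T.lo 0) -
      q 1 * (T.lo 1 + T.hi 1)) (s 0 * s 1) (2 * q 1) 0 0 0 :=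
    MvPolynomial.funext fun y => by rw [d1, eval_quadPoly]; ring
  have first : ∀ i j, |s i * L j + q i * ((x i - T.lo i) + (x i - T.hi i))| ≤ 6 * R ^ 2 * κ⁻¹ := by
    intro i j
    calc |s i * L j + q i * ((x i - T.lo i) + (x i - T.hi i))|
        ≤ |s i| * |L j| + |q i| * (|x i - T.lo i| + |x i - T.hi i|) := by
          refine (abs_add_le _ _).trans ?_
          rw [abs_mul, abs_mul]
          gcongr
          exact abs_add_le _ _
      _ ≤ κ⁻¹ * (2 * R) + κ⁻¹ ^ 2 * (h + h) := by
          gcongr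
          exacts [hsb i, hLb j, hqb i, (hxb i).1, (hxb i).2]
      _ = 4 * R * κ⁻¹ := by rw [hhR]; field_simp; ring
      _ ≤ _ := by
        have : 0 < κ⁻¹ := by positivity
        nlinarith
  have second : ∀ y, |y| ≤ 2 * κ⁻¹ ^ 2 → |y| ≤ 6 * R ^ 2 * κ⁻¹ ^ 2 := fun y hy => by
    have : 0 < κ⁻¹ ^ 2 := by positivity
    nlinarith
  have hss : |s 0 * s 1| ≤ 2 * κ⁻¹ ^ 2 := by
    rw [abs_mul]
    have : 0 < κ⁻¹ := by positivity
    nlinarith [mul_le_mul (hsb 0) (hsb 1) (abs_nonneg _) this.le]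
  have hqq : ∀ i, |2 * q i| ≤ 2 * κ⁻¹ ^ 2 := fun i => by
    rw [abs_mul, abs_two]; linarith [hqb i]
  have ha : a ≤ 2 := by omega
  have hb : b ≤ 2 - a := by omega
  interval_cases a <;> interval_cases b <;>
    simp only [polyDeriv, Function.iterate_succ_apply, Function.iterate_zero, id, zero_add, add_zero,
      pow_zero, pow_one, mul_one, Nat.reduceAdd]
  · rw [hp0]
    have e : ∀ i, |q i * ((x i - T.lo i) * (x i - T.hi i))| ≤ R ^ 2 := fun i => by
      rw [abs_mul (q i), abs_mul (x i - T.lo i)]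
      calc _ ≤ κ⁻¹ ^ 2 * (h * h) := by gcongr; exacts [hqb i, (hxb i).1, (hxb i).2]
        _ = _ := by rw [hhR]; field_simp
    have e' : |L 0 * L 1| ≤ (2 * R) * (2 * R) := by
      rw [abs_mul]
      exact mul_le_mul (hLb 0) (hLb 1) (abs_nonneg _) (by positivity)
    calc _ ≤ |L 0 * L 1| + _ + _ := abs_add_three _ _ _
      _ ≤ (2 * R) * (2 * R) + R ^ 2 + R ^ 2 := add_le_add (add_le_add e' (e 0)) (e 1)
      _ = _ := by ring
  · rw [d1]; exact first 1 0
  · rw [p1, pderiv_one_quadPoly, eval_quadPoly]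
    refine second _ ?_
    simpa using hqq 1
  · rw [d0]; exact first 0 1
  · rw [p0, pderiv_one_quadPoly, eval_quadPoly]
    refine second _ ?_
    simpa using hss
  · rw [p0, pderiv_zero_quadPoly, eval_quadPoly]
    refine second _ ?_
    simpa using hqq 0

end Patch

theorem Rect.eLpNorm_le_of_bound {T : Rect} {h B : ℝ} (hTh : ∀ i, T.hi i - T.lo i ≤ h)
    {f : Pt → ℝ} (hf : ∀ x ∈ T.closed, |f x| ≤ B) :
    eLpNorm f 2 (volume.restrict T.closed) ≤ ENNReal.ofReal h * ENNReal.ofReal B := by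
  refine (eLpNorm_le_of_ae_bound (C := B) ((ae_restrict_iff' T.measurableSet_closed).2
    (.of_forall fun x hx => by simpa using hf x hx))).trans ?_
  refine mul_le_mul_left ?_ _
  rw [Measure.restrict_apply_univ, Rect.volume_closed]
  have : ENNReal.ofReal (T.hi 0 - T.lo 0) * ENNReal.ofReal (T.hi 1 - T.lo 1) ≤
      ENNReal.ofReal h ^ (2 : ℝ) := by
    rw [ENNReal.rpow_two, pow_two]
    exact mul_le_mul' (ENNReal.ofReal_le_ofReal (hTh 0)) (ENNReal.ofReal_le_ofReal (hTh 1))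
  calc _ ≤ (ENNReal.ofReal h ^ (2 : ℝ)) ^ (2 : ℝ≥0∞).toReal⁻¹ := by gcongr
    _ = _ := by rw [← ENNReal.rpow_mul]; simp

end RRM

namespace RRM

/-! ### The interpolant on a cell -/

theorem Rect.closed_subset_closure_inner {K : Rect} (hK : ∀ i, K.lo i < K.hi i) :
    K.closed ⊆ closure K.inner := by
  rw [inner_eq_pi, closure_pi_set, closed_eq_pi]
  exact Set.pi_mono fun i _ => by rw [closure_Ioo (hK i).ne]

theorem Rect.inner_nonempty {K : Rect} (hK : ∀ i, K.lo i < K.hi i) : K.inner.Nonempty :=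
  ⟨fun i => (K.lo i + K.hi i) / 2, fun i => ⟨by linarith [hK i], by linarith [hK i]⟩⟩

theorem Patch.isOpen_inner (M : Patch) : IsOpen M.inner :=
  (⟨fun i => M i 0, fun i => M i 3⟩ : Rect).isOpen_inner

theorem Patch.restrict_inner (M : Patch) : volume.restrict M.inner = volume.restrict M.closed :=
  (⟨fun i => M i 0, fun i => M i 3⟩ : Rect).restrict_inner

theorem Patch.inner_inter_nonempty {M : Patch} (hM : ∀ i, StrictMono (M i)) {T : Rect} {x : Pt}
    (hx : x ∈ M.closed) (hxT : x ∈ T.inner) : (M.inner ∩ T.inner).Nonempty := by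
  have h : x ∈ closure M.inner :=
    Rect.closed_subset_closure_inner (K := ⟨fun i => M i 0, fun i => M i 3⟩)
      (fun i => hM i (by decide)) hx
  rw [Set.inter_comm]
  exact mem_closure_iff.1 h _ T.isOpen_inner hxT

/-- The polynomial that the interpolant of `u` is on `T`. -/
noncomputable def localPoly (T : Rect) (P : (Fin 2 → Option Bool) → Patch) (u : Pt → ℝ) :
    MvPolynomial (Fin 2) ℝ := ∑ τ, C ((P τ).functional u) * (P τ).piece T

theorem eval_localPoly (T : Rect) (P : (Fin 2 → Option Bool) → Patch) (u : Pt → ℝ) (x : Pt) :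
    eval x (localPoly T P u) = ∑ τ, (P τ).functional u * eval x ((P τ).piece T) := by
  simp [localPoly, map_sum]

theorem IsLocalFamily.cell_eq {T : Rect} {P : (Fin 2 → Option Bool) → Patch}
    {l : Fin 2 → Bool → Option Bool → ℝ} (hl : IsLocalFamily T P l) (τ : Fin 2 → Option Bool) :
    (P τ).cell (fun i => pos (τ i)) = T :=
  LinesAt.cell_eq (l := fun i b => l i b (τ (1 - i))) (hl.linesAt τ)

namespace GridExtension

variable {G : Finset Rect} {E : GridExtension G} {T : Rect} {γ₀ : ℝ}
  {P : (Fin 2 → Option Bool) → Patch}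

/-- A patch containing a point of the open cell also meets it with its interior and is therefore one
of the nine; all other basis functions vanish there. -/
theorem interpolant_eq_eval_localPoly (hE : E.IsAdmissible γ₀) (hTi : ∀ i, T.lo i < T.hi i)
    (hT : T ∈ G) (hP : ∀ τ, P τ ∈ E.patches) (hl : IsLocalFamily T P (E.outerLine T))
    (v : Pt → ℝ) {x : Pt} (hx : x ∈ T.inner) :
    E.interpolant v x = eval x (localPoly T P v) := by
  classical
  obtain ⟨hinj, hall⟩ := E.mem_range_of_inner_inter_nonempty hE (Rect.inner_nonempty hTi) hT hP hl
  have hsub : Finset.univ.image P ⊆ E.patches := fun M hM => by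
    obtain ⟨τ, -, rfl⟩ := Finset.mem_image.1 hM
    exact hP τ
  rw [eval_localPoly, interpolant, ← Finset.sum_subset hsub, Finset.sum_image hinj.injOn]
  · refine Finset.sum_congr rfl fun τ _ => ?_
    have hc := hl.cell_eq τ
    rw [Patch.basisFunction_eq_eval_piece (hE.ordered _ (hP τ)) _ (hc ▸ hx), hc]
  · intro M hM hMP
    rw [Patch.basisFunction_eq_zero (hE.ordered _ hM), mul_zero]
    intro hxM
    obtain ⟨τ, rfl⟩ := hall M hM (Patch.inner_inter_nonempty (hE.ordered _ hM) hxM hx)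
    exact hMP (Finset.mem_image_of_mem _ (Finset.mem_univ τ))

theorem closed_subset_patch (hE : E.IsAdmissible γ₀) (hP : ∀ τ, P τ ∈ E.patches)
    (hl : IsLocalFamily T P (E.outerLine T)) (τ : Fin 2 → Option Bool) :
    T.closed ⊆ (P τ).closed := by
  have := Patch.cell_closed_subset (hE.ordered _ (hP τ)) fun i => pos (τ i)
  rwa [hl.cell_eq τ] at this

theorem patch_subset_delta (hE : E.IsAdmissible γ₀) (hP : ∀ τ, P τ ∈ E.patches)
    (hl : IsLocalFamily T P (E.outerLine T)) (τ : Fin 2 → Option Bool) :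
    (P τ).closed ⊆ E.delta T := fun _ hx =>
  Set.mem_iUnion₂.2 ⟨P τ, hP τ, Set.mem_iUnion.2 ⟨closed_subset_patch hE hP hl τ, hx⟩⟩

theorem patch_subset_domain (hP : ∀ τ, P τ ∈ E.patches) (τ : Fin 2 → Option Bool) :
    (P τ).closed ⊆ E.domain := fun _ hx => Set.mem_iUnion₂.2 ⟨P τ, hP τ, hx⟩

end GridExtension

/-! ### Stability -/

/-- Per patch, the functional gives `9 κ⁻¹`, the area of `T` gives `h`, and the polynomial gives `6
(h / κ)²` and the derivative factors, where `h / κ = g²`. Nine patches make `9 · 54 = 486`. -/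
theorem eLpNorm_polyDeriv_localPoly_le {T : Rect} {P : (Fin 2 → Option Bool) → Patch} {g h : ℝ}
    (hg : 1 ≤ g) (hh : 0 < h) (hP : ∀ τ i, StrictMono (P τ i))
    (hlen : ∀ τ i j, h ≤ g ^ 2 * (P τ).len i j) (hT : ∀ i, h ≤ g ^ 2 * (T.hi i - T.lo i))
    (hTh : ∀ i, T.hi i - T.lo i ≤ h) {u : Pt → ℝ}
    (hu : ∀ τ, AEStronglyMeasurable u (volume.restrict (P τ).closed)) {N : ℝ≥0∞}
    (hN : ∀ τ, eLpNorm u 2 (volume.restrict (P τ).closed) ≤ N) {a b : ℕ} (hab : a + b ≤ 3) :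
    eLpNorm (fun x => eval x (polyDeriv a b (localPoly T P u))) 2 (volume.restrict T.closed) ≤
      ENNReal.ofReal (486 * g ^ 6 * (g ^ 2 / h) ^ (a + b)) * N := by
  set κ := h / g ^ 2 with hκd
  have hκ : 0 < κ := by positivity
  have hg2 : 1 ≤ g ^ 2 := one_le_pow₀ hg
  have hκh : κ ≤ h := (div_le_iff₀ (by positivity)).2 (by nlinarith)
  have hκl : ∀ {s}, h ≤ g ^ 2 * s → κ ≤ s := fun hs => (div_le_iff₀ (by positivity)).2 (by linarith)
  have hinv : κ⁻¹ = g ^ 2 / h := inv_div _ _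
  have hquot : h / κ = g ^ 2 := by rw [hκd]; field_simp
  have hpiece : ∀ τ, eLpNorm (fun x => eval x (polyDeriv a b ((P τ).piece T))) 2
      (volume.restrict T.closed) ≤
        ENNReal.ofReal h * ENNReal.ofReal (6 * (g ^ 2) ^ 2 * (g ^ 2 / h) ^ (a + b)) := by
    intro τ
    refine Rect.eLpNorm_le_of_bound hTh fun x hx => ?_
    rcases hab.lt_or_eq with hab | hab
    · have := Patch.abs_eval_polyDeriv_piece_le (hP τ) hκ hκh (fun i j => hκl (hlen τ i j))
        (fun i => hκl (hT i)) hTh (by omega : a + b ≤ 2) hx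
      rwa [hinv, hquot] at this
    · rw [polyDeriv_eq_zero_of_order_three ((P τ).piece_degree T) hab]
      simp only [map_zero, abs_zero]
      positivity
  have hterm : ∀ τ, eLpNorm (fun x => (P τ).functional u * eval x (polyDeriv a b ((P τ).piece T))) 2
      (volume.restrict T.closed) ≤ ENNReal.ofReal (54 * g ^ 6 * (g ^ 2 / h) ^ (a + b)) * N := by
    intro τ
    have e1 := eLpNorm_const_smul ((P τ).functional u)
      (fun x => eval x (polyDeriv a b ((P τ).piece T))) 2 (volume.restrict T.closed)
    have e2 := Patch.enorm_functional_le hκ (hP τ) (fun i j => hκl (hlen τ i j)) (hu τ)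
    calc _ = ‖(P τ).functional u‖ₑ * eLpNorm (fun x => eval x (polyDeriv a b ((P τ).piece T))) 2
          (volume.restrict T.closed) := e1
      _ ≤ (ENNReal.ofReal (9 * κ⁻¹) * N) * (ENNReal.ofReal h *
          ENNReal.ofReal (6 * (g ^ 2) ^ 2 * (g ^ 2 / h) ^ (a + b))) :=
        mul_le_mul' (e2.trans (mul_le_mul_right (hN τ) _)) (hpiece τ)
      _ = (ENNReal.ofReal (9 * κ⁻¹) * (ENNReal.ofReal h *
          ENNReal.ofReal (6 * (g ^ 2) ^ 2 * (g ^ 2 / h) ^ (a + b)))) * N := by ring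
      _ = _ := by
        rw [← ENNReal.ofReal_mul hh.le, ← ENNReal.ofReal_mul (by positivity), hinv]
        congr 2
        field_simp
        ring
  have hfun : (fun x => eval x (polyDeriv a b (localPoly T P u))) =
      ∑ τ, fun x => (P τ).functional u * eval x (polyDeriv a b ((P τ).piece T)) := by
    funext x
    rw [localPoly, polyDeriv_sum, Finset.sum_apply, map_sum]
    simp
  rw [hfun]
  refine (eLpNorm_sum_le (fun τ _ => ?_) (by norm_num)).trans ?_
  · exact ((contDiff_eval _).continuous.const_mul _).aestronglyMeasurable
  · refine (Finset.sum_le_sum fun τ _ => hterm τ).trans (le_of_eq ?_)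
    rw [Finset.sum_const, Finset.card_univ, show Fintype.card (Fin 2 → Option Bool) = 9 by simp,
      nsmul_eq_mul, ← mul_assoc, ← ENNReal.ofReal_natCast, ← ENNReal.ofReal_mul (by positivity)]
    congr 2
    push_cast
    ring

/-- For `k ≤ 3` there are at most four derivatives; the factor `4` is a crude bound for `√(k + 1)`.
-/
theorem sobolevSeminorm_le {U : Set Pt} {k : ℕ} (hk : k ≤ 3) {v : Pt → ℝ} {B : ℝ≥0∞}
    (h : ∀ a b, a + b = k → weakDerivNorm U a b v ≤ B) : sobolevSeminorm k U v ≤ 4 * B := by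
  have h1 : ∑ α ∈ Finset.HasAntidiagonal.antidiagonal k, weakDerivNorm U α.1 α.2 v ^ 2 ≤
      (4 * B) ^ 2 := by
    calc _ ≤ ∑ α ∈ Finset.HasAntidiagonal.antidiagonal k, B ^ 2 :=
          Finset.sum_le_sum fun α hα => by
            gcongr
            exact h _ _ (Finset.HasAntidiagonal.mem_antidiagonal.1 hα)
      _ = (k + 1 : ℕ) * B ^ 2 := by rw [Finset.sum_const, Finset.Nat.card_antidiagonal, nsmul_eq_mul]
      _ ≤ (16 : ℕ) * B ^ 2 := by gcongr; omega
      _ = _ := by push_cast; ring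
  calc _ ≤ ((4 * B) ^ 2) ^ (1 / 2 : ℝ) := by unfold sobolevSeminorm; gcongr
    _ = 4 * B := by rw [← ENNReal.rpow_natCast, ← ENNReal.rpow_mul]; norm_num

theorem weakDerivNorm_le_sobolevSeminorm (U : Set Pt) (a b : ℕ) (v : Pt → ℝ) :
    weakDerivNorm U a b v ≤ sobolevSeminorm (a + b) U v := by
  have h1 : weakDerivNorm U a b v ^ 2 ≤
      ∑ α ∈ Finset.HasAntidiagonal.antidiagonal (a + b), weakDerivNorm U α.1 α.2 v ^ 2 :=
    Finset.single_le_sum (f := fun α : ℕ × ℕ => weakDerivNorm U α.1 α.2 v ^ 2) (fun _ _ => zero_le)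
      (Finset.HasAntidiagonal.mem_antidiagonal.2 (rfl : (a, b).1 + (a, b).2 = a + b))
  calc weakDerivNorm U a b v = (weakDerivNorm U a b v ^ 2) ^ (1 / 2 : ℝ) := by
        rw [← ENNReal.rpow_natCast, ← ENNReal.rpow_mul]; norm_num
    _ ≤ _ := by unfold sobolevSeminorm; gcongr

/-- A cell together with its nine patches, all shape regular. -/
theorem exists_local_setting {G : Finset Rect} (hG : IsRectGrid G) {E : GridExtension G} {γ₀ : ℝ}
    (hE : E.IsAdmissible γ₀) {T : Rect} (hT : T ∈ G) :
    ∃ P, (∀ τ, P τ ∈ E.patches) ∧ IsLocalFamily T P (E.outerLine T) ∧ 0 < T.size ∧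
      (∀ τ i j, T.size ≤ max 1 (γ₀ / 2) ^ 2 * (P τ).len i j ∧
        (P τ).len i j ≤ max 1 (γ₀ / 2) * T.size) ∧
      (∀ i, T.size ≤ max 1 (γ₀ / 2) ^ 2 * (T.hi i - T.lo i)) ∧ ∀ i, T.hi i - T.lo i ≤ T.size := by
  obtain ⟨P, hP, hl⟩ := E.exists_isLocalFamily hG.nondegenerate hT
  have hTi := hG.nondegenerate T hT
  have hsize : ∀ i, T.hi i - T.lo i ≤ T.size := fun i => by
    fin_cases i
    exacts [le_max_left _ _, le_max_right _ _]
  have hpos : 0 < T.size := (sub_pos.2 (hTi 0)).trans_le (hsize 0)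
  have hlen : ∀ τ i j, T.size ≤ max 1 (γ₀ / 2) ^ 2 * (P τ).len i j ∧
      (P τ).len i j ≤ max 1 (γ₀ / 2) * T.size := by
    intro τ i j
    obtain ⟨h1, h2⟩ := Patch.len_bounds (hE.ordered _ (hP τ)) (hE.regular _ (hP τ))
      fun i => pos (τ i)
    rw [hl.cell_eq τ] at h2
    -- An admissible extension forces `γ₀ / 2 ≥ 1`. The maximum only makes the constant meaningful
    -- for every `γ₀`.
    rw [max_eq_right h1]
    exact h2 i j
  refine ⟨P, hP, hl, hpos, hlen, fun i => ?_, hsize⟩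
  have := (hlen (fun _ => none) i 1).1
  have hc := hl.cell_eq fun _ => none
  rw [← hc] at this ⊢
  exact this

theorem ae_interpolant_eq {G : Finset Rect} (hG : IsRectGrid G) {E : GridExtension G} {γ₀ : ℝ}
    (hE : E.IsAdmissible γ₀) {T : Rect} (hT : T ∈ G) {v : Pt → ℝ} {p : MvPolynomial (Fin 2) ℝ}
    (hp : p.totalDegree ≤ 2) (hv : ∀ᵐ x ∂volume.restrict (E.delta T), v x = eval x p) :
    ∀ᵐ x ∂volume.restrict T.closed, E.interpolant v x = v x := by
  obtain ⟨P, hP, hl, -⟩ := exists_local_setting hG hE hT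
  have hTi := hG.nondegenerate T hT
  have hvT := ae_restrict_of_ae_restrict_of_subset ((GridExtension.closed_subset_patch hE hP hl
    fun _ => none).trans (GridExtension.patch_subset_delta hE hP hl _)) hv
  rw [← T.restrict_inner] at hvT ⊢
  filter_upwards [hvT, ae_restrict_mem T.isOpen_inner.measurableSet] with x hx hxT
  rw [hx, GridExtension.interpolant_eq_eval_localPoly hE hTi hT hP hl v hxT, eval_localPoly,
    ← sum_functional_mul_piece hTi hl (fun τ => hE.ordered _ (hP τ)) hp x]
  refine Finset.sum_congr rfl fun τ _ => ?_
  -- Each of the nine functionals integrates over its own patch, which lies in `Δ_T`, so it does not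
  -- distinguish `v` from `p`.
  rw [Patch.functional_congr (hE.ordered _ (hP τ))
    (ae_restrict_of_ae_restrict_of_subset (GridExtension.patch_subset_delta hE hP hl τ) hv)]

theorem locallyIntegrableOn_congr {U : Set Pt} (hU : MeasurableSet U) {f w : Pt → ℝ}
    (hf : LocallyIntegrableOn f U) (h : ∀ x ∈ U, f x = w x) : LocallyIntegrableOn w U := by
  intro x hx
  obtain ⟨s, hs, hi⟩ := hf x hx
  refine ⟨s ∩ U, Filter.inter_mem hs self_mem_nhdsWithin, ?_⟩
  refine (hi.mono_set Set.inter_subset_left).congr ?_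
  have : ∀ᵐ y ∂volume.restrict U, f y = w y := (ae_restrict_iff' hU).2 (.of_forall h)
  exact ae_restrict_of_ae_restrict_of_subset Set.inter_subset_right this

theorem sobolevSeminorm_interpolant_le {G : Finset Rect} (hG : IsRectGrid G) {E : GridExtension G}
    {γ₀ : ℝ} (hE : E.IsAdmissible γ₀) {T : Rect} (hT : T ∈ G) {v : Pt → ℝ}
    (hv : IntegrableOn v E.domain) {k : ℕ} (hk : k ≤ 2) :
    sobolevSeminorm k T.inner (E.interpolant v) ≤
      ENNReal.ofReal (1944 * max 1 (γ₀ / 2) ^ 10 * (T.size ^ k)⁻¹) *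
        eLpNorm v 2 (volume.restrict (E.delta T)) := by
  obtain ⟨P, hP, hl, hpos, hlen, hTlen, hTsize⟩ := exists_local_setting hG hE hT
  have hTi := hG.nondegenerate T hT
  set g := max 1 (γ₀ / 2)
  have hg : 1 ≤ g := le_max_left _ _
  set N := eLpNorm v 2 (volume.restrict (E.delta T))
  have hmain : ∀ a b, a + b = k → weakDerivNorm T.inner a b (E.interpolant v) ≤
      ENNReal.ofReal (486 * g ^ 6 * (g ^ 2 / T.size) ^ k) * N := by
    intro a b hab
    have hw := isWeakDeriv_eval T.inner a b (localPoly T P v)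
    have heq : ∀ x ∈ T.inner, eval x (localPoly T P v) = E.interpolant v x := fun x hx =>
      (GridExtension.interpolant_eq_eval_localPoly hE hTi hT hP hl v hx).symm
    have hw' := hw.congr_left ((ae_restrict_iff' T.isOpen_inner.measurableSet).2 (.of_forall heq))
      (locallyIntegrableOn_congr T.isOpen_inner.measurableSet hw.1 heq)
    -- The norm is an infimum over weak derivatives, so the polynomial one suffices.
    refine (iInf₂_le _ hw').trans ?_
    rw [T.restrict_inner, ← hab]
    refine eLpNorm_polyDeriv_localPoly_le hg hpos (fun τ => hE.ordered _ (hP τ))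
      (fun τ i j => (hlen τ i j).1) hTlen hTsize (fun τ => ?_) (fun τ => ?_) (by omega)
    · exact (hv.mono_set (GridExtension.patch_subset_domain hP τ)).aestronglyMeasurable
    · exact eLpNorm_mono_measure _
        (Measure.restrict_mono_set _ (GridExtension.patch_subset_delta hE hP hl τ))
  refine (sobolevSeminorm_le (by omega) hmain).trans ?_
  rw [← mul_assoc]
  refine mul_le_mul_left ?_ _
  rw [show (4 : ℝ≥0∞) = ENNReal.ofReal 4 by norm_num, ← ENNReal.ofReal_mul (by norm_num)]
  refine ENNReal.ofReal_le_ofReal ?_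
  rw [div_pow, ← pow_mul]
  have h2k : g ^ (2 * k) ≤ g ^ 4 := pow_le_pow_right₀ hg (by omega)
  calc 4 * (486 * g ^ 6 * (g ^ (2 * k) / T.size ^ k))
      = 1944 * g ^ 6 * g ^ (2 * k) * (T.size ^ k)⁻¹ := by rw [div_eq_mul_inv]; ring
    _ ≤ 1944 * g ^ 6 * g ^ 4 * (T.size ^ k)⁻¹ := by gcongr
    _ = _ := by ring

end RRM

namespace RRM

/-! ### Approximation -/

theorem eLpNorm_two_sq {μ : Measure Pt} (f : Pt → ℝ) :
    eLpNorm f 2 μ ^ 2 = ∫⁻ x, ‖f x‖ₑ ^ 2 ∂μ := by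
  rw [eLpNorm_eq_lintegral_rpow_enorm_toReal (by norm_num) (by norm_num), ← ENNReal.rpow_natCast,
    ← ENNReal.rpow_mul]
  simp

theorem memLp_eval (K : Rect) (p : MvPolynomial (Fin 2) ℝ) :
    MemLp (fun x => eval x p) 2 (volume.restrict K.closed) := by
  have hc := (contDiff_eval p).continuous
  obtain ⟨B, hB⟩ := K.isCompact_closed.exists_bound_of_continuousOn hc.continuousOn
  have : IsFiniteMeasure (volume.restrict K.closed) :=
    ⟨by simpa using K.isCompact_closed.measure_lt_top⟩
  exact MemLp.of_bound hc.aestronglyMeasurable B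
    ((ae_restrict_iff' K.measurableSet_closed).2 (.of_forall hB))

/-- The Poincaré inequality on a shape regular patch around `T`. -/
theorem poincare_patch {M : Patch} {T : Rect} {g h : ℝ} (hg : 1 ≤ g) (hh : 0 < h)
    (hlen : ∀ i j, M.len i j ≤ g * h) (hT : ∀ i, h ≤ g ^ 2 * (T.hi i - T.lo i))
    (hTM : T.inner ⊆ M.inner) {w g₀ g₁ : Pt → ℝ}
    (hw : MemLp w 2 (volume.restrict M.inner)) (hg₀ : MemLp g₀ 2 (volume.restrict M.inner))
    (hg₁ : MemLp g₁ 2 (volume.restrict M.inner)) (H₀ : IsWeakDeriv M.inner 1 0 w g₀)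
    (H₁ : IsWeakDeriv M.inner 0 1 w g₁) (hmean : ∫ x in T.inner, w x = 0) :
    eLpNorm w 2 (volume.restrict M.inner) ≤ ENNReal.ofReal (26 * g ^ 4 * h) *
      (eLpNorm g₀ 2 (volume.restrict M.inner) + eLpNorm g₁ 2 (volume.restrict M.inner)) := by
  have hconv : Convex ℝ M.inner := by
    have : M.inner = Set.univ.pi fun i => Set.Ioo (M i 0) (M i 3) :=
      Rect.inner_eq_pi ⟨fun i => M i 0, fun i => M i 3⟩
    rw [this]
    exact convex_pi fun i _ => convex_Ioo _ _
  have hfin : volume M.inner ≠ ⊤ := by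
    refine ne_top_of_le_ne_top M.volume_closed_ne_top (measure_mono ?_)
    exact Rect.inner_subset_closed ⟨fun i => M i 0, fun i => M i 3⟩
  have hdiam : ∀ x ∈ M.inner, ∀ y ∈ M.inner, ∀ i, |x i - y i| ≤ 3 * g * h := by
    intro x hx y hy i
    have h0 : M i 1 - M i 0 ≤ g * h := hlen i 0
    have h1 : M i 2 - M i 1 ≤ g * h := hlen i 1
    have h2 : M i 3 - M i 2 ≤ g * h := hlen i 2
    have := hx i
    have := hy i
    exact abs_le.2 ⟨by linarith, by linarith⟩
  have main := poincare M.isOpen_inner hconv hfin hdiam T.isOpen_inner.measurableSet hTM hw hg₀ hg₁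
    H₀ H₁ hmean
  simp only [← eLpNorm_two_sq] at main
  set A := eLpNorm w 2 (volume.restrict M.inner)
  set B₀ := eLpNorm g₀ 2 (volume.restrict M.inner)
  set B₁ := eLpNorm g₁ 2 (volume.restrict M.inner)
  have hκ : ∀ i, h / g ^ 2 ≤ T.hi i - T.lo i := fun i =>
    (div_le_iff₀ (by positivity)).2 (by linarith [hT i])
  have hvol : ENNReal.ofReal (h / g ^ 2) ^ 2 ≤ volume T.inner := by
    rw [measure_congr T.inner_ae_eq_closed, Rect.volume_closed, pow_two]
    exact mul_le_mul' (ENNReal.ofReal_le_ofReal (hκ 0)) (ENNReal.ofReal_le_ofReal (hκ 1))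
  -- The patch has extent at most `3gh`, and `8 · 3⁴ = 648 ≤ 26²`.
  have hsq : (ENNReal.ofReal (h / g ^ 2) * A) ^ 2 ≤
      (ENNReal.ofReal (26 * g ^ 2 * h ^ 2) * (B₀ + B₁)) ^ 2 := by
    calc (ENNReal.ofReal (h / g ^ 2) * A) ^ 2 = ENNReal.ofReal (h / g ^ 2) ^ 2 * A ^ 2 := mul_pow _ _ _
      _ ≤ volume T.inner * A ^ 2 := mul_le_mul_left hvol _
      _ ≤ ENNReal.ofReal (8 * (3 * g * h) ^ 4) * (B₀ ^ 2 + B₁ ^ 2) := main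
      _ ≤ ENNReal.ofReal ((26 * g ^ 2 * h ^ 2) ^ 2) * (B₀ + B₁) ^ 2 := by
        refine mul_le_mul' (ENNReal.ofReal_le_ofReal ?_) ?_
        · have : 0 ≤ g ^ 4 * h ^ 4 := by positivity
          nlinarith
        · rw [add_sq]
          exact add_le_add_left le_self_add _
      _ = _ := by rw [ENNReal.ofReal_pow (by positivity), ← mul_pow]
  have hle := (ENNReal.pow_le_pow_left_iff (n := 2) (by norm_num)).1 hsq
  calc A = ENNReal.ofReal (g ^ 2 / h) * (ENNReal.ofReal (h / g ^ 2) * A) := by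
        rw [← mul_assoc, ← ENNReal.ofReal_mul (by positivity),
          show g ^ 2 / h * (h / g ^ 2) = 1 by field_simp]
        simp
    _ ≤ ENNReal.ofReal (g ^ 2 / h) * (ENNReal.ofReal (26 * g ^ 2 * h ^ 2) * (B₀ + B₁)) :=
        mul_le_mul_right hle _
    _ = _ := by
        rw [← mul_assoc, ← ENNReal.ofReal_mul (by positivity)]
        congr 2
        field_simp

/-- A quadratic polynomial is determined by prescribing the means of its derivatives. -/
theorem exists_average_polyDeriv_eq {T : Rect} (hT : ∀ i, T.lo i < T.hi i) {s : ℕ} (hs : s ≤ 3)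
    (c : ℕ → ℕ → ℝ) : ∃ p : MvPolynomial (Fin 2) ℝ, p.totalDegree ≤ 2 ∧
      (∀ a b, a + b < s → ⨍ x in T.closed, eval x (polyDeriv a b p) = c a b) ∧
      ∀ a b, a + b = s → polyDeriv a b p = 0 := by
  -- The system is triangular: second-order coefficients come from the prescribed second
  -- derivatives, then `B`, `D` from the first, then `A` from the value. Prescribing zero from order
  -- `s` on makes the derivatives of order `s` vanish.
  set c' : ℕ → ℕ → ℝ := fun a b => if a + b < s then c a b else 0 with hc'
  have hz : ∀ a b, s ≤ a + b → c' a b = 0 := fun a b h => if_neg (by omega)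
  set m : Fin 2 → ℝ := fun i => (T.lo i + T.hi i) / 2
  set q : Fin 2 → ℝ := fun i => (T.lo i ^ 2 + T.lo i * T.hi i + T.hi i ^ 2) / 3
  set B := c' 1 0 - c' 2 0 * m 0 - c' 1 1 * m 1 with hB
  set D := c' 0 1 - c' 1 1 * m 0 - c' 0 2 * m 1 with hD
  set A := c' 0 0 - B * m 0 - D * m 1 - c' 2 0 / 2 * q 0 - c' 1 1 * (m 0 * m 1) - c' 0 2 / 2 * q 1
    with hA
  refine ⟨quadPoly A B D (c' 2 0 / 2) (c' 1 1) (c' 0 2 / 2), totalDegree_quadPoly_le _ _ _ _ _ _,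
    fun a b hab => ?_, fun a b hab => ?_⟩
  · have e : c a b = c' a b := (if_pos hab).symm
    rw [e]
    have ha : a ≤ 2 := by omega
    have hb : b ≤ 2 - a := by omega
    interval_cases a <;> interval_cases b <;>
      simp only [polyDeriv, Function.iterate_succ_apply, Function.iterate_zero, id,
        pderiv_zero_quadPoly, pderiv_one_quadPoly, Rect.average_quadPoly hT] <;>
      (try simp only [hA, hB, hD]) <;> ring
  · have ha : a ≤ s := by omega
    obtain rfl : b = s - a := by omega
    have z20 := hz 2 0
    have z11 := hz 1 1
    have z02 := hz 0 2
    have z10 := hz 1 0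
    have z01 := hz 0 1
    have z00 := hz 0 0
    interval_cases s <;> interval_cases a <;> norm_num at z20 z11 z02 z10 z01 z00 <;>
      simp only [polyDeriv, Function.iterate_succ_apply, Function.iterate_zero, id,
        pderiv_zero_quadPoly, pderiv_one_quadPoly] <;>
      simp [hA, hB, hD, z20, z11, z02, z10, z01, z00, quadPoly_zero]

end RRM

namespace RRM

/-! ### The error estimate on a cell. -/

theorem isWeakDeriv_zero_self {U : Set Pt} {v : Pt → ℝ} (hv : LocallyIntegrableOn v U) :
    IsWeakDeriv U 0 0 v v :=
  ⟨hv, hv, fun ψ _ _ _ => by simp⟩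

/-- Bounds for weak derivatives with zero means by those of order `s`, on a patch around `T`. -/
theorem eLpNorm_le_of_mean_zero {M : Patch} {T : Rect} {g h : ℝ} (hg : 1 ≤ g) (hh : 0 < h)
    (hlen : ∀ i j, M.len i j ≤ g * h) (hT : ∀ i, h ≤ g ^ 2 * (T.hi i - T.lo i))
    (hTM : T.inner ⊆ M.inner) {v : Pt → ℝ} {w : ℕ → ℕ → Pt → ℝ} {s : ℕ}
    (hw : ∀ a b, a + b ≤ s → IsWeakDeriv M.inner a b v (w a b))
    (hm : ∀ a b, a + b ≤ s → MemLp (w a b) 2 (volume.restrict M.inner))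
    (hmean : ∀ a b, a + b < s → ∫ x in T.inner, w a b x = 0) {N : ℝ≥0∞}
    (hN : ∀ a b, a + b = s → eLpNorm (w a b) 2 (volume.restrict M.inner) ≤ N) (n : ℕ) :
    ∀ a b, a + b + n = s → eLpNorm (w a b) 2 (volume.restrict M.inner) ≤
      ENNReal.ofReal ((52 * g ^ 4 * h) ^ n) * N := by
  induction n with
  | zero => intro a b hab; simpa using hN a b hab
  | succ n ih =>
    intro a b hab
    have h0 := ih (a + 1) b (by omega)
    have h1 := ih a (b + 1) (by omega)
    refine (poincare_patch hg hh hlen hT hTM (hm a b (by omega)) (hm (a + 1) b (by omega))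
      (hm a (b + 1) (by omega)) ((hw a b (by omega)).step_zero (hw (a + 1) b (by omega)))
      ((hw a b (by omega)).step_one (hw a (b + 1) (by omega))) (hmean a b (by omega))).trans ?_
    -- Both components of the gradient satisfy the same bound, hence `52 = 2 · 26` for each order.
    calc _ ≤ ENNReal.ofReal (26 * g ^ 4 * h) * (ENNReal.ofReal ((52 * g ^ 4 * h) ^ n) * N +
          ENNReal.ofReal ((52 * g ^ 4 * h) ^ n) * N) := mul_le_mul_right (add_le_add h0 h1) _
      _ = ENNReal.ofReal (26 * g ^ 4 * h) * 2 * ENNReal.ofReal ((52 * g ^ 4 * h) ^ n) * N := by ring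
      _ = _ := by
        rw [show (2 : ℝ≥0∞) = ENNReal.ofReal 2 by norm_num, ← ENNReal.ofReal_mul (by positivity),
          ← ENNReal.ofReal_mul (by positivity)]
        congr 2
        ring

/-- With `u = v - q`, the error `u - Πu` is bounded by `u`, through the Poincaré chain of length `s
- k`, and by `Πu`, through stability and the chain of length `s`. The factor `h⁻ᵏ` from stability
leaves `h` to the power `s - k` in both. -/
theorem sobolevSeminorm_sub_interpolant_le {G : Finset Rect} (hG : IsRectGrid G)
    {E : GridExtension G} {γ₀ : ℝ} (hE : E.IsAdmissible γ₀) {T : Rect} (hT : T ∈ G) {v : Pt → ℝ}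
    (hv : IntegrableOn v E.domain) {k s : ℕ} (hks : k ≤ s) (hs : s ≤ 3)
    (hvs : MemSobolev s (interior (E.delta T)) v) :
    sobolevSeminorm k T.inner (fun x => v x - E.interpolant v x) ≤
      ENNReal.ofReal (1948 * 52 ^ 3 * max 1 (γ₀ / 2) ^ 24 * T.size ^ (s - k)) *
        sobolevSeminorm s (interior (E.delta T)) v := by
  obtain ⟨P, hP, hl, hpos, hlen, hTlen, hTsize⟩ := exists_local_setting hG hE hT
  have hTi := hG.nondegenerate T hT
  set g := max 1 (γ₀ / 2)
  have hg : 1 ≤ g := le_max_left _ _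
  set U := interior (E.delta T) with hU
  set X := sobolevSeminorm s U v
  set h := T.size
  have hUo : IsOpen U := isOpen_interior
  have hord := fun τ => hE.ordered _ (hP τ)
  have hPU : ∀ τ, (P τ).inner ⊆ U := fun τ => by
    refine interior_maximal (subset_trans ?_ (GridExtension.patch_subset_delta hE hP hl τ))
      (P τ).isOpen_inner
    exact Rect.inner_subset_closed ⟨fun i => P τ i 0, fun i => P τ i 3⟩
  have hTP : ∀ τ, T.inner ⊆ (P τ).inner := fun τ => by
    have := Patch.cell_inner_subset (hord τ) fun i => pos (τ i)
    rwa [hl.cell_eq τ] at this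
  have hTU : T.inner ⊆ U := (hTP fun _ => none).trans (hPU _)
  have hex : ∀ a b, ∃ f, a + b ≤ s → IsWeakDeriv U a b v f ∧ MemLp f 2 (volume.restrict U) := by
    intro a b
    -- Orders above `s` get the dummy value `0`, so that `f` is a total family.
    by_cases hab : a + b ≤ s
    · obtain ⟨f, hf⟩ := hvs a b hab
      exact ⟨f, fun _ => hf⟩
    · exact ⟨0, fun h => absurd h hab⟩
  choose f hf using hex
  obtain ⟨q, hq2, hqm, hqs⟩ := exists_average_polyDeriv_eq hTi hs
    fun a b => ⨍ x in T.closed, f a b x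
  set w : ℕ → ℕ → Pt → ℝ := fun a b x => f a b x - eval x (polyDeriv a b q) with hw
  set u : Pt → ℝ := fun x => v x - eval x q with hu
  have hwU : ∀ a b, a + b ≤ s → IsWeakDeriv U a b u (w a b) := fun a b hab =>
    (hf a b hab).1.sub (isWeakDeriv_eval U a b q)
  have hmem : ∀ τ a b, a + b ≤ s → MemLp (w a b) 2 (volume.restrict (P τ).inner) := by
    intro τ a b hab
    refine MemLp.sub ((hf a b hab).2.mono_measure (Measure.restrict_mono_set _ (hPU τ))) ?_
    rw [Patch.restrict_inner]
    exact memLp_eval ⟨fun i => P τ i 0, fun i => P τ i 3⟩ _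
  have hvT : volume.real T.closed ≠ 0 := by
    have h0 := sub_pos.2 (hTi 0)
    have h1 := sub_pos.2 (hTi 1)
    rw [Rect.volume_real_closed hTi]
    positivity
  have hmean : ∀ a b, a + b < s → ∫ x in T.inner, w a b x = 0 := by
    intro a b hab
    rw [T.restrict_inner]
    have hfi : IntegrableOn (f a b) T.closed := by
      rw [IntegrableOn, ← T.restrict_inner]
      refine integrableOn_of_memLp_two ?_ ((hf a b hab.le).2.mono_measure
        (Measure.restrict_mono_set _ hTU))
      rw [measure_congr T.inner_ae_eq_closed]
      exact T.isCompact_closed.measure_lt_top.ne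
    have := hqm a b hab
    simp only [setAverage_eq, smul_eq_mul] at this
    rw [integral_sub hfi (T.integrableOn_eval _),
      mul_left_cancel₀ (inv_ne_zero hvT) this, sub_self]
  have hX : ∀ τ a b, a + b = s → eLpNorm (w a b) 2 (volume.restrict (P τ).inner) ≤ X := by
    intro τ a b hab
    have hwf : w a b = f a b := by
      funext x
      simp [hw, hqs a b hab]
    rw [hwf]
    calc _ ≤ eLpNorm (f a b) 2 (volume.restrict U) :=
          eLpNorm_mono_measure _ (Measure.restrict_mono_set _ (hPU τ))
      _ = weakDerivNorm U a b v := ((hf a b hab.le).1.weakDerivNorm_eq hUo).symm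
      _ ≤ X := by
        have := weakDerivNorm_le_sobolevSeminorm U a b v
        rwa [hab] at this
  have hbound : ∀ τ n a b, a + b + n = s → eLpNorm (w a b) 2 (volume.restrict (P τ).inner) ≤
      ENNReal.ofReal ((52 * g ^ 4 * h) ^ n) * X := fun τ n =>
    eLpNorm_le_of_mean_zero hg hpos (fun i j => (hlen τ i j).2) hTlen (hTP τ)
      (fun a b hab => (hwU a b hab).mono (hPU τ)) (hmem τ) hmean (hX τ) n
  have hvP : ∀ τ, IntegrableOn v (P τ).closed := fun τ =>
    hv.mono_set (GridExtension.patch_subset_domain hP τ)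
  have hqP : ∀ τ, IntegrableOn (fun x => eval x q) (P τ).closed := fun τ =>
    Rect.integrableOn_eval ⟨fun i => P τ i 0, fun i => P τ i 3⟩ q
  have huP : ∀ τ, IntegrableOn u (P τ).closed := fun τ => (hvP τ).sub (hqP τ)
  have huN : ∀ τ, eLpNorm u 2 (volume.restrict (P τ).closed) ≤
      ENNReal.ofReal ((52 * g ^ 4 * h) ^ s) * X := by
    intro τ
    -- The chosen derivative of order zero need not be `u` itself, but agrees with it almost
    -- everywhere.
    have h00 := (hwU 0 0 (by omega)).mono (hPU τ)
    have hae := (isWeakDeriv_zero_self h00.1).ae_eq (P τ).isOpen_inner h00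
    rw [← Patch.restrict_inner, eLpNorm_congr_ae hae]
    exact hbound τ s 0 0 (by omega)
  -- The quadratic `q` drops out of the error because it is reproduced on `T`.
  have hpoint : ∀ x ∈ T.inner,
      u x - eval x (localPoly T P u) = v x - E.interpolant v x := by
    intro x hx
    rw [GridExtension.interpolant_eq_eval_localPoly hE hTi hT hP hl v hx, eval_localPoly,
      eval_localPoly]
    have h1 := sum_functional_mul_piece hTi hl hord hq2 x
    have h2 : ∀ τ, (P τ).functional u = (P τ).functional v - (P τ).functional fun y => eval y q :=
      fun τ => Patch.functional_sub (hord τ) (hvP τ) (hqP τ)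
    simp only [h2, sub_mul, Finset.sum_sub_distrib, h1]
    simp only [hu]
    ring
  have hmain : ∀ a b, a + b = k → weakDerivNorm T.inner a b (fun x => v x - E.interpolant v x) ≤
      ENNReal.ofReal (487 * 52 ^ 3 * g ^ 24 * h ^ (s - k)) * X := by
    intro a b hab
    have hd := ((hwU a b (by omega)).mono hTU).sub (isWeakDeriv_eval T.inner a b (localPoly T P u))
    have hd' := hd.congr_left
      ((ae_restrict_iff' T.isOpen_inner.measurableSet).2 (.of_forall hpoint))
      (locallyIntegrableOn_congr T.isOpen_inner.measurableSet hd.1 hpoint)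
    refine (iInf₂_le _ hd').trans ?_
    have hwT : MemLp (w a b) 2 (volume.restrict T.inner) :=
      (hmem (fun _ => none) a b (by omega)).mono_measure (Measure.restrict_mono_set _ (hTP _))
    refine (eLpNorm_sub_le hwT.1 (contDiff_eval _).continuous.aestronglyMeasurable
      (by norm_num)).trans ?_
    have e1 : eLpNorm (w a b) 2 (volume.restrict T.inner) ≤
        ENNReal.ofReal ((52 * g ^ 4 * h) ^ (s - k)) * X :=
      (eLpNorm_mono_measure _ (Measure.restrict_mono_set _ (hTP fun _ => none))).trans
        (hbound _ (s - k) a b (by omega))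
    have e2 := eLpNorm_polyDeriv_localPoly_le hg hpos hord (fun τ i j => (hlen τ i j).1) hTlen
      hTsize (fun τ => (huP τ).aestronglyMeasurable) huN (show a + b ≤ 3 by omega)
    rw [← T.restrict_inner, hab, ← mul_assoc, ← ENNReal.ofReal_mul (by positivity)] at e2
    refine (add_le_add e1 e2).trans ?_
    rw [← add_mul, ← ENNReal.ofReal_add (by positivity) (by positivity)]
    refine mul_le_mul_left (ENNReal.ofReal_le_ofReal ?_) _
    have hD : 1 ≤ 52 * g ^ 4 := by
      have := one_le_pow₀ hg (n := 4)
      linarith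
    have t1 : (52 * g ^ 4) ^ (s - k) ≤ (52 * g ^ 4) ^ 3 := pow_le_pow_right₀ hD (by omega)
    have t2 : (52 * g ^ 4) ^ s ≤ (52 * g ^ 4) ^ 3 := pow_le_pow_right₀ hD hs
    have t3 : (g ^ 2) ^ k ≤ (g ^ 2) ^ 3 := pow_le_pow_right₀ (one_le_pow₀ hg) (by omega)
    have t4 : h ^ s = h ^ (s - k) * h ^ k := by rw [← pow_add]; congr 1; omega
    have t5 : (1 : ℝ) ≤ g ^ 12 := one_le_pow₀ hg
    -- All exponents of quantities at least `1` are raised to `3`. Then `487 = 1 + 486`, and `g ^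
    -- 24` consists of `g ^ 12` from the Poincaré chain and `g ^ 12` from stability.
    calc (52 * g ^ 4 * h) ^ (s - k) + 486 * g ^ 6 * (g ^ 2 / h) ^ k * (52 * g ^ 4 * h) ^ s
        = (52 * g ^ 4) ^ (s - k) * h ^ (s - k) +
          486 * g ^ 6 * (g ^ 2) ^ k * (52 * g ^ 4) ^ s * h ^ (s - k) := by
          rw [mul_pow _ h, mul_pow _ h, t4, div_pow]
          field_simp
      _ ≤ (52 * g ^ 4) ^ 3 * h ^ (s - k) +
          486 * g ^ 6 * (g ^ 2) ^ 3 * (52 * g ^ 4) ^ 3 * h ^ (s - k) := by gcongr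
      _ = (1 + 486 * g ^ 12) * (52 ^ 3 * g ^ 12 * h ^ (s - k)) := by ring
      _ ≤ (487 * g ^ 12) * (52 ^ 3 * g ^ 12 * h ^ (s - k)) := by gcongr; linarith
      _ = _ := by ring
  refine (sobolevSeminorm_le (by omega) hmain).trans (le_of_eq ?_)
  rw [← mul_assoc, show (4 : ℝ≥0∞) = ENNReal.ofReal 4 by norm_num,
    ← ENNReal.ofReal_mul (by norm_num)]
  congr 2
  ring

end RRM

/-! ### The lemma. -/

theorem lemma3p6 (γ₀ : ℝ) :
    ∃ C : ℝ, 0 < C ∧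
      ∀ (G : Finset RRM.Rect), RRM.IsRectGrid G →
      ∀ (E : RRM.GridExtension G), E.IsAdmissible γ₀ →
      ∀ T ∈ G,
        (∀ v : RRM.Pt → ℝ, IntegrableOn v E.domain →
          ∀ p : MvPolynomial (Fin 2) ℝ, p.totalDegree ≤ 2 →
          (∀ᵐ x ∂volume.restrict (E.delta T), v x = MvPolynomial.eval x p) →
          ∀ᵐ x ∂volume.restrict T.closed, E.interpolant v x = v x) ∧
        (∀ v : RRM.Pt → ℝ, IntegrableOn v E.domain →
          ∀ k : ℕ, k ≤ 2 →
          RRM.sobolevSeminorm k T.inner (E.interpolant v) ≤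
            ENNReal.ofReal (C * (T.size ^ k)⁻¹) *
              eLpNorm v 2 (volume.restrict (E.delta T))) ∧
        (∀ v : RRM.Pt → ℝ, IntegrableOn v E.domain →
          ∀ k s : ℕ, k ≤ s → s ≤ 3 →
          RRM.MemSobolev s (interior (E.delta T)) v →
          RRM.sobolevSeminorm k T.inner (fun x => v x - E.interpolant v x) ≤
            ENNReal.ofReal (C * T.size ^ (s - k)) *
              RRM.sobolevSeminorm s (interior (E.delta T)) v) := by
  have hg : (1 : ℝ) ≤ max 1 (γ₀ / 2) := le_max_left _ _
  -- The constant of the error estimate, with `1948 = 4 · 487`; it dominates the stability constant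
  -- `1944 g ^ 10` because `g = max 1 (γ₀ / 2)` is at least `1`.
  refine ⟨1948 * 52 ^ 3 * max 1 (γ₀ / 2) ^ 24, by positivity, fun G hG E hE T hT =>
    ⟨fun v _ p hp hvp => RRM.ae_interpolant_eq hG hE hT hp hvp, fun v hv k hk => ?_,
      fun v hv k s hks hs hvs => RRM.sobolevSeminorm_sub_interpolant_le hG hE hT hv hks hs hvs⟩⟩
  have hpos : 0 < T.size :=
    (sub_pos.2 (hG.nondegenerate T hT 0)).trans_le (le_max_left _ _)
  refine (RRM.sobolevSeminorm_interpolant_le hG hE hT hv hk).trans (mul_le_mul_left ?_ _)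
  refine ENNReal.ofReal_le_ofReal ?_
  have hpow : max 1 (γ₀ / 2) ^ 10 ≤ max 1 (γ₀ / 2) ^ 24 := pow_le_pow_right₀ hg (by norm_num)
  gcongr
  norm_num
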